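/- **Setting.** Let $D\subseteq\mathbb R$ be Borel, $K:D\times D\to\mathbb R$ a measurable reproducing kernel (symmetric, positive semidefinite) with an anchor $c\in D$, $K(c,c)=0$, and $\rho$ a probability measure on $D$ with $M:=\int_D K(x,x)\,\rho(dx)<\infty$ and $C_0:=\int_D\int_D K(x,y)\,\rho(dx)\rho(dy)>0$. For finite $u\subset\mathbb N=\{1,2,\dots\}$ let $H_u$ be the reproducing kernel Hilbert space on $D^u$ with kernel $K_u(\boldsymbol x,\boldsymbol y)=\prod_{j\in u}K(x_j,y_j)$, and $H=H_{\{1\}}$. Let $\boldsymbol\gamma=(\gamma_u)$ be POD weights: $\gamma_u=\Gamma_{|u|}\prod_{j\in u}\gamma_j$ with $\gamma_1\ge\gamma_2\ge\dots\ge0$, $\Gamma_0=\Gamma_1=1$, $\Gamma_k\ge0$; assume $\sum_u\gamma_uM^{|u|}<\infty$ and that $\gamma_u>0$ for some $u\ne\emptyset$. Let $\mathcal H_{\boldsymbol\gamma}$ be the reproducing kernel Hilbert space with kernel $\sum_u\gamma_uK_u$ on $\mathfrak X=\{\boldsymbol x\in D^{\mathbb N}:\sum_u\gamma_u\prod_{j\in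 u}K(x_j,x_j)<\infty\}$; each $f\in\mathcal H_{\boldsymbol\gamma}$ has the anchored decomposition $f=\sum_u f_u$, $f_u(\boldsymbol x)=\sum_{v\subseteq u}(-1)^{|u\setminus v|}f(\boldsymbol x_v;\boldsymbol c)$, where $(\boldsymbol x_v;\boldsymbol c)$ has the coordinates $x_j$ for $j\in v$ and $c$ otherwise. Let $I(f)=\int_{\mathfrak X} f\,d\rho^{\mathbb N}$. Algorithms are $Q(f)=\sum_{i=1}^na_if(\boldsymbol t_{v_i};\boldsymbol c)$ with $n\ge0$, $a_i\in\mathbb R$, finite sets $v_i\subset\mathbb N$ and $\boldsymbol t_{v_i}\in(D\setminus\{c\})^{v_i}$; $e(Q;\mathcal H_{\boldsymbol\gamma})=\sup_{\|f\|\le1}|I(f)-Q(f)|$, and analogously on $H_u$ for integration with respect to $\rho^u$; $e(n;H)$ is the infimum of the errors on $H$ of the quadratures with $n$ nodes. For a non-decreasing $\$:\mathbb N_0\to[1,\infty)$ put $\mathrm{cost}_{\rm unr}(Q)=\sum_i\$(|v_i|)$ and $\mathrm{comp}(\varepsilon)=\inf\{\mathrm{cost}_{\rm unr}(Q):e(Q;\mathcal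 H_{\boldsymbol\gamma})\le\varepsilon\}$. The problem is strongly tractable if there are $B,p\ge0$ with $\mathrm{comp}(\varepsilon)\le B\varepsilon^{-p}$ for all $\varepsilon>0$, and $p^{\rm unr}$ is the infimum of all such $p$. Put $\widehat\gamma_u=\gamma_uC_0^{|u|}$. For $\sigma\in\mathbb N\cup\{\infty\}$ let $u_1,u_2,\dots$ be the sets $u$ with $1\le|u|\le\sigma$ and $\gamma_u>0$, ordered such that $\widehat\gamma_{u_1}\ge\widehat\gamma_{u_2}\ge\cdots$, and $\mathrm{decay}_{\boldsymbol\gamma,\sigma}=\sup\{p\in\mathbb R:\lim_j\widehat\gamma_{u_j}j^p=0\}\in(-\infty,\infty]$ (it is $\infty$ if the list is finite); $\mathrm{decay}_{\boldsymbol\gamma}=\mathrm{decay}_{\boldsymbol\gamma,\infty}$. Assume $\mathrm{decay}_{\boldsymbol\gamma,1}>1$ and that there are a real $q<\mathrm{decay}_{\boldsymbol\gamma,1}$ and $C_q>0$ with $\Gamma_k\le C_q(k!)^q$ for all $k\ge1$. Conventions: $1/\infty=0$, $\infty\cdot a=\infty/2=\infty-1=\infty$ ($a>0$). **Building blocks.**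 For $\tau>0$ consider the condition that there are $a,C>0$, $\lambda_1\ge0$, $\lambda_2\in[0,1]$ and, for all finite $u\neq\emptyset$ and $n\ge1$, quadratures $Q_{n,u}$ with $n$ nodes in $D^u$ such that $$e(Q_{n,u};H_u)^2\le\frac{a\,C^{|u|}}{(n+1)^{2\tau}}\Bigl(1+\frac{\ln(n+1)}{(|u|-1)^{\lambda_2}}\Bigr)^{\lambda_1(|u|-1)^{\lambda_2}}\qquad(*)$$ (the last factor being $1$ for $|u|=1$). **Theorem.** 1. Let $0<\lambda_0<1-1/\mathrm{decay}_{\boldsymbol\gamma}$ and $0<\tau<\lambda_0\,\mathrm{decay}_{\boldsymbol\gamma}/2$, and let $(*)$ hold with constants $a\ge1$, $C\ge C_0$ (which may be assumed) and quadratures $Q_{n,u}$. Put $L=\sum_{u\ne\emptyset}\gamma_u^{1-\lambda_0}$ and $\theta_u=\gamma_u^{\lambda_0}L\,a\,C^{|u|}$. For $\varepsilon>0$ let $n_u=0$ if $\theta_u\le\varepsilon^2$ and $n_u=\lfloor(\theta_u\varepsilon^{-2})^{1/(2\tau)}\rfloor$ otherwise, let $d(\varepsilon)=\max\{\ell\ge1:\theta_{\{1,\dots,\ell\}}>\varepsilon^2\}$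 ($0$ if there is no such $\ell$), and $Q^{\rm CD}_\varepsilon(f)=f(\boldsymbol c)+\sum_{u\neq\emptyset,\,n_u\ge1}Q_{n_u,u}(f_u)$, where each $f_u(\boldsymbol x)$ is evaluated by the formula above. Then for every $\varepsilon>0$ only finitely many $n_u$ are non-zero, the maximum is over a finite set, and $n_u=0$ if $|u|>d(\varepsilon)$. As $\varepsilon\to0$, $$e(Q^{\rm CD}_\varepsilon;\mathcal H_{\boldsymbol\gamma})\le\varepsilon^{1-o(1)},\qquad \mathrm{cost}_{\rm unr}(Q^{\rm CD}_\varepsilon)=O\bigl(\$(d(\varepsilon))\,\varepsilon^{-1/\tau}\bigr),\qquad d(\varepsilon)=O\Bigl(\frac{\ln(1/\varepsilon)}{\ln\ln(1/\varepsilon)}\Bigr)=o(\ln(1/\varepsilon)).$$ 2. Suppose $\$(d)=O(e^{\ell d})$ for some $\ell\ge0$. If $(*)$ can be satisfied for some $\tau>0$, then integration on $\mathcal H_{\boldsymbol\gamma}$ is strongly tractable and $$p^{\rm unr}\le\max\Bigl\{\frac1\tau,\frac2{\mathrm{decay}_{\boldsymbol\gamma}-1}\Bigr\}.$$ 3. Suppose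 in addition that $\$(d)=\Omega(d)$, that $e(n;H)=\Omega(n^{-\alpha})$ for some $\alpha>0$, and that $(*)$ can be satisfied for $\tau$ arbitrarily close to $\alpha$. Then $$p^{\rm unr}=\max\Bigl\{\frac1\alpha,\frac2{\mathrm{decay}_{\boldsymbol\gamma}-1}\Bigr\}.$$ -/

import Mathlib

open MeasureTheory Filter Topology Asymptotics
open scoped ENNReal

noncomputable section

namespace InfInt

/-! ### Reproducing kernel Hilbert spaces and worst case errors -/

/-- The closed unit ball of the reproducing kernel Hilbert space `H(k)`, as a set of functions:
`f` belongs to it iff `f` is (the function represented by) an element of norm at most one of a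
Hilbert space of functions on `X` whose reproducing kernel is `k`. -/
def unitBall {X : Type} (k : X → X → ℝ) : Set (X → ℝ) :=
  {f | ∃ (H : Type) (_ : NormedAddCommGroup H) (_ : InnerProductSpace ℝ H)
      (_ : CompleteSpace H) (_ : RKHS ℝ H X ℝ),
      (∀ x y : X, RKHS.kernel H x y 1 = k x y) ∧ ∃ g : H, ‖g‖ ≤ 1 ∧ ⇑g = f}

/-- Worst case error over the unit ball of `H(k)` of the functional `Q` as an approximation of
integration with respect to `μ`. -/
def worstCaseError {X : Type} [MeasurableSpace X] (k : X → X → ℝ) (μ : Measure X)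
    (Q : (X → ℝ) → ℝ) : ℝ≥0∞ :=
  ⨆ f ∈ unitBall k, ENNReal.ofReal |∫ x, f x ∂μ - Q f|

/-- The quadrature with `n` coefficients and `n` nodes. -/
def quad {X : Type} {n : ℕ} (q : Fin n → ℝ × X) (f : X → ℝ) : ℝ :=
  ∑ i, (q i).1 * f (q i).2

/-- The `n`-th minimal worst case error `e(n; H(k))`. -/
def minError {X : Type} [MeasurableSpace X] (k : X → X → ℝ) (μ : Measure X) (n : ℕ) : ℝ≥0∞ :=
  ⨅ q : Fin n → ℝ × X, worstCaseError k μ (quad q)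

/-! ### The weighted space of functions of infinitely many variables

Coordinates are numbered `0, 1, 2, …`, so that the set of the first `d` coordinates is
`Finset.range d`. -/

variable {D : Set ℝ}

/-- `M = ∫ K(x,x) ρ(dx)`. -/
def constM (K : D → D → ℝ) (ρ : Measure D) : ℝ := ∫ x, K x x ∂ρ

/-- `C₀ = ∫∫ K(x,y) ρ(dx) ρ(dy)`. -/
def constC₀ (K : D → D → ℝ) (ρ : Measure D) : ℝ := ∫ x, ∫ y, K x y ∂ρ ∂ρ

/-- The kernel `K_u`, on `D^u`. -/
def kernelOn (K : D → D → ℝ) (u : Finset ℕ) (x y : u → D) : ℝ := ∏ j, K (x j) (y j)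

/-- The domain `𝔛` of the functions of infinitely many variables. -/
def domain (K : D → D → ℝ) (γ : Finset ℕ → ℝ) : Set (ℕ → D) :=
  {x | Summable fun u : Finset ℕ => γ u * ∏ j ∈ u, K (x j) (x j)}

/-- The kernel `𝒦_γ` on `𝔛`. -/
def kernelInf (K : D → D → ℝ) (γ : Finset ℕ → ℝ) (x y : domain K γ) : ℝ :=
  ∑' u : Finset ℕ, γ u * ∏ j ∈ u, K (x.1 j) (y.1 j)

/-- The infinite product measure of `ρ`, as a measure on `𝔛`. -/
def measureInf (K : D → D → ℝ) (γ : Finset ℕ → ℝ) (ρ : Measure D) [IsProbabilityMeasure ρ] :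
    Measure (domain K γ) :=
  (Measure.infinitePi fun _ : ℕ => ρ).comap Subtype.val

/-! ### Admissible algorithms, cost and complexity -/

/-- An admissible sample point `(t_v; c)` with `t_v ∈ (D \ {c})^v`; here `v` is `supp`. -/
structure Node (c : D) where
  supp : Finset ℕ
  pt : ℕ → D
  pt_ne_iff : ∀ j, pt j ≠ c ↔ j ∈ supp

open Classical in
/-- The admissible sample point `(y_v; c)`. -/
def Node.restrict (c : D) (v : Finset ℕ) (y : ℕ → D) : Node c where
  supp := v.filter fun j => y j ≠ c
  pt j := if j ∈ v then y j else c
  pt_ne_iff j := by by_cases h : j ∈ v <;> simp [h]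

/-- Admissible sample points lie in `𝔛`. -/
theorem Node.mem_domain {K : D → D → ℝ} {c : D} (hc : K c c = 0) (γ : Finset ℕ → ℝ)
    (t : Node c) : t.pt ∈ domain K γ := by
  refine summable_of_ne_finset_zero (s := t.supp.powerset) fun u hu => ?_
  rw [Finset.mem_powerset, Finset.not_subset] at hu
  obtain ⟨j, hj, hjs⟩ := hu
  have h : t.pt j = c := by
    by_contra hne
    exact hjs ((t.pt_ne_iff j).1 hne)
  rw [Finset.prod_eq_zero hj (by rw [h, hc]), mul_zero]

/-- A linear algorithm `Q(f) = ∑ aᵢ f(t_{vᵢ}; c)`, as the list of the pairs of a coefficient and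
an admissible sample point. -/
abbrev Algorithm (c : D) := List (ℝ × Node c)

open Classical in
/-- The value `f(y)` of a function `f` on `𝔛`; it is only used for points `y` of `𝔛`, see
`Node.mem_domain`. -/
def evalAt {K : D → D → ℝ} {γ : Finset ℕ → ℝ} (f : domain K γ → ℝ) (y : ℕ → D) : ℝ :=
  if h : y ∈ domain K γ then f ⟨y, h⟩ else 0

/-- The value `Q(f)`. -/
def Algorithm.apply {K : D → D → ℝ} {γ : Finset ℕ → ℝ} {c : D} (Q : Algorithm c)
    (f : domain K γ → ℝ) : ℝ :=
  (Q.map fun p => p.1 * evalAt f p.2.pt).sum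

/-- The worst case error `e(Q; ℋ_γ)`. -/
def algError (K : D → D → ℝ) (γ : Finset ℕ → ℝ) (ρ : Measure D) [IsProbabilityMeasure ρ]
    {c : D} (Q : Algorithm c) : ℝ≥0∞ :=
  worstCaseError (kernelInf K γ) (measureInf K γ ρ) Q.apply

/-- Cost of `Q` in the unrestricted subspace sampling model with cost function `price`:
sampling at `(t_v; c)` costs `price |v|`. -/
def costUnr (price : ℕ → ℝ) {c : D} (Q : Algorithm c) : ℝ :=
  (Q.map fun p => price p.2.supp.card).sum

/-- The `ε`-complexity in the unrestricted subspace sampling model. -/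
def compUnr (K : D → D → ℝ) (c : D) (γ : Finset ℕ → ℝ) (ρ : Measure D) [IsProbabilityMeasure ρ]
    (price : ℕ → ℝ) (ε : ℝ) : ℝ≥0∞ :=
  ⨅ (Q : Algorithm c) (_ : algError K γ ρ Q ≤ ENNReal.ofReal ε), ENNReal.ofReal (costUnr price Q)

/-- `comp(ε) ≤ B ε^{-p}` for all `ε > 0`, with non-negative `B` and `p`. -/
def TractableWith (K : D → D → ℝ) (c : D) (γ : Finset ℕ → ℝ) (ρ : Measure D)
    [IsProbabilityMeasure ρ] (price : ℕ → ℝ) (p : ℝ) : Prop :=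
  0 ≤ p ∧ ∃ B : ℝ, 0 ≤ B ∧ ∀ ε : ℝ, 0 < ε →
    compUnr K c γ ρ price ε ≤ ENNReal.ofReal (B * ε ^ (-p))

/-- Strong tractability in the unrestricted subspace sampling model. -/
def StronglyTractable (K : D → D → ℝ) (c : D) (γ : Finset ℕ → ℝ) (ρ : Measure D)
    [IsProbabilityMeasure ρ] (price : ℕ → ℝ) : Prop :=
  ∃ p : ℝ, TractableWith K c γ ρ price p

/-- The exponent of strong tractability `p^unr`. -/
def expUnr (K : D → D → ℝ) (c : D) (γ : Finset ℕ → ℝ) (ρ : Measure D) [IsProbabilityMeasure ρ]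
    (price : ℕ → ℝ) : EReal :=
  ⨅ (p : ℝ) (_ : TractableWith K c γ ρ price p), (p : EReal)

/-! ### Weights -/

/-- Product and order-dependent weights `γ_u = Γ_{|u|} ∏_{j ∈ u} g_j`. -/
structure IsPOD (γ : Finset ℕ → ℝ) (Γ : ℕ → ℝ) (g : ℕ → ℝ) : Prop where
  eq : ∀ u : Finset ℕ, γ u = Γ u.card * ∏ j ∈ u, g j
  antitone : Antitone g
  nonneg : ∀ j, 0 ≤ g j
  order_zero : Γ 0 = 1
  order_one : Γ 1 = 1
  order_nonneg : ∀ k, 0 ≤ Γ k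

open Classical in
/-- The cut-off weights of order `σ`; for `σ = ∞` these are the weights themselves. -/
def cutOff (γ : Finset ℕ → ℝ) (σ : ℕ∞) (u : Finset ℕ) : ℝ :=
  if (u.card : ℕ∞) ≤ σ then γ u else 0

/-- The weights `γ̂_u = γ_u C₀^{|u|}`. -/
def hat (γ : Finset ℕ → ℝ) (C₀ : ℝ) (u : Finset ℕ) : ℝ := γ u * C₀ ^ u.card

/-- The non-empty sets with positive weight. -/
def activeSets (γ : Finset ℕ → ℝ) : Set (Finset ℕ) := {u | u.Nonempty ∧ 0 < γ u}

/-- `e 0, e 1, …` (up to the number of elements of `S`, which may be finite) lists the distinct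
elements of `S` in an order in which the values of `w` do not increase. -/
def IsOrdering (S : Set (Finset ℕ)) (w : Finset ℕ → ℝ) (e : ℕ → Finset ℕ) : Prop :=
  Set.BijOn e {j | (j : ℕ∞) < S.encard} S ∧ AntitoneOn (w ∘ e) {j | (j : ℕ∞) < S.encard}

open Classical in
/-- `w(u_j) j^p → 0`, where `u_1, u_2, …` are the elements of `S` ordered such that `w` does not
increase (`e j` is `u_{j+1}`). A finite list is continued by zeros. -/
def DecaysWith (S : Set (Finset ℕ)) (w : Finset ℕ → ℝ) (p : ℝ) : Prop :=
  ∃ e : ℕ → Finset ℕ, IsOrdering S w e ∧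
    Tendsto (fun j : ℕ => if (j : ℕ∞) < S.encard then w (e j) * ((j : ℝ) + 1) ^ p else 0)
      atTop (𝓝 0)

/-- `decay_{γ,σ}`; it is `∞` if only finitely many sets are active. -/
def decay (γ : Finset ℕ → ℝ) (C₀ : ℝ) (σ : ℕ∞) : EReal :=
  ⨆ (p : ℝ) (_ : DecaysWith (activeSets (cutOff γ σ)) (hat (cutOff γ σ) C₀) p), (p : EReal)

/-! ### Changing dimension algorithms -/

/-- Building blocks: for every `u` and `n`, a quadrature with `n` nodes in `D^u`. -/
abbrev Blocks (D : Set ℝ) := ∀ (u : Finset ℕ) (n : ℕ), Fin n → ℝ × (u → D)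

/-- The logarithmic factor in the error bound for the building blocks on `k` variables. -/
def logFactor (l₁ l₂ : ℝ) (k n : ℕ) : ℝ :=
  if k = 1 then 1
  else (1 + Real.log (n + 1) / ((k : ℝ) - 1) ^ l₂) ^ (l₁ * ((k : ℝ) - 1) ^ l₂)

/-- The error bound for the building blocks. -/
def BlockBound (K : D → D → ℝ) (ρ : Measure D) [IsProbabilityMeasure ρ]
    (a C τ l₁ l₂ : ℝ) (q : Blocks D) : Prop :=
  ∀ (u : Finset ℕ) (n : ℕ), u.Nonempty → 1 ≤ n →
    worstCaseError (kernelOn K u) (Measure.pi fun _ : u => ρ) (quad (q u n)) ^ 2 ≤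
      ENNReal.ofReal (a * C ^ u.card / ((n : ℝ) + 1) ^ (2 * τ) * logFactor l₁ l₂ u.card n)

/-- There are building blocks with rate `τ`. -/
def HasBlocks (K : D → D → ℝ) (ρ : Measure D) [IsProbabilityMeasure ρ] (τ : ℝ) : Prop :=
  ∃ a C l₁ l₂ : ℝ, 0 < a ∧ 0 < C ∧ 0 ≤ l₁ ∧ 0 ≤ l₂ ∧ l₂ ≤ 1 ∧
    ∃ q : Blocks D, BlockBound K ρ a C τ l₁ l₂ q

/-- `L_r = ∑_{u ≠ ∅} γ_u^r`. -/
def sumPow (γ : Finset ℕ → ℝ) (r : ℝ) : ℝ := ∑' u : {u : Finset ℕ // u.Nonempty}, γ u.1 ^ r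

/-- The quantity `γ_u^{λ₀} L_{1-λ₀} c C^{|u|}`, with `a` in place of `c` and `l₀` of `λ₀`. -/
def threshold (γ : Finset ℕ → ℝ) (l₀ a C : ℝ) (u : Finset ℕ) : ℝ :=
  γ u ^ l₀ * sumPow γ (1 - l₀) * a * C ^ u.card

open Classical in
/-- The number `n_u(ε, λ₀)` of samples spent on `u`. -/
def numSamples (γ : Finset ℕ → ℝ) (l₀ a C τ ε : ℝ) (u : Finset ℕ) : ℕ :=
  if threshold γ l₀ a C u ≤ ε ^ 2 then 0
  else ⌊(threshold γ l₀ a C u / ε ^ 2) ^ (1 / (2 * τ))⌋₊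

/-- The non-empty sets `u` with `n_u ≥ 1`. -/
def usedSets (γ : Finset ℕ → ℝ) (l₀ a C τ ε : ℝ) : Set (Finset ℕ) :=
  {u | u.Nonempty ∧ 1 ≤ numSamples γ l₀ a C τ ε u}

open Classical in
/-- The algorithm `f ↦ ∑ᵢ aᵢ f_u(xᵢ)` for nodes `xᵢ ∈ D^u`, where `f_u` is the component of `f` in
the anchored decomposition, `f_u(x) = ∑_{v ⊆ u} (-1)^{|u \ v|} f(x_v; c)`. -/
def blockAlg (c : D) (u : Finset ℕ) {n : ℕ} (q : Fin n → ℝ × (u → D)) : Algorithm c :=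
  (List.finRange n).flatMap fun i => u.powerset.toList.map fun v =>
    ((-1) ^ (u \ v).card * (q i).1,
      Node.restrict c v fun j => if h : j ∈ u then (q i).2 ⟨j, h⟩ else c)

open Classical in
/-- The changing dimension algorithm `Q_ε(f) = f(c) + ∑_{u ≠ ∅} Q_{n_u,u}(f_u)`. (For the weights
considered here, only finitely many `n_u` are non-zero.) -/
def changingDim (c : D) (γ : Finset ℕ → ℝ) (l₀ a C τ : ℝ) (q : Blocks D) (ε : ℝ) :
    Algorithm c :=
  (1, Node.restrict c ∅ fun _ => c) ::
    if h : (usedSets γ l₀ a C τ ε).Finite then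
      h.toFinset.toList.flatMap fun u => blockAlg c u (q u (numSamples γ l₀ a C τ ε u))
    else []

/-- The numbers `ℓ ≥ 1` with `c C^ℓ L_{1-λ₀} γ_{[ℓ]}^{λ₀} > ε²`. -/
def dimSet (γ : Finset ℕ → ℝ) (l₀ a C ε : ℝ) : Set ℕ :=
  {l | 1 ≤ l ∧ ε ^ 2 < threshold γ l₀ a C (Finset.range l)}

/-- The `ε`-dimension `d(ε)`, the maximum of `dimSet` (and zero if that set is empty). -/
def epsDim (γ : Finset ℕ → ℝ) (l₀ a C ε : ℝ) : ℕ := sSup (dimSet γ l₀ a C ε)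

end InfInt

end

open InfInt

/-! The worst case error of a linear algorithm is the norm of the Riesz representer of its error
functional. By the reproducing property the square of this norm is `errSq`, the error functional
applied to both arguments of the kernel, whichever Hilbert space realises the kernel
(`worstCaseError_eq`). Since the kernel on 𝔛 is the series of the γ_u K_u, the squared error is the
sum of γ_u times the squared errors for the K_u (`Setting.hasSum_errSq`). Everything else is an
estimate of this series.

For the upper bounds, K(c,c) = 0 forces K(·,c) = 0, so only functions vanishing at the anchor
matter. On these, inclusion-exclusion makes the block for w act on functions of the variables in u
as its quadrature if u = w and as zero otherwise. The error of the changing dimension algorithm for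
K_u is therefore zero for u = ∅, the building block error for used u, and C₀^|u| for all other u.
The choice of n_u bounds γ_u times this squared error by ε² γ_u^(1-λ₀)/L times the logarithmic
factor, and these terms add up to ε² times a bound for that factor (`Regime.errSq_changingDim_le`).
The cost is at most $(d(ε)) times a constant plus ε^(-1/τ) ∑ θ_u^(1/(2τ)) 2^|u|.

These sums converge because the k-th elementary symmetric function of a sequence with sum at most A
is at most (eA)^k/k!. With Γ_k bounded by a power of k!, the factorials beat every exponential
factor, so summability of γ_u^r B^|u| reduces to that of the powers g_j^r of the singleton weights
(`IsPOD.summable_weight`). The same bound makes the weights of initial segments decay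
superexponentially, hence d(ε) = o(ln(1/ε)). This makes the logarithmic factor, and a price of
exponential growth, cost only arbitrarily small powers of ε. Letting λ₀ tend to 1 - 1/decay gives
the upper bound for the exponent.

For the lower bounds, terms of the series are dropped. One singleton leaves the univariate problem
and gives 1/α. For the other term, an algorithm touching at most m coordinates misses m of the first
2m, so its squared error is at least m g(2m) C₀. With m of order ε^(-p) this yields g(m) =
O(m^(-(1+2/p))), hence decay ≥ 1 + 2/p. -/

noncomputable section
namespace InfInt

/-! ### The worst case error as a quadratic form -/

section Kernels

variable {X : Type}

/-- The error of the algorithm with the coefficients and nodes in the list `L`, as an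
approximation of integration with respect to `μ`. -/
def errFun [MeasurableSpace X] (μ : Measure X) (L : List (ℝ × X)) (f : X → ℝ) : ℝ :=
  ∫ x, f x ∂μ - (L.map fun p => p.1 * f p.2).sum

/-- The squared worst case error, as a quadratic form in the error functional. -/
def errSq [MeasurableSpace X] (k : X → X → ℝ) (μ : Measure X) (L : List (ℝ × X)) : ℝ :=
  errFun μ L fun x => errFun μ L (k x)

/-- The construction of a space from its kernel uses operator-valued kernels; a scalar kernel enters
as a multiple of the identity. -/
theorem posSemidef_smul_id {k : X → X → ℝ} (hk : (Matrix.of k).PosSemidef) :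
    (Matrix.of fun x y => k x y • ContinuousLinearMap.id ℝ ℝ :
      Matrix X X (ℝ →L[ℝ] ℝ)).PosSemidef := by
  refine (RKHS.posSemidef_tfae.out 0 2 (by rfl) (by rfl)).mpr (And.intro ?_ fun v => ?_)
  · ext x y
    have := hk.1.apply x y
    simp only [Matrix.of_apply, star_trivial] at this
    simp [Matrix.conjTranspose_apply, star, this, ContinuousLinearMap.adjoint_id]
  · have := hk.2 v
    simp only [Matrix.of_apply, star_trivial] at this
    refine this.trans_eq ?_
    rw [Finsupp.sum_comm]
    simp [Finsupp.sum, mul_comm, mul_left_comm]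

theorem PosSemidef.symm {k : X → X → ℝ} (hk : (Matrix.of k).PosSemidef) (x y : X) :
    k x y = k y x := by
  simpa using (hk.1.apply x y).symm

section RKHS

variable {H : Type} [NormedAddCommGroup H] [InnerProductSpace ℝ H] [CompleteSpace H]
  [RKHS ℝ H X ℝ] {k : X → X → ℝ}

theorem coe_kerFun_eq (hk : ∀ x y, RKHS.kernel H x y 1 = k x y) (y : X) :
    ⇑(RKHS.kerFun H y (1 : ℝ)) = fun x => k x y := by
  ext x
  rw [RKHS.kerFun_apply, hk]

theorem kernel_symm (hk : ∀ x y, RKHS.kernel H x y 1 = k x y) (x y : X) : k x y = k y x := by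
  have h1 := RKHS.kernel_inner H x y (1 : ℝ) (1 : ℝ)
  have h2 := RKHS.kernel_inner H y x (1 : ℝ) (1 : ℝ)
  rw [hk] at h1 h2
  simpa using h1.trans ((real_inner_comm _ _).trans h2.symm)

theorem inner_kerFun_one (x : X) (f : H) : inner ℝ (RKHS.kerFun H x (1 : ℝ)) f = f x := by
  simp

theorem abs_apply_le (hk : ∀ x y, RKHS.kernel H x y 1 = k x y) (f : H) (x : X) :
    |f x| ≤ ‖f‖ * √(k x x) := by
  have h1 : ‖RKHS.kerFun H x (1 : ℝ)‖ = √(k x x) := by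
    rw [norm_eq_sqrt_real_inner, inner_kerFun_one, coe_kerFun_eq hk]
  rw [← inner_kerFun_one x f, ← h1, mul_comm]
  exact abs_real_inner_le_norm _ _

/-- Finite combinations of kernel sections are dense, and norm convergence implies pointwise
convergence because evaluations are continuous. -/
theorem measurable_coe [MeasurableSpace X] (hk : ∀ x y, RKHS.kernel H x y 1 = k x y)
    (hm : ∀ y, Measurable fun x => k x y) (f : H) : Measurable ⇑f := by
  have hspan : ∀ g ∈ Submodule.span ℝ {RKHS.kerFun H x v | (x : X) (v : ℝ)}, Measurable ⇑g := by
    intro g hg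
    induction hg using Submodule.span_induction with
    | mem g hg =>
      obtain ⟨x, v, rfl⟩ := hg
      have : RKHS.kerFun H x v = v • RKHS.kerFun H x (1 : ℝ) := by
        rw [← map_smul, smul_eq_mul, mul_one]
      rw [this, RKHS.coe_smul, coe_kerFun_eq hk]
      exact (hm x).const_smul v
    | zero => rw [RKHS.coe_zero]; exact measurable_const
    | add g h _ _ hg hh => rw [RKHS.coe_add]; exact hg.add hh
    | smul c g _ hg => rw [RKHS.coe_smul]; exact hg.const_smul c
  have hf : f ∈ closure (Submodule.span ℝ {RKHS.kerFun H x v | (x : X) (v : ℝ)} : Set H) := by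
    rw [← Submodule.topologicalClosure_coe, RKHS.kerFun_dense]
    trivial
  obtain ⟨u, hu, hlim⟩ := mem_closure_iff_seq_limit.1 hf
  refine measurable_of_tendsto_metrizable (fun n => hspan (u n) (hu n)) ?_
  rw [tendsto_pi_nhds]
  exact fun x => ((RKHS.continuous_eval x).tendsto f).comp hlim

theorem integrable_sqrt_diag [MeasurableSpace X] {μ : Measure X} [IsFiniteMeasure μ]
    {d : X → ℝ} (hd : Integrable d μ) : Integrable (fun x => √(d x)) μ := by
  refine (hd.abs.add (integrable_const (1 : ℝ))).mono'
    (hd.aemeasurable.sqrt).aestronglyMeasurable (ae_of_all _ fun x => ?_)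
  rw [Real.norm_of_nonneg (Real.sqrt_nonneg _)]
  refine (Real.sqrt_le_sqrt (le_abs_self _)).trans ?_
  have h := Real.sq_sqrt (abs_nonneg (d x))
  simp only [Pi.add_apply]
  nlinarith [sq_nonneg (√|d x| - 1), Real.sqrt_nonneg |d x|]

theorem integrable_coe [MeasurableSpace X] {μ : Measure X} [IsFiniteMeasure μ]
    (hk : ∀ x y, RKHS.kernel H x y 1 = k x y)
    (hm : ∀ y, Measurable fun x => k x y) (hd : Integrable (fun x => k x x) μ) (f : H) :
    Integrable ⇑f μ :=
  ((integrable_sqrt_diag hd).const_mul ‖f‖).mono' (measurable_coe hk hm f).aestronglyMeasurable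
    (ae_of_all _ fun x => abs_apply_le hk f x)

/-- The Riesz representer of the error functional. -/
theorem exists_representer [MeasurableSpace X] {μ : Measure X} [IsFiniteMeasure μ]
    (hk : ∀ x y, RKHS.kernel H x y 1 = k x y)
    (hm : ∀ y, Measurable fun x => k x y) (hd : Integrable (fun x => k x x) μ)
    (L : List (ℝ × X)) :
    ∃ r : H, (∀ f : H, inner ℝ r f = errFun μ L f) ∧ ‖r‖ ^ 2 = errSq k μ L := by
  have hi := integrable_coe hk hm hd
  let I : H →ₗ[ℝ] ℝ :=
    { toFun := fun f => ∫ x, f x ∂μ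
      map_add' := fun f g => by
        simp only [RKHS.coe_add, Pi.add_apply]
        exact integral_add (hi f) (hi g)
      map_smul' := fun c f => by
        simp only [RKHS.coe_smul, Pi.smul_apply, RingHom.id_apply]
        exact integral_smul c _ }
  have hI : ∀ f, ‖I f‖ ≤ (∫ x, √(k x x) ∂μ) * ‖f‖ := fun f => by
    have h := norm_integral_le_of_norm_le ((integrable_sqrt_diag hd).const_mul ‖f‖)
      (ae_of_all _ fun x => (Real.norm_eq_abs _).trans_le (abs_apply_le hk f x))
    rwa [integral_const_mul, mul_comm] at h
  let r₀ : H := (InnerProductSpace.toDual ℝ H).symm (I.mkContinuous _ hI)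
  let s : H := (L.map fun p => p.1 • RKHS.kerFun H p.2 (1 : ℝ)).sum
  have hr₀ : ∀ f : H, inner ℝ r₀ f = ∫ x, f x ∂μ := fun f => by
    simp [r₀, I]
  have hs : ∀ f : H, inner ℝ s f = (L.map fun p => p.1 * f p.2).sum := fun f => by
    simp only [s]
    clear * -
    induction L with
    | nil => simp
    | cons p L ih =>
      rw [List.map_cons, List.sum_cons, inner_add_left, ih, inner_smul_left, inner_kerFun_one]
      simp
  have hr : ∀ f : H, inner ℝ (r₀ - s) f = errFun μ L f := fun f => by
    rw [inner_sub_left, hr₀, hs, errFun]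
  refine ⟨r₀ - s, hr, ?_⟩
  -- The representer r is known as a function: r(x) = ⟨k(·,x), r⟩ is the error functional at the
  -- section k(x,·). Applying the functional once more gives ⟨r, r⟩.
  rw [← real_inner_self_eq_norm_sq, hr, errSq]
  congr 1
  ext x
  rw [← inner_kerFun_one x, real_inner_comm, hr, coe_kerFun_eq hk]
  congr 1
  ext y
  exact kernel_symm hk y x

theorem coe_mem_unitBall (hk : ∀ x y, RKHS.kernel H x y 1 = k x y) {g : H} (hg : ‖g‖ ≤ 1) :
    ⇑g ∈ unitBall k :=
  ⟨H, inferInstance, inferInstance, inferInstance, inferInstance, hk, g, hg, rfl⟩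

end RKHS

/-- `unitBall` quantifies over all realisations of the kernel; existence of one is what prevents the
supremum from being vacuous. -/
theorem exists_rkhs {k : X → X → ℝ} (hk : (Matrix.of k).PosSemidef) :
    ∃ (H : Type) (_ : NormedAddCommGroup H) (_ : InnerProductSpace ℝ H)
      (_ : CompleteSpace H) (_ : RKHS ℝ H X ℝ), ∀ x y : X, RKHS.kernel H x y 1 = k x y := by
  have : Fact (Matrix.of fun x y => k x y • ContinuousLinearMap.id ℝ ℝ :
    Matrix X X (ℝ →L[ℝ] ℝ)).PosSemidef := ⟨posSemidef_smul_id hk⟩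
  refine ⟨RKHS.OfKernel (Matrix.of fun x y => k x y • ContinuousLinearMap.id ℝ ℝ :
    Matrix X X (ℝ →L[ℝ] ℝ)), inferInstance, inferInstance, inferInstance, inferInstance,
    fun x y => ?_⟩
  rw [RKHS.OfKernel.kernel_ofKernel]
  simp

variable [MeasurableSpace X] {μ : Measure X} [IsFiniteMeasure μ] {k : X → X → ℝ}

theorem errSq_nonneg (hk : (Matrix.of k).PosSemidef)
    (hm : ∀ y, Measurable fun x => k x y) (hd : Integrable (fun x => k x x) μ)
    (L : List (ℝ × X)) : 0 ≤ errSq k μ L := by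
  obtain ⟨H, _, _, _, _, hH⟩ := exists_rkhs hk
  obtain ⟨r, -, hr⟩ := exists_representer hH hm hd L
  rw [← hr]
  positivity

/-- Cauchy–Schwarz against the representer in every realisation gives the upper bound; the
normalised representer in one realisation attains it. -/
theorem worstCaseError_eq (hk : (Matrix.of k).PosSemidef)
    (hm : ∀ y, Measurable fun x => k x y) (hd : Integrable (fun x => k x x) μ)
    (L : List (ℝ × X)) {Q : (X → ℝ) → ℝ} (hQ : ∀ f, Q f = (L.map fun p => p.1 * f p.2).sum) :
    worstCaseError k μ Q = ENNReal.ofReal √(errSq k μ L) := by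
  refine le_antisymm (iSup₂_le fun f hf => ?_) ?_
  · obtain ⟨H, _, _, _, _, hH, g, hg, rfl⟩ := hf
    obtain ⟨r, hr, hn⟩ := exists_representer hH hm hd L
    refine ENNReal.ofReal_le_ofReal ?_
    rw [← hn, Real.sqrt_sq (norm_nonneg _), hQ, ← errFun, ← hr]
    calc _ ≤ ‖r‖ * ‖g‖ := abs_real_inner_le_norm _ _
      _ ≤ ‖r‖ * 1 := by gcongr
      _ = _ := mul_one _
  · obtain ⟨H, _, _, _, _, hH⟩ := exists_rkhs hk
    obtain ⟨r, hr, hn⟩ := exists_representer hH hm hd L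
    rw [← hn, Real.sqrt_sq (norm_nonneg _)]
    have hb : ⇑((‖r‖)⁻¹ • r) ∈ unitBall k := by
      refine coe_mem_unitBall hH ?_
      rw [norm_smul, norm_inv, norm_norm]
      exact inv_mul_le_one
    refine le_iSup₂_of_le _ hb ?_
    · rw [hQ, ← errFun, ← hr, inner_smul_right, real_inner_self_eq_norm_sq]
      refine ENNReal.ofReal_le_ofReal (le_trans (le_of_eq ?_) (le_abs_self _))
      -- For r = 0 the convention 0⁻¹ = 0 makes the test function zero, which is still in the ball.
      by_cases h : ‖r‖ = 0
      · simp [h]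
      · field_simp

end Kernels

/-! ### Product kernels and the kernel of the weighted space -/

/-- The assumptions on the kernel, the measure and the weights that make integration on the
weighted space a bounded functional. -/
structure Setting {D : Set ℝ} (K : D → D → ℝ) (c : D) (ρ : Measure D) (γ : Finset ℕ → ℝ) :
    Prop where
  meas : Measurable (Function.uncurry K)
  psd : (Matrix.of K).PosSemidef
  anchor : K c c = 0
  diag : Integrable (fun x => K x x) ρ
  nonneg : ∀ u, 0 ≤ γ u
  summable : Summable fun u : Finset ℕ => γ u * constM K ρ ^ u.card

/-! ### The error functional on series of functions. -/

section Functional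

variable {X : Type} [MeasurableSpace X] {μ : Measure X} {L : List (ℝ × X)}

theorem errFun_const_mul (c : ℝ) (f : X → ℝ) :
    errFun μ L (fun x => c * f x) = c * errFun μ L f := by
  rw [errFun, errFun, integral_const_mul, mul_sub, ← List.sum_map_mul_left]
  simp only [mul_left_comm]

theorem errSq_const_mul (c : ℝ) (k : X → X → ℝ) :
    errSq (fun x y => c * k x y) μ L = c * errSq k μ L := by
  simp only [errSq, errFun_const_mul]

theorem abs_errFun_le {f g : X → ℝ} (hfg : ∀ x, |f x| ≤ g x) (hg : Integrable g μ) :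
    |errFun μ L f| ≤ ∫ x, g x ∂μ + (L.map fun p => |p.1| * g p.2).sum := by
  refine (abs_sub _ _).trans (add_le_add ?_ ?_)
  · exact norm_integral_le_of_norm_le hg (ae_of_all _ fun x =>
      (Real.norm_eq_abs _).trans_le (hfg x))
  · induction L with
    | nil => simp
    | cons p L ih =>
      simp only [List.map_cons, List.sum_cons]
      refine (abs_add_le _ _).trans (add_le_add ?_ ih)
      rw [abs_mul]
      exact mul_le_mul_of_nonneg_left (hfg _) (abs_nonneg _)

/-- The functional is an integral minus finitely many evaluations, so the majorant has to be
summable both after integration and at every point. -/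
theorem hasSum_errFun {ι : Type*} [Countable ι] {F G : ι → X → ℝ}
    (hF : ∀ u, Measurable (F u)) (hFG : ∀ u x, |F u x| ≤ G u x) (hG : ∀ u, Integrable (G u) μ)
    (hGi : Summable fun u => ∫ x, G u x ∂μ) (hGs : ∀ x, Summable fun u => G u x) :
    HasSum (fun u => errFun μ L (F u)) (errFun μ L fun x => ∑' u, F u x) := by
  have hFi : ∀ u, Integrable (F u) μ := fun u =>
    (hG u).mono' (hF u).aestronglyMeasurable (ae_of_all _ fun x => hFG u x)
  have hFs : ∀ x, Summable fun u => F u x := fun x =>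
    Summable.of_norm_bounded (hGs x) fun u => hFG u x
  refine HasSum.sub ?_ ?_
  · refine hasSum_integral_of_summable_integral_norm hFi ?_
    refine Summable.of_nonneg_of_le (fun u => integral_nonneg fun x => norm_nonneg _)
      (fun u => integral_mono (hFi u).norm (hG u) fun x => hFG u x) hGi
  · induction L with
    | nil => simp
    | cons p L ih =>
      simp only [List.map_cons, List.sum_cons]
      exact ((hFs p.2).hasSum.mul_left p.1).add ih

end Functional

variable {D : Set ℝ}

/-- The kernel `K_u` as a kernel on `D^ℕ`. -/
def prodKer (K : D → D → ℝ) (u : Finset ℕ) (x y : ℕ → D) : ℝ := ∏ j ∈ u, K (x j) (y j)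

theorem kernelOn_restrict (K : D → D → ℝ) (u : Finset ℕ) (x y : ℕ → D) :
    kernelOn K u (u.restrict x) (u.restrict y) = prodKer K u x y :=
  Finset.prod_coe_sort u fun j => K (x j) (y j)

theorem posSemidef_one (X : Type) : (Matrix.of fun _ _ : X => (1 : ℝ)).PosSemidef := by
  refine ⟨by ext; simp, fun x => ?_⟩
  have : (x.sum fun _ a => a) * (x.sum fun _ a => a) =
      x.sum fun i xi => x.sum fun j xj => star xi * (Matrix.of fun _ _ : X => (1 : ℝ)) i j * xj := by
    simp [Finsupp.sum, Finset.sum_mul_sum]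
  rw [← this]
  exact mul_self_nonneg _

theorem posSemidef_prod {X ι : Type} {k : ι → X → X → ℝ} (u : Finset ι)
    (hk : ∀ j ∈ u, (Matrix.of (k j)).PosSemidef) :
    (Matrix.of fun x y => ∏ j ∈ u, k j x y).PosSemidef := by
  classical
  induction u using Finset.induction_on with
  | empty => simpa using posSemidef_one X
  | insert j u hj ih =>
    have := (hk j (Finset.mem_insert_self j u)).hadamard
      (ih fun i hi => hk i (Finset.mem_insert_of_mem hi))
    have e : (Matrix.of fun x y => ∏ i ∈ insert j u, k i x y) =
        (Matrix.of (k j)).hadamard (Matrix.of fun x y => ∏ i ∈ u, k i x y) := by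
      ext x y
      simp [Finset.prod_insert hj]
    rw [e]
    exact this

theorem posSemidef_kernelOn {K : D → D → ℝ} (hK : (Matrix.of K).PosSemidef) (u : Finset ℕ) :
    (Matrix.of (kernelOn K u)).PosSemidef :=
  posSemidef_prod Finset.univ fun j _ => hK.submatrix fun x : u → D => x j

theorem posSemidef_prodKer {K : D → D → ℝ} (hK : (Matrix.of K).PosSemidef) (u : Finset ℕ) :
    (Matrix.of (prodKer K u)).PosSemidef :=
  posSemidef_prod u fun j _ => hK.submatrix fun x : ℕ → D => x j

theorem diag_nonneg_of_posSemidef {X : Type} {k : X → X → ℝ} (hk : (Matrix.of k).PosSemidef)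
    (x : X) : 0 ≤ k x x := by
  simpa using hk.diag_nonneg (i := x)

theorem abs_le_of_posSemidef {X : Type} {k : X → X → ℝ} (hk : (Matrix.of k).PosSemidef)
    (x y : X) : |k x y| ≤ √(k x x) * √(k y y) := by
  obtain ⟨H, _, _, _, _, hH⟩ := exists_rkhs hk
  have h := abs_apply_le hH (RKHS.kerFun H y (1 : ℝ)) x
  have h1 : ‖RKHS.kerFun H y (1 : ℝ)‖ = √(k y y) := by
    rw [norm_eq_sqrt_real_inner, inner_kerFun_one, coe_kerFun_eq hH]
  rw [coe_kerFun_eq hH, h1] at h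
  linarith [mul_comm √(k x x) √(k y y)]

/-- The additive form of Cauchy–Schwarz separates x from y, so diagonal terms, which are summable on
𝔛, can serve as majorants. -/
theorem abs_le_mean_of_posSemidef {X : Type} {k : X → X → ℝ} (hk : (Matrix.of k).PosSemidef)
    (x y : X) : |k x y| ≤ (k x x + k y y) / 2 := by
  have h1 := Real.sq_sqrt (diag_nonneg_of_posSemidef hk x)
  have h2 := Real.sq_sqrt (diag_nonneg_of_posSemidef hk y)
  have h3 := abs_le_of_posSemidef hk x y
  nlinarith [sq_nonneg (√(k x x) - √(k y y))]

theorem measurable_prodKer {K : D → D → ℝ} (hK : Measurable (Function.uncurry K))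
    (u : Finset ℕ) : Measurable (Function.uncurry (prodKer K u)) := by
  have this (j : ℕ) : Measurable fun p : (ℕ → D) × (ℕ → D) => K (p.1 j) (p.2 j) :=
    hK.comp (f := fun p : (ℕ → D) × (ℕ → D) => (p.1 j, p.2 j))
      (((measurable_pi_apply j).comp measurable_fst).prodMk
        ((measurable_pi_apply j).comp measurable_snd))
  exact Finset.measurable_prod u fun j _ => this j

theorem measurable_kernelOn {K : D → D → ℝ} (hK : Measurable (Function.uncurry K))
    (u : Finset ℕ) : Measurable (Function.uncurry (kernelOn K u)) := by
  have this (j : u) : Measurable fun p : (u → D) × (u → D) => K (p.1 j) (p.2 j) :=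
    hK.comp (f := fun p : (u → D) × (u → D) => (p.1 j, p.2 j))
      (((measurable_pi_apply j).comp measurable_fst).prodMk
        ((measurable_pi_apply j).comp measurable_snd))
  exact Finset.measurable_prod Finset.univ fun j _ => this j

theorem measurable_diag {X : Type} [MeasurableSpace X] {k : X → X → ℝ}
    (hk : Measurable (Function.uncurry k)) : Measurable fun x => k x x :=
  hk.comp (measurable_id.prodMk measurable_id)

theorem integrable_kernelOn_diag {K : D → D → ℝ} {ρ : Measure D} [IsProbabilityMeasure ρ]
    (hd : Integrable (fun x => K x x) ρ) (u : Finset ℕ) :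
    Integrable (fun x => kernelOn K u x x) (Measure.pi fun _ : u => ρ) :=
  Integrable.fintype_prod (f := fun (_ : u) (x : D) => K x x) fun _ => hd

theorem integral_kernelOn_diag {K : D → D → ℝ} {ρ : Measure D} [IsProbabilityMeasure ρ]
    (u : Finset ℕ) :
    ∫ x, kernelOn K u x x ∂(Measure.pi fun _ : u => ρ) = constM K ρ ^ u.card := by
  have := integral_fintype_prod_eq_prod (ι := u) (μ := fun _ => ρ) (fun _ (x : D) => K x x)
  simpa [constM, kernelOn] using this

theorem integrable_prodKer_diag {K : D → D → ℝ} {ρ : Measure D} [IsProbabilityMeasure ρ]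
    (hd : Integrable (fun x => K x x) ρ) (u : Finset ℕ) :
    Integrable (fun x => prodKer K u x x) (Measure.infinitePi fun _ : ℕ => ρ) := by
  have h := integrable_kernelOn_diag hd u
  rw [← Measure.infinitePi_map_restrict (fun _ : ℕ => ρ)] at h
  have := h.comp_measurable (Finset.measurable_restrict u)
  simpa only [Function.comp_def, kernelOn_restrict] using this

theorem integral_prodKer_diag {K : D → D → ℝ} {ρ : Measure D} [IsProbabilityMeasure ρ]
    (hd : Integrable (fun x => K x x) ρ) (u : Finset ℕ) :
    ∫ x, prodKer K u x x ∂(Measure.infinitePi fun _ : ℕ => ρ) = constM K ρ ^ u.card := by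
  have := integral_restrict_infinitePi (μ := fun _ : ℕ => ρ)
    (integrable_kernelOn_diag hd u).aestronglyMeasurable
  rw [← integral_kernelOn_diag, ← this]
  simp only [kernelOn_restrict]

/-! ### The domain 𝔛, its measure, and the series for the squared error. -/

namespace Setting

variable {K : D → D → ℝ} {c : D} {ρ : Measure D} {γ : Finset ℕ → ℝ} (h : Setting K c ρ γ)
include h

theorem prod_diag_nonneg (u : Finset ℕ) (x : ℕ → D) : 0 ≤ prodKer K u x x :=
  Finset.prod_nonneg fun j _ => diag_nonneg_of_posSemidef h.psd (x j)

omit h in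
theorem mem_domain_iff (x : ℕ → D) :
    x ∈ domain K γ ↔ Summable fun u : Finset ℕ => γ u * prodKer K u x x := Iff.rfl

/-- As a finiteness condition on an extended nonnegative series, membership becomes visibly
measurable. -/
theorem mem_domain_iff_lt_top (x : ℕ → D) :
    x ∈ domain K γ ↔ ∑' u : Finset ℕ, ENNReal.ofReal (γ u * prodKer K u x x) < ∞ := by
  have h0 : ∀ u, 0 ≤ γ u * prodKer K u x x := fun u =>
    mul_nonneg (h.nonneg u) (h.prod_diag_nonneg u x)
  rw [mem_domain_iff]
  constructor
  · intro hs
    rw [← ENNReal.ofReal_tsum_of_nonneg h0 hs]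
    exact ENNReal.ofReal_lt_top
  · intro hs
    have := ENNReal.summable_toReal hs.ne
    simpa only [ENNReal.toReal_ofReal (h0 _)] using this

theorem measurable_term (u : Finset ℕ) :
    Measurable fun x : ℕ → D => ENNReal.ofReal (γ u * prodKer K u x x) :=
  ((measurable_diag (measurable_prodKer h.meas u)).const_mul (γ u)).ennreal_ofReal

theorem measurableSet_domain : MeasurableSet (domain K γ) := by
  have : domain K γ =
      {x | ∑' u : Finset ℕ, ENNReal.ofReal (γ u * prodKer K u x x) < ∞} := by
    ext x
    exact h.mem_domain_iff_lt_top x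
  rw [this]
  exact measurableSet_lt (Measurable.tsum h.measurable_term) measurable_const

variable [IsProbabilityMeasure ρ]

/-- By Tonelli the integral is the series of the γ_u M^|u|. Its finiteness gives 𝔛 full measure and
makes the diagonal of the full kernel integrable. -/
theorem lintegral_ne_top : ∫⁻ x, ∑' u : Finset ℕ, ENNReal.ofReal (γ u * prodKer K u x x)
    ∂(Measure.infinitePi fun _ : ℕ => ρ) ≠ ∞ := by
  rw [lintegral_tsum fun u => (h.measurable_term u).aemeasurable]
  have h1 : ∀ u, ∫⁻ x, ENNReal.ofReal (γ u * prodKer K u x x)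
      ∂(Measure.infinitePi fun _ : ℕ => ρ) = ENNReal.ofReal (γ u * constM K ρ ^ u.card) := by
    intro u
    rw [← ofReal_integral_eq_lintegral_ofReal ((integrable_prodKer_diag h.diag u).const_mul _)
      (ae_of_all _ fun x => mul_nonneg (h.nonneg u) (h.prod_diag_nonneg u x)),
      integral_const_mul, integral_prodKer_diag h.diag]
  simp only [h1]
  exact h.summable.tsum_ofReal_ne_top

theorem ae_mem_domain : ∀ᵐ x ∂(Measure.infinitePi fun _ : ℕ => ρ), x ∈ domain K γ := by
  filter_upwards [ae_lt_top (Measurable.tsum h.measurable_term) h.lintegral_ne_top] with x hx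
  exact (h.mem_domain_iff_lt_top x).2 hx

theorem map_measureInf :
    (measureInf K γ ρ).map Subtype.val = Measure.infinitePi fun _ : ℕ => ρ := by
  rw [measureInf, map_comap_subtype_coe h.measurableSet_domain,
    Measure.restrict_eq_self_of_ae_mem h.ae_mem_domain]

theorem isProbabilityMeasure_measureInf : IsProbabilityMeasure (measureInf K γ ρ) := by
  constructor
  rw [← Set.preimage_univ (f := (Subtype.val : domain K γ → ℕ → D)),
    ← Measure.map_apply measurable_subtype_coe MeasurableSet.univ, h.map_measureInf, measure_univ]

theorem integral_measureInf (F : (ℕ → D) → ℝ) :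
    ∫ x, F x.1 ∂(measureInf K γ ρ) = ∫ x, F x ∂(Measure.infinitePi fun _ : ℕ => ρ) := by
  rw [← h.map_measureInf,
    (MeasurableEmbedding.subtype_coe h.measurableSet_domain).integral_map]

theorem integrable_measureInf {F : (ℕ → D) → ℝ}
    (hF : Integrable F (Measure.infinitePi fun _ : ℕ => ρ)) :
    Integrable (fun x : domain K γ => F x.1) (measureInf K γ ρ) := by
  rw [← h.map_measureInf] at hF
  exact hF.comp_measurable measurable_subtype_coe

omit h [IsProbabilityMeasure ρ] in
theorem summable_diag (x : domain K γ) : Summable fun u : Finset ℕ => γ u * prodKer K u x.1 x.1 :=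
  x.2

omit [IsProbabilityMeasure ρ] in
theorem summable_kernelInf (x y : domain K γ) :
    Summable fun u : Finset ℕ => γ u * prodKer K u x.1 y.1 := by
  refine Summable.of_norm_bounded (((summable_diag x).add (summable_diag y)).div_const 2)
    fun u => ?_
  rw [Real.norm_eq_abs, abs_mul, abs_of_nonneg (h.nonneg u)]
  have := mul_le_mul_of_nonneg_left
    (abs_le_mean_of_posSemidef (posSemidef_prodKer h.psd u) x.1 y.1) (h.nonneg u)
  linarith

omit [IsProbabilityMeasure ρ] in
theorem posSemidef_kernelInf : (Matrix.of (kernelInf K γ)).PosSemidef := by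
  constructor
  · ext x y
    simp only [Matrix.conjTranspose_apply, Matrix.of_apply, star_trivial, kernelInf]
    refine tsum_congr fun u => ?_
    congr 1
    exact PosSemidef.symm (posSemidef_prodKer h.psd u) y.1 x.1
  · intro a
    have hs : HasSum (fun u : Finset ℕ => a.sum fun i xi => a.sum fun j xj =>
        star xi * (γ u * prodKer K u i.1 j.1) * xj) (a.sum fun i xi => a.sum fun j xj =>
        star xi * kernelInf K γ i j * xj) := by
      refine hasSum_sum fun i _ => hasSum_sum fun j _ => ?_
      exact ((h.summable_kernelInf i j).hasSum.mul_left _).mul_right _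
    refine hs.nonneg fun u => ?_
    have := (((posSemidef_prodKer h.psd u).submatrix
      (Subtype.val : domain K γ → ℕ → D)).smul (h.nonneg u)).2 a
    simpa using this

/-- The error functional is interchanged with the kernel series twice, once per variable. This
replaces the orthogonal decomposition of the function space. -/
theorem hasSum_errSq (L : List (ℝ × domain K γ)) :
    HasSum (fun u : Finset ℕ => γ u * errSq (fun x y : domain K γ => prodKer K u x.1 y.1)
      (measureInf K γ ρ) L) (errSq (kernelInf K γ) (measureInf K γ ρ) L) := by
  have := h.isProbabilityMeasure_measureInf
  set μ := measureInf K γ ρ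
  have hPm : ∀ u, Measurable (Function.uncurry fun x y : domain K γ => prodKer K u x.1 y.1) :=
    fun u => (measurable_prodKer h.meas u).comp
      ((measurable_subtype_coe.comp measurable_fst).prodMk
        (measurable_subtype_coe.comp measurable_snd))
  have hPi : ∀ u, Integrable (fun x : domain K γ => prodKer K u x.1 x.1) μ := fun u =>
    h.integrable_measureInf (integrable_prodKer_diag h.diag u)
  have hPI : ∀ u, ∫ x : domain K γ, prodKer K u x.1 x.1 ∂μ = constM K ρ ^ u.card := fun u => by
    rw [h.integral_measureInf fun x => prodKer K u x x, integral_prodKer_diag h.diag]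
  have hP : ∀ u (x y : domain K γ), |γ u * prodKer K u x.1 y.1| ≤
      γ u * prodKer K u x.1 x.1 / 2 + γ u * prodKer K u y.1 y.1 / 2 := by
    intro u x y
    rw [abs_mul, abs_of_nonneg (h.nonneg u)]
    have := mul_le_mul_of_nonneg_left
      (abs_le_mean_of_posSemidef (posSemidef_prodKer h.psd u) x.1 y.1) (h.nonneg u)
    linarith
  have hGi : ∀ u (x : domain K γ), Integrable (fun y : domain K γ =>
      γ u * prodKer K u x.1 x.1 / 2 + γ u * prodKer K u y.1 y.1 / 2) μ := fun u x =>
    (integrable_const _).add (((hPi u).const_mul _).div_const 2)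
  have hGI : ∀ u (x : domain K γ), ∫ y : domain K γ,
      (γ u * prodKer K u x.1 x.1 / 2 + γ u * prodKer K u y.1 y.1 / 2) ∂μ =
      γ u * prodKer K u x.1 x.1 / 2 + γ u * constM K ρ ^ u.card / 2 := by
    intro u x
    rw [integral_add (integrable_const _) (((hPi u).const_mul _).div_const 2), integral_const,
      integral_div, integral_const_mul, hPI]
    simp
  have h1 : ∀ x, HasSum (fun u => errFun μ L fun y : domain K γ => γ u * prodKer K u x.1 y.1)
      (errFun μ L (kernelInf K γ x)) := by
    intro x
    refine hasSum_errFun (G := fun u y => γ u * prodKer K u x.1 x.1 / 2 +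
      γ u * prodKer K u y.1 y.1 / 2) (fun u => ?_) (fun u y => hP u x y) (fun u => hGi u x) ?_ ?_
    · exact ((hPm u).comp measurable_prodMk_left).const_mul _
    · simp only [hGI]
      exact ((summable_diag x).div_const 2).add (h.summable.div_const 2)
    · exact fun y => ((summable_diag x).div_const 2).add ((summable_diag y).div_const 2)
  -- Majorant for the second interchange: the functional applied in y to the mean of the two
  -- diagonals costs its integral plus the weighted evaluations. A collects the coefficients and B
  -- the diagonal values at the nodes.
  set A : ℝ := (L.map fun p => |p.1|).sum with hA
  set B : Finset ℕ → ℝ := fun u =>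
    (L.map fun p => |p.1| * (γ u * prodKer K u p.2.1 p.2.1 / 2)).sum with hB
  have hBs : Summable B := by
    have : ∀ L' : List (ℝ × domain K γ), Summable fun u : Finset ℕ =>
        (L'.map fun p => |p.1| * (γ u * prodKer K u p.2.1 p.2.1 / 2)).sum := by
      intro L'
      induction L' with
      | nil => simp
      | cons p L' ih =>
        simp only [List.map_cons, List.sum_cons]
        exact (((summable_diag p.2).div_const 2).mul_left _).add ih
    exact this L
  have hsum : ∀ u (x : domain K γ), (L.map fun p => |p.1| *
      (γ u * prodKer K u x.1 x.1 / 2 + γ u * prodKer K u p.2.1 p.2.1 / 2)).sum =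
      γ u * prodKer K u x.1 x.1 / 2 * A + B u := by
    intro u x
    simp only [hA, hB, mul_add, List.sum_map_add, List.sum_map_mul_right]
    ring
  have h2 : HasSum (fun u => errFun μ L fun x =>
      errFun μ L fun y : domain K γ => γ u * prodKer K u x.1 y.1)
      (errFun μ L fun x => ∑' u, errFun μ L fun y : domain K γ => γ u * prodKer K u x.1 y.1) := by
    refine hasSum_errFun (G := fun u x => γ u * prodKer K u x.1 x.1 / 2 +
      γ u * constM K ρ ^ u.card / 2 + (γ u * prodKer K u x.1 x.1 / 2 * A + B u))
      (fun u => ?_) (fun u x => ?_) (fun u => ?_) ?_ ?_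
    · refine Measurable.sub ?_ ?_
      · exact ((((hPm u).const_mul (γ u)).stronglyMeasurable).integral_prod_right).measurable
      · clear * - hPm
        induction L with
        | nil => exact measurable_const
        | cons p L ih =>
          simp only [List.map_cons, List.sum_cons]
          exact ((((hPm u).comp measurable_prodMk_right).const_mul _).const_mul _).add ih
    · rw [← hGI, ← hsum]
      exact abs_errFun_le (hP u x) (hGi u x)
    · have := ((hPi u).const_mul (γ u)).div_const 2
      exact (this.add (integrable_const _)).add ((this.mul_const A).add (integrable_const _))
    · have := fun u => ((hPi u).const_mul (γ u)).div_const 2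
      have h3 : ∀ u, ∫ x : domain K γ, (γ u * prodKer K u x.1 x.1 / 2 +
          γ u * constM K ρ ^ u.card / 2 + (γ u * prodKer K u x.1 x.1 / 2 * A + B u)) ∂μ =
          γ u * constM K ρ ^ u.card / 2 + γ u * constM K ρ ^ u.card / 2 +
          (γ u * constM K ρ ^ u.card / 2 * A + B u) := by
        intro u
        have e : ∀ x : domain K γ, γ u * prodKer K u x.1 x.1 / 2 +
            γ u * constM K ρ ^ u.card / 2 + (γ u * prodKer K u x.1 x.1 / 2 * A + B u) =
            γ u * prodKer K u x.1 x.1 / 2 * (1 + A) + (γ u * constM K ρ ^ u.card / 2 + B u) :=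
          fun x => by ring
        simp only [e]
        rw [integral_add ((this u).mul_const _) (integrable_const _), integral_mul_const,
          integral_div, integral_const_mul, hPI, integral_const]
        simp
        ring
      simp only [h3]
      have h4 := h.summable.div_const 2
      exact (h4.add h4).add ((h4.mul_right A).add hBs)
    · intro x
      have h4 := (summable_diag x).div_const 2
      exact (h4.add (h.summable.div_const 2)).add ((h4.mul_right A).add hBs)
  have h5 : (fun x => ∑' u, errFun μ L fun y : domain K γ => γ u * prodKer K u x.1 y.1) =
      fun x => errFun μ L (kernelInf K γ x) := funext fun x => (h1 x).tsum_eq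
  rw [h5] at h2
  simp only [← errSq_const_mul]
  exact h2

/-- The list of the coefficients and nodes of an algorithm. -/
def nodes (h : Setting K c ρ γ) (Q : Algorithm c) : List (ℝ × domain K γ) :=
  Q.map fun p => (p.1, ⟨p.2.pt, p.2.mem_domain h.anchor γ⟩)

omit [IsProbabilityMeasure ρ] in
theorem apply_eq (Q : Algorithm c) (f : domain K γ → ℝ) :
    Q.apply f = ((h.nodes Q).map fun p => p.1 * f p.2).sum := by
  rw [Algorithm.apply, nodes, List.map_map]
  congr 1
  refine List.map_congr_left fun p _ => ?_
  simp [evalAt, p.2.mem_domain h.anchor γ]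

omit [IsProbabilityMeasure ρ] in
theorem measurable_kernelInf_left (y : domain K γ) : Measurable fun x => kernelInf K γ x y := by
  refine Measurable.tsum fun u => ?_
  exact (((measurable_prodKer h.meas u).comp
      (measurable_subtype_coe.prodMk measurable_const)).const_mul (γ u))

theorem integrable_kernelInf_diag :
    Integrable (fun x => kernelInf K γ x x) (measureInf K γ ρ) := by
  have h1 := integrable_toReal_of_lintegral_ne_top
    (Measurable.tsum h.measurable_term).aemeasurable h.lintegral_ne_top
  refine (h.integrable_measureInf h1).congr (ae_of_all _ fun x => ?_)
  have h0 : ∀ u, 0 ≤ γ u * prodKer K u x.1 x.1 := fun u =>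
    mul_nonneg (h.nonneg u) (h.prod_diag_nonneg u x.1)
  simp only
  rw [← ENNReal.ofReal_tsum_of_nonneg h0 (summable_diag x), ENNReal.toReal_ofReal (tsum_nonneg h0)]
  rfl

theorem algError_eq (Q : Algorithm c) :
    algError K γ ρ Q =
      ENNReal.ofReal √(errSq (kernelInf K γ) (measureInf K γ ρ) (h.nodes Q)) := by
  have := h.isProbabilityMeasure_measureInf
  refine worstCaseError_eq h.posSemidef_kernelInf (fun y => ?_) ?_ _ (h.apply_eq Q)
  · exact h.measurable_kernelInf_left y
  · exact h.integrable_kernelInf_diag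

theorem errSq_prodKer_nonneg (u : Finset ℕ) (L : List (ℝ × domain K γ)) :
    0 ≤ errSq (fun x y : domain K γ => prodKer K u x.1 y.1) (measureInf K γ ρ) L := by
  have := h.isProbabilityMeasure_measureInf
  refine errSq_nonneg ((posSemidef_prodKer h.psd u).submatrix Subtype.val) (fun y => ?_) ?_ L
  · exact (measurable_prodKer h.meas u).comp
      (measurable_subtype_coe.prodMk measurable_const)
  · exact h.integrable_measureInf (integrable_prodKer_diag h.diag u)

end Setting

/-! ### Error of changing dimension algorithms -/

section Comparison

variable {X Y : Type} [MeasurableSpace X] [MeasurableSpace Y] {μ : Measure X} {ν : Measure Y}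

theorem stronglyMeasurable_errFun [SFinite ν] {k : Y → Y → ℝ}
    (hk : Measurable (Function.uncurry k)) (L : List (ℝ × Y)) :
    StronglyMeasurable fun y => errFun ν L (k y) := by
  refine StronglyMeasurable.sub hk.stronglyMeasurable.integral_prod_right ?_
  induction L with
  | nil => exact stronglyMeasurable_const
  | cons p L ih =>
    simp only [List.map_cons, List.sum_cons]
    exact ((hk.comp measurable_prodMk_right).stronglyMeasurable.const_mul _).add ih

/-- The quadratic form of a kernel pulled back along a measure preserving map, if the sampling
functional acts on the functions of a class `P` as another one does. -/
theorem errSq_comp [SFinite ν] {k : Y → Y → ℝ} (hk : Measurable (Function.uncurry k)) {π : X → Y}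
    (hπ : MeasurePreserving π μ ν) {L : List (ℝ × X)} {L' : List (ℝ × Y)} {P : (Y → ℝ) → Prop}
    (hL : ∀ φ, P φ → (L.map fun p => p.1 * φ (π p.2)).sum = (L'.map fun p => p.1 * φ p.2).sum)
    (hP : ∀ y, P (k y)) (hP' : P fun y => errFun ν L' (k y)) :
    errSq (fun x y => k (π x) (π y)) μ L = errSq k ν L' := by
  have key : ∀ φ, P φ → StronglyMeasurable φ →
      errFun μ L (fun x => φ (π x)) = errFun ν L' φ := by
    intro φ h1 h2
    rw [errFun, errFun, hL φ h1, ← hπ.map_eq, integral_map hπ.aemeasurable]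
    exact h2.aestronglyMeasurable
  rw [errSq, errSq]
  have h1 : ∀ x, errFun μ L (fun y => k (π x) (π y)) = errFun ν L' (k (π x)) := fun x =>
    key _ (hP _) (hk.comp measurable_prodMk_left).stronglyMeasurable
  simp only [h1]
  exact key _ hP' (stronglyMeasurable_errFun hk L')

end Comparison

theorem list_sum_flatMap {α β : Type*} (l : List α) (g : α → List β) (f : β → ℝ) :
    ((l.flatMap g).map f).sum = (l.map fun a => ((g a).map f).sum).sum := by
  induction l with
  | nil => simp
  | cons a l ih => simp [ih]

/-- For u ⊆ w the sum expands ∏_{j ∈ w} (1 + x_j) with x_j = 0 on u and x_j = -1 elsewhere, so any j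
in w \ u contributes a factor zero. -/
theorem sum_powerset_neg_one_pow (u w : Finset ℕ) (a : ℝ) :
    ∑ v ∈ w.powerset, (-1 : ℝ) ^ (w \ v).card * (if u ⊆ v then a else 0) =
      if u = w then a else 0 := by
  by_cases huw : u ⊆ w
  · have h1 : ∀ v ∈ w.powerset, (-1 : ℝ) ^ (w \ v).card * (if u ⊆ v then a else 0) =
        ((∏ _j ∈ v, (1 : ℝ)) * ∏ j ∈ w \ v, if j ∈ u then (0 : ℝ) else -1) * a := by
      intro v _
      by_cases huv : u ⊆ v
      · have : ∀ j ∈ w \ v, (if j ∈ u then (0 : ℝ) else -1) = -1 := fun j hj =>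
          if_neg fun h => (Finset.mem_sdiff.1 hj).2 (huv h)
        rw [Finset.prod_congr rfl this]
        simp [huv]
      · obtain ⟨j, hj, hjv⟩ := Finset.not_subset.1 huv
        have : (∏ j ∈ w \ v, if j ∈ u then (0 : ℝ) else -1) = 0 :=
          Finset.prod_eq_zero (Finset.mem_sdiff.2 ⟨huw hj, hjv⟩) (if_pos hj)
        simp [this, huv]
    rw [Finset.sum_congr rfl h1, ← Finset.sum_mul, ← Finset.prod_add]
    split_ifs with h
    · subst h
      rw [Finset.prod_eq_one, one_mul]
      intro j hj
      simp [hj]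
    · obtain ⟨j, hj, hju⟩ := Finset.not_subset.1 fun h' => h (huw.antisymm h')
      rw [Finset.prod_eq_zero hj, zero_mul]
      simp [hju]
  · rw [if_neg fun h => huw h.subset]
    refine Finset.sum_eq_zero fun v hv => ?_
    rw [if_neg fun h => huw (h.trans (Finset.mem_powerset.1 hv)), mul_zero]

variable {D : Set ℝ} {c : D}

/-- Functions on `D^u` that vanish whenever one of the variables equals the anchor. -/
def IsAnchored (c : D) {u : Finset ℕ} (φ : (u → D) → ℝ) : Prop :=
  ∀ z : u → D, (∃ j, z j = c) → φ z = 0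

/-- Resetting the coordinates outside v to c kills an anchored φ unless u ⊆ v. The alternating sum
over v then isolates the component u = w. -/
theorem sum_blockAlg (u w : Finset ℕ) {n : ℕ} (q : Fin n → ℝ × (w → D)) {φ : (u → D) → ℝ}
    (hφ : IsAnchored c φ) :
    ((blockAlg c w q).map fun p => p.1 * φ (u.restrict p.2.pt)).sum =
      ∑ i, (q i).1 * if u = w then
        φ (u.restrict fun j => if h : j ∈ w then (q i).2 ⟨j, h⟩ else c) else 0 := by
  rw [blockAlg, list_sum_flatMap, ← Fin.sum_univ_def]
  refine Finset.sum_congr rfl fun i _ => ?_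
  rw [List.map_map, Finset.sum_map_toList, ← sum_powerset_neg_one_pow, Finset.mul_sum]
  refine Finset.sum_congr (by congr) fun v _ => ?_
  simp only [Function.comp_apply]
  have h1 : φ (u.restrict (Node.restrict c v
      fun j => if h : j ∈ w then (q i).2 ⟨j, h⟩ else c).pt) = if u ⊆ v then
        φ (u.restrict fun j => if h : j ∈ w then (q i).2 ⟨j, h⟩ else c) else 0 := by
    split_ifs with huv
    · congr 1
      ext j
      simp [Node.restrict, huv j.2]
    · obtain ⟨j, hj, hjv⟩ := Finset.not_subset.1 huv
      exact hφ _ ⟨⟨j, hj⟩, by simp [Node.restrict, hjv]⟩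
  rw [h1]
  have e : ∀ x y z : ℝ, x * y * z = y * (x * z) := fun x y z => by ring
  rw [e]

theorem sum_changingDim {γ : Finset ℕ → ℝ} {l₀ a C τ ε : ℝ} (q : Blocks D)
    (hfin : (usedSets γ l₀ a C τ ε).Finite) {u : Finset ℕ} {φ : (u → D) → ℝ}
    (hφ : IsAnchored c φ) [Decidable (u ∈ usedSets γ l₀ a C τ ε)] :
    ((changingDim c γ l₀ a C τ q ε).map fun p => p.1 * φ (u.restrict p.2.pt)).sum =
      (if u = ∅ then φ (fun _ => c) else 0) + if u ∈ usedSets γ l₀ a C τ ε then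
        quad (q u (numSamples γ l₀ a C τ ε u)) φ else 0 := by
  rw [changingDim, dif_pos hfin, List.map_cons, List.sum_cons, list_sum_flatMap]
  congr 1
  · have : (Node.restrict c ∅ fun _ => c).pt = fun _ => c := by simp [Node.restrict]
    simp only [this, one_mul]
    split_ifs with hu
    · rfl
    · obtain ⟨j, hj⟩ := Finset.nonempty_iff_ne_empty.2 hu
      exact hφ _ ⟨⟨j, hj⟩, rfl⟩
  · simp only [sum_blockAlg _ _ _ hφ]
    rw [Finset.sum_map_toList]
    have h1 : ∀ w ∈ hfin.toFinset, (∑ i, (q w (numSamples γ l₀ a C τ ε w) i).1 * if u = w then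
        φ (u.restrict fun j => if h : j ∈ w then (q w (numSamples γ l₀ a C τ ε w) i).2 ⟨j, h⟩
          else c) else 0) =
        if u = w then quad (q u (numSamples γ l₀ a C τ ε u)) φ else 0 := by
      intro w _
      split_ifs with huw
      · subst huw
        refine Finset.sum_congr rfl fun i _ => ?_
        congr 2
        ext j
        simp
      · simp
    rw [Finset.sum_congr rfl h1, Finset.sum_ite_eq]
    simp

theorem quad_eq_sum {X : Type} {n : ℕ} (q : Fin n → ℝ × X) (f : X → ℝ) :
    quad q f = ((List.ofFn q).map fun p => p.1 * f p.2).sum := by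
  rw [List.map_ofFn, List.sum_ofFn]
  rfl

/-- By Cauchy–Schwarz, K(c,c) = 0 forces K(·,c) = 0, so one factor of the product vanishes. -/
theorem isAnchored_kernelOn {K : D → D → ℝ} (hK : (Matrix.of K).PosSemidef) (hc : K c c = 0)
    {u : Finset ℕ} (z : u → D) : IsAnchored c (kernelOn K u z) := by
  rintro y ⟨j, hj⟩
  refine Finset.prod_eq_zero (Finset.mem_univ j) ?_
  have := abs_le_of_posSemidef hK (z j) (y j)
  rw [hj, hc, Real.sqrt_zero, mul_zero] at this
  rw [hj]
  exact abs_nonpos_iff.1 this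

theorem isAnchored_errFun_kernelOn {K : D → D → ℝ} (hK : (Matrix.of K).PosSemidef)
    (hc : K c c = 0) {u : Finset ℕ} (ν : Measure (u → D)) (L : List (ℝ × (u → D))) :
    IsAnchored c fun z => errFun ν L (kernelOn K u z) := by
  intro z hz
  -- Zero is written as a product so that homogeneity of the error functional applies.
  have : kernelOn K u z = fun y => 0 * (0 : ℝ) := by
    ext y
    rw [PosSemidef.symm (posSemidef_kernelOn hK u), isAnchored_kernelOn hK hc y z hz, zero_mul]
  change errFun ν L (kernelOn K u z) = 0
  rw [this, errFun_const_mul, zero_mul]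

theorem errSq_kernelOn_nil {K : D → D → ℝ} {ρ : Measure D} [IsProbabilityMeasure ρ]
    (u : Finset ℕ) :
    errSq (kernelOn K u) (Measure.pi fun _ : u => ρ) [] = constC₀ K ρ ^ u.card := by
  have h1 : ∀ x : u → D, ∫ y, kernelOn K u x y ∂(Measure.pi fun _ : u => ρ) =
      ∏ j, ∫ y, K (x j) y ∂ρ := fun x =>
    integral_fintype_prod_eq_prod (ι := u) (μ := fun _ => ρ) (fun j (y : D) => K (x j) y)
  have h2 := integral_fintype_prod_eq_prod (ι := u) (μ := fun _ => ρ)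
    (fun _ (x : D) => ∫ y, K x y ∂ρ)
  simp only [errSq, errFun, List.map_nil, List.sum_nil, sub_zero, h1]
  rw [h2]
  simp [constC₀]

theorem worstCaseError_kernelOn {K : D → D → ℝ} {ρ : Measure D} [IsProbabilityMeasure ρ]
    (hm : Measurable (Function.uncurry K)) (hK : (Matrix.of K).PosSemidef)
    (hd : Integrable (fun x => K x x) ρ) (u : Finset ℕ) {n : ℕ} (q : Fin n → ℝ × (u → D)) :
    worstCaseError (kernelOn K u) (Measure.pi fun _ : u => ρ) (quad q) =
      ENNReal.ofReal √(errSq (kernelOn K u) (Measure.pi fun _ : u => ρ) (List.ofFn q)) :=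
  worstCaseError_eq (posSemidef_kernelOn hK u)
    (fun _ => (measurable_kernelOn hm u).comp measurable_prodMk_right)
    (integrable_kernelOn_diag hd u) _ (quad_eq_sum q)

namespace Setting

variable {K : D → D → ℝ} {ρ : Measure D} {γ : Finset ℕ → ℝ} [IsProbabilityMeasure ρ]
  (h : Setting K c ρ γ)
include h

theorem measurePreserving_restrict (u : Finset ℕ) :
    MeasurePreserving (fun x : domain K γ => u.restrict x.1) (measureInf K γ ρ)
      (Measure.pi fun _ : u => ρ) := by
  refine ⟨(Finset.measurable_restrict u).comp measurable_subtype_coe, ?_⟩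
  have := Measure.map_map (μ := measureInf K γ ρ) (Finset.measurable_restrict (X := fun _ => D) u)
    measurable_subtype_coe
  rw [h.map_measureInf, Measure.infinitePi_map_restrict] at this
  exact this.symm

theorem measurePreserving_eval (j : ℕ) :
    MeasurePreserving (fun x : domain K γ => x.1 j) (measureInf K γ ρ) ρ := by
  refine ⟨(measurable_pi_apply j).comp measurable_subtype_coe, ?_⟩
  have := Measure.map_map (μ := measureInf K γ ρ) (measurable_pi_apply (X := fun _ => D) j)
    measurable_subtype_coe
  rw [h.map_measureInf, (measurePreserving_eval_infinitePi (fun _ : ℕ => ρ) j).map_eq] at this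
  exact this.symm

/-- Agreement on anchored functions suffices, since kernel sections and the error functional applied
to them are both anchored. -/
theorem errSq_prodKer_eq {u : Finset ℕ} {Q : Algorithm c} {L : List (ℝ × (u → D))}
    (hQ : ∀ φ : (u → D) → ℝ, IsAnchored c φ →
      (Q.map fun p => p.1 * φ (u.restrict p.2.pt)).sum = (L.map fun p => p.1 * φ p.2).sum) :
    errSq (fun x y : domain K γ => prodKer K u x.1 y.1) (measureInf K γ ρ) (h.nodes Q) =
      errSq (kernelOn K u) (Measure.pi fun _ : u => ρ) L := by
  simp only [← kernelOn_restrict]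
  refine errSq_comp (measurable_kernelOn h.meas u) (h.measurePreserving_restrict u)
    (P := IsAnchored c) (fun φ hφ => ?_) (isAnchored_kernelOn h.psd h.anchor)
    (isAnchored_errFun_kernelOn h.psd h.anchor _ L)
  rw [← hQ φ hφ, nodes, List.map_map]
  rfl

theorem errSq_changingDim_empty {l₀ a C τ ε : ℝ} (q : Blocks D)
    (hfin : (usedSets γ l₀ a C τ ε).Finite) :
    errSq (fun x y : domain K γ => prodKer K ∅ x.1 y.1) (measureInf K γ ρ)
      (h.nodes (changingDim c γ l₀ a C τ q ε)) = 0 := by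
  classical
  rw [h.errSq_prodKer_eq (L := [(1, fun _ => c)]) fun φ hφ => ?_]
  · simp [errSq, errFun, kernelOn]
  · rw [sum_changingDim q hfin hφ, if_pos rfl, if_neg fun h' => by simpa using h'.1]
    simp

theorem errSq_changingDim_of_mem {l₀ a C τ ε : ℝ} (q : Blocks D)
    (hfin : (usedSets γ l₀ a C τ ε).Finite) {u : Finset ℕ} (hu : u ∈ usedSets γ l₀ a C τ ε) :
    errSq (fun x y : domain K γ => prodKer K u x.1 y.1) (measureInf K γ ρ)
      (h.nodes (changingDim c γ l₀ a C τ q ε)) =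
    errSq (kernelOn K u) (Measure.pi fun _ : u => ρ)
      (List.ofFn (q u (numSamples γ l₀ a C τ ε u))) := by
  classical
  refine h.errSq_prodKer_eq fun φ hφ => ?_
  rw [sum_changingDim q hfin hφ, if_neg hu.1.ne_empty, if_pos hu, zero_add, quad_eq_sum]

theorem errSq_changingDim_of_notMem {l₀ a C τ ε : ℝ} (q : Blocks D)
    (hfin : (usedSets γ l₀ a C τ ε).Finite) {u : Finset ℕ} (hu0 : u.Nonempty)
    (hu : u ∉ usedSets γ l₀ a C τ ε) :
    errSq (fun x y : domain K γ => prodKer K u x.1 y.1) (measureInf K γ ρ)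
      (h.nodes (changingDim c γ l₀ a C τ q ε)) = constC₀ K ρ ^ u.card := by
  classical
  rw [← errSq_kernelOn_nil]
  refine h.errSq_prodKer_eq fun φ hφ => ?_
  rw [sum_changingDim q hfin hφ, if_neg hu0.ne_empty, if_neg hu]
  simp

end Setting

/-! ### Decay of families of weights -/

section Ordering

variable {S : Set (Finset ℕ)} {w : Finset ℕ → ℝ}

/-- Along the ordering, w is eventually below (j+1)^(-p), so the r-th powers are dominated by a
convergent p-series of exponent p r. -/
theorem DecaysWith.summable {p r : ℝ} (h : DecaysWith S w p) (hw : ∀ u ∈ S, 0 ≤ w u)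
    (hr : 0 < r) (hpr : 1 < p * r) : Summable fun u : S => w u ^ r := by
  obtain ⟨e, ⟨hbij, -⟩, hlim⟩ := h
  rw [← hbij.equiv.summable_iff]
  have : ((fun u : S => w u ^ r) ∘ hbij.equiv) =
      (fun j => w (e j) ^ r) ∘ (Subtype.val : {j : ℕ | (j : ℕ∞) < S.encard} → ℕ) := by
    ext j
    rfl
  rw [this, summable_subtype_iff_indicator]
  have hs : Summable fun j : ℕ => ((j : ℝ) + 1) ^ (-(p * r)) := by
    have := (summable_nat_add_iff 1).2 (Real.summable_nat_rpow.2 (by linarith : -(p * r) < -1))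
    simpa using this
  refine Summable.of_norm_bounded_eventually_nat hs ?_
  filter_upwards [hlim.eventually (gt_mem_nhds one_pos)] with j hj
  have hj0 : (0 : ℝ) < (j : ℝ) + 1 := by positivity
  by_cases hjS : (j : ℕ∞) < S.encard
  · rw [if_pos hjS] at hj
    have hwj : 0 ≤ w (e j) := hw _ (hbij.mapsTo hjS)
    rw [Set.indicator_of_mem (show j ∈ {j : ℕ | (j : ℕ∞) < S.encard} from hjS),
      Real.norm_of_nonneg (Real.rpow_nonneg hwj r), ← neg_mul, Real.rpow_mul hj0.le]
    refine Real.rpow_le_rpow hwj ?_ hr.le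
    rw [Real.rpow_neg hj0.le, ← one_div, le_div_iff₀ (Real.rpow_pos_of_pos hj0 p)]
    exact hj.le
  · rw [Set.indicator_of_notMem (show j ∉ {j : ℕ | (j : ℕ∞) < S.encard} from hjS), norm_zero]
    positivity

/-- The number of elements of `S` in front of `u`, in the order of non-increasing `w`, where ties
are broken by an enumeration. -/
def orderRank (S : Set (Finset ℕ)) (w : Finset ℕ → ℝ) (u : Finset ℕ) : ℕ :=
  {v ∈ S | w u < w v ∨ (w u = w v ∧ Encodable.encode v < Encodable.encode u)}.ncard

theorem orderRank_lt (hfin : ∀ t, 0 < t → {u ∈ S | t ≤ w u}.Finite)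
    {u v : Finset ℕ} (hv : v ∈ S) (hw : 0 < w u)
    (h : w u < w v ∨ (w u = w v ∧ Encodable.encode v < Encodable.encode u)) :
    orderRank S w v < orderRank S w u := by
  refine Set.ncard_lt_ncard ⟨fun x hx => ⟨hx.1, ?_⟩, fun hsub => ?_⟩
    ((hfin (w u) hw).subset fun x hx => ⟨hx.1, ?_⟩)
  · rcases h with h | h <;> rcases hx.2 with h' | h'
    · exact Or.inl (h.trans h')
    · exact Or.inl (h'.1 ▸ h)
    · exact Or.inl (h.1 ▸ h')
    · exact Or.inr ⟨h.1.trans h'.1, h'.2.trans h.2⟩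
  · simpa using (hsub ⟨hv, h⟩).2
  · rcases hx.2 with h' | h'
    · exact h'.le
    · exact h'.1.le

/-- The rank embeds S into ℕ. Listing the ranks increasingly by `Nat.nth` treats finite and infinite
S alike. -/
theorem exists_isOrdering (hw : ∀ u ∈ S, 0 < w u)
    (hfin : ∀ t, 0 < t → {u ∈ S | t ≤ w u}.Finite) : ∃ e, IsOrdering S w e := by
  classical
  have htri : ∀ u ∈ S, ∀ v ∈ S, u ≠ v → orderRank S w v < orderRank S w u ∨
      (orderRank S w u < orderRank S w v ∧ w v ≤ w u) := by
    intro u hu v hv huv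
    have hne : Encodable.encode u ≠ Encodable.encode v := fun h =>
      huv (Encodable.encode_injective h)
    rcases lt_trichotomy (w u) (w v) with h | h | h
    · exact Or.inl (orderRank_lt hfin hv (hw u hu) (Or.inl h))
    · rcases hne.lt_or_gt with h' | h'
      · exact Or.inr ⟨orderRank_lt hfin hu (hw v hv) (Or.inr ⟨h.symm, h'⟩), h.ge⟩
      · exact Or.inl (orderRank_lt hfin hv (hw u hu) (Or.inr ⟨h, h'⟩))
    · exact Or.inr ⟨orderRank_lt hfin hu (hw v hv) (Or.inl h), h.le⟩
  have hinj : Set.InjOn (orderRank S w) S := by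
    intro u hu v hv h
    by_contra huv
    rcases htri u hu v hv huv with h' | h'
    · exact h'.ne h.symm
    · exact h'.1.ne h
  set T : Set ℕ := orderRank S w '' S with hT
  -- The right-hand side is the form in which `Nat.nth` expresses that a j-th element exists.
  have hcard : ∀ j : ℕ, (j : ℕ∞) < S.encard ↔
      ∀ hf : (Set.ofPred fun n => n ∈ T).Finite, j < hf.toFinset.card := by
    intro j
    rw [← hinj.encard_image, ← hT]
    constructor
    · intro h hf
      have hf' : T.Finite := hf
      rw [Set.Finite.encard_eq_coe_toFinset_card hf'] at h
      exact_mod_cast h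
    · intro h
      by_cases hf : T.Finite
      · rw [Set.Finite.encard_eq_coe_toFinset_card hf]
        exact_mod_cast h hf
      · rw [Set.Infinite.encard_eq hf]
        exact ENat.natCast_lt_top j
  have hpre : ∀ j : ℕ, (j : ℕ∞) < S.encard → ∃ u ∈ S, orderRank S w u = Nat.nth (· ∈ T) j :=
    fun j hj => Nat.nth_mem j ((hcard j).1 hj)
  set e : ℕ → Finset ℕ := fun j => Function.invFunOn (orderRank S w) S (Nat.nth (· ∈ T) j)
  have heS : ∀ j : ℕ, (j : ℕ∞) < S.encard → e j ∈ S := fun j hj =>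
    Function.invFunOn_mem (hpre j hj)
  have her : ∀ j : ℕ, (j : ℕ∞) < S.encard → orderRank S w (e j) = Nat.nth (· ∈ T) j :=
    fun j hj => Function.invFunOn_eq (hpre j hj)
  have hlt : ∀ i j : ℕ, i < j → (i : ℕ∞) < S.encard → (j : ℕ∞) < S.encard →
      orderRank S w (e i) < orderRank S w (e j) := by
    intro i j hij hi hj
    rw [her i hi, her j hj]
    exact Nat.nth_lt_nth' hij ((hcard j).1 hj)
  refine ⟨e, ⟨heS, fun i hi j hj hij => ?_, fun u hu => ?_⟩, fun i hi j hj hij => ?_⟩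
  · by_contra hne
    rcases Nat.lt_or_gt_of_ne hne with h | h
    · exact (hlt i j h hi hj).ne (by rw [hij])
    · exact (hlt j i h hj hi).ne (by rw [hij])
  · obtain ⟨j, hj, hju⟩ := Nat.exists_lt_card_nth_eq (p := (· ∈ T)) ⟨u, hu, rfl⟩
    rw [← hcard] at hj
    exact ⟨j, hj, hinj (heS j hj) hu ((her j hj).trans hju)⟩
  · rcases hij.eq_or_lt with rfl | hij
    · exact le_rfl
    · have h := hlt i j hij hi hj
      rcases htri (e i) (heS i hi) (e j) (heS j hj) (fun h' => h.ne (by rw [h'])) with h' | h'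
      · exact absurd h' h.asymm
      · exact h'.2

/-- By monotonicity the first j+1 terms give (j+1) w(e j)^r ≤ A, the total sum, so w(e j) =
O(j^(-1/r)), and p < 1/r. -/
theorem decaysWith_of_summable {p r : ℝ} (hw : ∀ u ∈ S, 0 < w u) (hr : 0 < r)
    (hs : Summable fun u : S => w u ^ r) (hpr : p * r < 1) : DecaysWith S w p := by
  have hfin : ∀ t, 0 < t → {u ∈ S | t ≤ w u}.Finite := by
    intro t ht
    have h1 := hs.tendsto_cofinite_zero.eventually (gt_mem_nhds (Real.rpow_pos_of_pos ht r))
    rw [eventually_cofinite] at h1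
    refine (h1.image Subtype.val).subset fun u hu => ⟨⟨u, hu.1⟩, ?_, rfl⟩
    exact not_lt.2 (Real.rpow_le_rpow ht.le hu.2 hr.le)
  obtain ⟨e, he⟩ := exists_isOrdering hw hfin
  refine ⟨e, he, ?_⟩
  set A := ∑' u : S, w u ^ r
  have hA : 0 ≤ A := tsum_nonneg fun u => Real.rpow_nonneg (hw u u.2).le r
  have hb : ∀ j : ℕ, (j : ℕ∞) < S.encard →
      w (e j) * ((j : ℝ) + 1) ^ p ≤ A ^ (1 / r) * ((j : ℝ) + 1) ^ (-(1 / r - p)) := by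
    intro j hj
    have hj0 : (0 : ℝ) < (j : ℝ) + 1 := by positivity
    have hlt : ∀ i ∈ Finset.range (j + 1), (i : ℕ∞) < S.encard := fun i hi =>
      lt_of_le_of_lt (by exact_mod_cast Nat.lt_succ_iff.1 (Finset.mem_range.1 hi)) hj
    have h1 : ((j : ℝ) + 1) * w (e j) ^ r ≤ A := by
      have hinj : Set.InjOn e (Finset.range (j + 1) : Set ℕ) := fun i hi i' hi' h =>
        he.1.injOn (hlt i (by simpa using hi)) (hlt i' (by simpa using hi')) h
      calc ((j : ℝ) + 1) * w (e j) ^ r = ∑ i ∈ Finset.range (j + 1), w (e j) ^ r := by simp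
        _ ≤ ∑ i ∈ Finset.range (j + 1), w (e i) ^ r := by
            refine Finset.sum_le_sum fun i hi => Real.rpow_le_rpow
              (hw _ (he.1.mapsTo hj)).le ?_ hr.le
            exact he.2 (hlt i hi) hj (Nat.lt_succ_iff.1 (Finset.mem_range.1 hi))
        _ = ∑ i ∈ (Finset.range (j + 1)).attach, w (e i) ^ r :=
            (Finset.sum_attach _ fun i => w (e i) ^ r).symm
        _ = ∑ u ∈ (Finset.range (j + 1)).attach.map
              ⟨fun i : {i // i ∈ Finset.range (j + 1)} => (⟨e i, he.1.mapsTo (hlt i i.2)⟩ : S), fun i i' h => Subtype.ext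
                (hinj (Finset.mem_coe.2 i.2) (Finset.mem_coe.2 i'.2) (congrArg Subtype.val h))⟩, w u ^ r := by
            rw [Finset.sum_map]
            rfl
        _ ≤ A := hs.sum_le_tsum _ fun u _ => Real.rpow_nonneg (hw u u.2).le r
    have hwj := hw _ (he.1.mapsTo hj)
    have h2 : w (e j) ≤ (A / ((j : ℝ) + 1)) ^ (1 / r) := by
      rw [← Real.rpow_le_rpow_iff hwj.le (by positivity) hr, ← Real.rpow_mul (by positivity),
        one_div_mul_cancel hr.ne', Real.rpow_one, le_div_iff₀ hj0]
      linarith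
    calc w (e j) * ((j : ℝ) + 1) ^ p ≤ (A / ((j : ℝ) + 1)) ^ (1 / r) * ((j : ℝ) + 1) ^ p := by
          gcongr
      _ = _ := by
          rw [Real.div_rpow hA hj0.le, div_eq_mul_inv, ← Real.rpow_neg hj0.le, mul_assoc,
            ← Real.rpow_add hj0]
          congr 2
          ring
  have hp : 0 < 1 / r - p := by
    rw [sub_pos, lt_div_iff₀ hr]
    exact hpr
  have hlim : Tendsto (fun j : ℕ => A ^ (1 / r) * ((j : ℝ) + 1) ^ (-(1 / r - p))) atTop (𝓝 0) := by
    have := (((tendsto_rpow_neg_atTop hp).comp tendsto_natCast_atTop_atTop).comp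
      (tendsto_add_atTop_nat 1)).const_mul (A ^ (1 / r))
    simpa using this
  refine squeeze_zero (fun j => ?_) (fun j => ?_) hlim
  · split_ifs with hj
    · have := hw _ (he.1.mapsTo hj)
      positivity
    · exact le_rfl
  · split_ifs with hj
    · exact hb j hj
    · positivity

end Ordering

/-! ### Weights of product and order-dependent form -/

/-- The elementary symmetric function e_k satisfies e_k t^k ≤ ∏ (1 + t x_j) ≤ exp(tA) for t ≥ 0. The
choice t = k/A gives (eA)^k/k^k, and k! ≤ k^k. -/
theorem sum_prod_powersetCard_le {x : ℕ → ℝ} (hx : ∀ j, 0 ≤ x j) (s : Finset ℕ) {A : ℝ}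
    (hA : 0 < A) (h : ∑ j ∈ s, x j ≤ A) (k : ℕ) :
    ∑ u ∈ s.powersetCard k, ∏ j ∈ u, x j ≤ (Real.exp 1 * A) ^ k / k.factorial := by
  have ht : (0 : ℝ) ≤ k / A := by positivity
  have h1 : (∑ u ∈ s.powersetCard k, ∏ j ∈ u, x j) * (k / A) ^ k ≤ Real.exp 1 ^ k := by
    calc (∑ u ∈ s.powersetCard k, ∏ j ∈ u, x j) * (k / A) ^ k
        = ∑ u ∈ s.powersetCard k, ∏ j ∈ u, (k / A * x j) := by
          rw [Finset.sum_mul]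
          refine Finset.sum_congr rfl fun u hu => ?_
          rw [Finset.prod_mul_distrib, Finset.prod_const, (Finset.mem_powersetCard.1 hu).2,
            mul_comm]
      _ ≤ ∑ u ∈ s.powerset, ∏ j ∈ u, (k / A * x j) :=
          Finset.sum_le_sum_of_subset_of_nonneg
            (fun u hu => Finset.mem_powerset.2 (Finset.mem_powersetCard.1 hu).1)
            fun u _ _ => Finset.prod_nonneg fun j _ => mul_nonneg ht (hx j)
      _ = ∏ j ∈ s, (1 + k / A * x j) := (Finset.prod_one_add s).symm
      _ ≤ ∏ j ∈ s, Real.exp (k / A * x j) := by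
          refine Finset.prod_le_prod (fun j _ => by have := mul_nonneg ht (hx j); linarith)
            fun j _ => ?_
          linarith [Real.add_one_le_exp (k / A * x j)]
      _ = Real.exp (k / A * ∑ j ∈ s, x j) := by rw [← Real.exp_sum, Finset.mul_sum]
      _ ≤ Real.exp k := by
          refine Real.exp_le_exp.2 ?_
          calc k / A * ∑ j ∈ s, x j ≤ k / A * A := by gcongr
            _ = k := by field_simp
      _ = Real.exp 1 ^ k := by rw [← Real.exp_nat_mul, mul_one]
  have h0 : 0 ≤ ∑ u ∈ s.powersetCard k, ∏ j ∈ u, x j :=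
    Finset.sum_nonneg fun u _ => Finset.prod_nonneg fun j _ => hx j
  rw [div_pow, ← mul_div_assoc, div_le_iff₀ (by positivity)] at h1
  rw [le_div_iff₀ (by positivity), mul_pow]
  refine le_trans (mul_le_mul_of_nonneg_left ?_ h0) h1
  exact_mod_cast Nat.factorial_le_pow k

theorem summable_pow_mul_factorial_rpow {Z s : ℝ} (hZ : 0 < Z) (hs : 0 < s) :
    Summable fun k : ℕ => Z ^ k * (k.factorial : ℝ) ^ (-s) := by
  have hpos : ∀ k : ℕ, 0 < Z ^ k * (k.factorial : ℝ) ^ (-s) := fun k =>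
    mul_pos (pow_pos hZ k) (Real.rpow_pos_of_pos (by positivity) _)
  refine summable_of_ratio_test_tendsto_lt_one (l := 0) one_pos
    (Eventually.of_forall fun k => (hpos k).ne') ?_
  have h1 : ∀ k : ℕ, ‖Z ^ (k + 1) * ((k + 1).factorial : ℝ) ^ (-s)‖ /
      ‖Z ^ k * (k.factorial : ℝ) ^ (-s)‖ = Z * (((k + 1 : ℕ) : ℝ) ^ (-s)) := by
    intro k
    rw [Real.norm_of_nonneg (hpos _).le, Real.norm_of_nonneg (hpos _).le,
      div_eq_iff (hpos k).ne', Nat.factorial_succ, Nat.cast_mul,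
      Real.mul_rpow (by positivity) (by positivity), pow_succ]
    ring
  simp only [h1]
  have := (((tendsto_rpow_neg_atTop hs).comp tendsto_natCast_atTop_atTop).comp
    (tendsto_add_atTop_nat 1)).const_mul Z
  simpa using this

section POD

variable {γ : Finset ℕ → ℝ} {Γ g : ℕ → ℝ}

theorem IsPOD.weight_nonneg (h : IsPOD γ Γ g) (u : Finset ℕ) : 0 ≤ γ u := by
  rw [h.eq]
  exact mul_nonneg (h.order_nonneg _) (Finset.prod_nonneg fun j _ => h.nonneg j)

theorem IsPOD.weight_singleton (h : IsPOD γ Γ g) (j : ℕ) : γ {j} = g j := by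
  rw [h.eq, Finset.card_singleton, h.order_one, Finset.prod_singleton, one_mul]

/-- The i-th smallest element of u, counted from 0, is at least i, and g is antitone. -/
theorem IsPOD.weight_le_range (h : IsPOD γ Γ g) (u : Finset ℕ) :
    γ u ≤ γ (Finset.range u.card) := by
  rw [h.eq, h.eq, Finset.card_range]
  refine mul_le_mul_of_nonneg_left ?_ (h.order_nonneg _)
  rw [← Fin.prod_univ_eq_prod_range, ← Finset.prod_coe_sort,
    ← (u.orderIsoOfFin rfl).toEquiv.prod_comp]
  refine Finset.prod_le_prod (fun i _ => h.nonneg _) fun i _ => h.antitone ?_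
  have hle : ∀ n (hn : n < u.card), n ≤ u.orderEmbOfFin rfl ⟨n, hn⟩ := by
    intro n
    induction n with
    | zero => exact fun _ => Nat.zero_le _
    | succ n ih =>
      intro hn
      refine (ih (Nat.lt_of_succ_lt hn)).trans_lt ?_
      exact (u.orderEmbOfFin rfl).strictMono (Fin.mk_lt_mk.2 n.lt_succ_self)
  exact hle i i.2

/-- The symmetric function bound contributes 1/k! and Γ_k^r at most (k!)^(q r). The maximum with 1
covers k = 0, where the bound on Γ is not assumed. -/
theorem IsPOD.sum_powersetCard_le (h : IsPOD γ Γ g) {q Cq r A B : ℝ} (hCq : 0 < Cq)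
    (hΓ : ∀ k : ℕ, 1 ≤ k → Γ k ≤ Cq * (k.factorial : ℝ) ^ q) (hr : 0 < r) (hA : 0 < A)
    (hB : 0 ≤ B) (s : Finset ℕ) (hs : ∑ j ∈ s, g j ^ r ≤ A) (k : ℕ) :
    ∑ u ∈ s.powersetCard k, γ u ^ r * B ^ u.card ≤
      max 1 (Cq ^ r) * ((B * (Real.exp 1 * A)) ^ k * (k.factorial : ℝ) ^ (-(1 - q * r))) := by
  have hk : (0 : ℝ) < k.factorial := by positivity
  have h1 : ∑ u ∈ s.powersetCard k, γ u ^ r * B ^ u.card =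
      Γ k ^ r * B ^ k * ∑ u ∈ s.powersetCard k, ∏ j ∈ u, g j ^ r := by
    rw [Finset.mul_sum]
    refine Finset.sum_congr rfl fun u hu => ?_
    rw [h.eq, (Finset.mem_powersetCard.1 hu).2, Real.mul_rpow (h.order_nonneg _)
      (Finset.prod_nonneg fun j _ => h.nonneg j), Real.finsetProd_rpow _ _ fun j _ => h.nonneg j]
    ring
  have h2 : Γ k ^ r ≤ max 1 (Cq ^ r) * (k.factorial : ℝ) ^ (q * r) := by
    rcases Nat.eq_zero_or_pos k with rfl | hk1
    · simp [h.order_zero]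
    · calc Γ k ^ r ≤ (Cq * (k.factorial : ℝ) ^ q) ^ r :=
            Real.rpow_le_rpow (h.order_nonneg k) (hΓ k hk1) hr.le
        _ = Cq ^ r * (k.factorial : ℝ) ^ (q * r) := by
            rw [Real.mul_rpow hCq.le (by positivity), Real.rpow_mul hk.le]
        _ ≤ _ := by gcongr; exact le_max_right _ _
  rw [h1]
  calc _ ≤ max 1 (Cq ^ r) * (k.factorial : ℝ) ^ (q * r) * B ^ k *
        ((Real.exp 1 * A) ^ k / k.factorial) := by
        have := sum_prod_powersetCard_le (fun j => Real.rpow_nonneg (h.nonneg j) r) s hA hs k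
        gcongr
        exact Finset.sum_nonneg fun u _ => Finset.prod_nonneg fun j _ =>
          Real.rpow_nonneg (h.nonneg j) r
    _ = _ := by
        rw [show -(1 - q * r) = q * r - 1 by ring, Real.rpow_sub_one hk.ne', mul_pow B]
        ring

/-- Any finite family lies in one power set, which splits by cardinality. For q r < 1 a positive
power of 1/k! remains and beats the exponential factor. -/
theorem IsPOD.summable_of_small (h : IsPOD γ Γ g) {q Cq r B : ℝ} (hCq : 0 < Cq)
    (hΓ : ∀ k : ℕ, 1 ≤ k → Γ k ≤ Cq * (k.factorial : ℝ) ^ q) (hr : 0 < r) (hqr : q * r < 1)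
    (hB : 0 < B) (hg : Summable fun j => g j ^ r) :
    Summable fun u : Finset ℕ => γ u ^ r * B ^ u.card := by
  set A := ∑' j, g j ^ r + 1
  have h0 : 0 ≤ ∑' j, g j ^ r := tsum_nonneg fun j => Real.rpow_nonneg (h.nonneg j) r
  have hA : 0 < A := by positivity
  have hs : ∀ s : Finset ℕ, ∑ j ∈ s, g j ^ r ≤ A := fun s =>
    (hg.sum_le_tsum s fun j _ => Real.rpow_nonneg (h.nonneg j) r).trans (le_add_of_nonneg_right one_pos.le)
  have hk : Summable fun k : ℕ => max 1 (Cq ^ r) *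
      ((B * (Real.exp 1 * A)) ^ k * (k.factorial : ℝ) ^ (-(1 - q * r))) :=
    (summable_pow_mul_factorial_rpow (by positivity) (by linarith)).mul_left _
  have hpos : ∀ u, 0 ≤ γ u ^ r * B ^ u.card := fun u =>
    mul_nonneg (Real.rpow_nonneg (h.weight_nonneg u) r) (by positivity)
  refine summable_of_sum_le hpos (c := ∑' k : ℕ, max 1 (Cq ^ r) *
      ((B * (Real.exp 1 * A)) ^ k * (k.factorial : ℝ) ^ (-(1 - q * r)))) fun F => ?_
  calc ∑ u ∈ F, γ u ^ r * B ^ u.card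
      ≤ ∑ u ∈ (F.sup id).powerset, γ u ^ r * B ^ u.card :=
        Finset.sum_le_sum_of_subset_of_nonneg
          (fun u hu => Finset.mem_powerset.2 (Finset.le_sup (f := id) hu)) fun u _ _ => hpos u
    _ = ∑ k ∈ Finset.range ((F.sup id).card + 1), ∑ u ∈ (F.sup id).powersetCard k,
          γ u ^ r * B ^ u.card := Finset.sum_powerset _ _
    _ ≤ ∑ k ∈ Finset.range ((F.sup id).card + 1), max 1 (Cq ^ r) *
          ((B * (Real.exp 1 * A)) ^ k * (k.factorial : ℝ) ^ (-(1 - q * r))) :=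
        Finset.sum_le_sum fun k _ => h.sum_powersetCard_le hCq hΓ hr hA hB.le _ (hs _) k
    _ ≤ _ := hk.sum_le_tsum _ fun k _ => by positivity

theorem summable_rpow_of_le {ι : Type*} {x : ι → ℝ} (hx : ∀ i, 0 ≤ x i) {t : ℝ} (ht : 1 ≤ t)
    (hs : Summable x) : Summable fun i => x i ^ t := by
  have h1 := hs.tendsto_cofinite_zero.eventually (gt_mem_nhds one_pos)
  refine Summable.of_norm_bounded_eventually hs ?_
  filter_upwards [h1] with i hi
  rw [Real.norm_of_nonneg (Real.rpow_nonneg (hx i) t)]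
  exact Real.rpow_le_self_of_le_one (hx i) hi.le ht

/-- Summability of powers of product and order-dependent weights, up to exponential factors, is
decided by the weights of the singletons. -/
theorem IsPOD.summable_weight (h : IsPOD γ Γ g) {q Cq r₁ r B : ℝ} (hCq : 0 < Cq)
    (hΓ : ∀ k : ℕ, 1 ≤ k → Γ k ≤ Cq * (k.factorial : ℝ) ^ q) (hr₁ : 0 < r₁) (hqr₁ : q * r₁ < 1)
    (hg₁ : Summable fun j => g j ^ r₁) (hr : 0 < r) (hB : 0 < B)
    (hg : Summable fun j => g j ^ r) :
    Summable fun u : Finset ℕ => γ u ^ r * B ^ u.card := by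
  by_cases hqr : q * r < 1
  · exact h.summable_of_small hCq hΓ hr hqr hB hg
  -- If q r ≥ 1, then q r₁ < 1 gives r₁ < r. The result for r₁, with base B^(r₁/r), is raised to the
  -- power r/r₁ ≥ 1.
  · have hq : 0 < q := by
      by_contra hq
      have : q * r ≤ 0 := mul_nonpos_of_nonpos_of_nonneg (not_lt.1 hq) hr.le
      linarith
    have hle : 1 ≤ r / r₁ := by
      rw [le_div_iff₀ hr₁, one_mul]
      nlinarith
    have := summable_rpow_of_le (fun u => mul_nonneg (Real.rpow_nonneg (h.weight_nonneg u) r₁)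
      (by positivity)) hle (h.summable_of_small hCq hΓ hr₁ hqr₁
        (Real.rpow_pos_of_pos hB (r₁ / r)) hg₁)
    refine this.congr fun u => ?_
    rw [Real.mul_rpow (Real.rpow_nonneg (h.weight_nonneg u) _) (by positivity),
      ← Real.rpow_mul (h.weight_nonneg u), mul_div_cancel₀ _ hr₁.ne', ← Real.rpow_natCast,
      ← Real.rpow_mul (by positivity), ← Real.rpow_mul hB.le, ← Real.rpow_natCast B]
    congr 2
    field_simp

theorem cutOff_of_le {σ : ℕ∞} {u : Finset ℕ} (hu : (u.card : ℕ∞) ≤ σ) : cutOff γ σ u = γ u :=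
  if_pos hu

theorem IsPOD.cutOff_singleton (h : IsPOD γ Γ g) {σ : ℕ∞} (hσ : 1 ≤ σ) (j : ℕ) :
    cutOff γ σ {j} = g j := by
  rw [cutOff_of_le (by simpa using hσ), h.weight_singleton]

/-- The singletons are at least as summable as any decay rate of the weights indicates. -/
theorem IsPOD.summable_of_lt_decay (h : IsPOD γ Γ g) {σ : ℕ∞} (hσ : 1 ≤ σ) {C₀ r : ℝ}
    (hC₀ : 0 < C₀) (hr : 0 < r) (hdec : ((1 / r : ℝ) : EReal) < decay γ C₀ σ) :
    Summable fun j => g j ^ r := by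
  obtain ⟨p, hp⟩ := lt_iSup_iff.1 hdec
  obtain ⟨hpd, hp⟩ := lt_iSup_iff.1 hp
  have hpr : 1 < p * r := by
    rw [EReal.coe_lt_coe_iff, div_lt_iff₀ hr] at hp
    exact hp
  have hs := hpd.summable (fun u hu => mul_nonneg hu.2.le (by positivity)) hr hpr
  have hmem : ∀ j : {j | 0 < g j}, ({(j : ℕ)} : Finset ℕ) ∈ activeSets (cutOff γ σ) := fun j =>
    ⟨Finset.singleton_nonempty _, by rw [h.cutOff_singleton hσ]; exact j.2⟩
  have hinj : Function.Injective fun j : {j | 0 < g j} =>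
      (⟨{(j : ℕ)}, hmem j⟩ : activeSets (cutOff γ σ)) := fun i j hij => by
    simpa [Subtype.ext_iff] using hij
  have h1 := (hs.comp_injective hinj).mul_right ((C₀ ^ r)⁻¹)
  have h2 : Summable ((fun j => g j ^ r) ∘ (Subtype.val : {j | 0 < g j} → ℕ)) := by
    refine h1.congr fun j => ?_
    simp only [Function.comp_apply, hat, h.cutOff_singleton hσ, Finset.card_singleton, pow_one]
    rw [Real.mul_rpow (h.nonneg j) hC₀.le, mul_inv_cancel_right₀ (Real.rpow_pos_of_pos hC₀ r).ne']
  rw [summable_subtype_iff_indicator] at h2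
  refine h2.congr fun j => ?_
  by_cases hj : 0 < g j
  · rw [Set.indicator_of_mem (show j ∈ {j | 0 < g j} from hj)]
  · rw [Set.indicator_of_notMem (show j ∉ {j | 0 < g j} from hj),
      le_antisymm (not_lt.1 hj) (h.nonneg j), Real.zero_rpow hr.ne']

/-- Converse to `IsPOD.summable_of_lt_decay` for σ = ∞: the singletons control the decay of all
weights, the factor C₀^|u| being harmless. -/
theorem IsPOD.le_decay (h : IsPOD γ Γ g) {q Cq r₁ r C₀ : ℝ} (hCq : 0 < Cq)
    (hΓ : ∀ k : ℕ, 1 ≤ k → Γ k ≤ Cq * (k.factorial : ℝ) ^ q) (hr₁ : 0 < r₁) (hqr₁ : q * r₁ < 1)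
    (hg₁ : Summable fun j => g j ^ r₁) (hr : 0 < r) (hC₀ : 0 < C₀)
    (hg : Summable fun j => g j ^ r) : ((1 / r : ℝ) : EReal) ≤ decay γ C₀ ⊤ := by
  have hs := h.summable_weight hCq hΓ hr₁ hqr₁ hg₁ hr (Real.rpow_pos_of_pos hC₀ r) hg
  refine EReal.ge_of_forall_gt_iff_ge.1 fun p hp => ?_
  rw [EReal.coe_lt_coe_iff, lt_div_iff₀ hr] at hp
  refine le_iSup₂_of_le p (decaysWith_of_summable (fun u hu => mul_pos hu.2 (by positivity)) hr ?_
    hp) le_rfl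
  refine (hs.subtype _).congr fun u => ?_
  simp only [Function.comp_apply, hat]
  rw [cutOff_of_le le_top, Real.mul_rpow (h.weight_nonneg _) (by positivity),
    ← Real.rpow_natCast, ← Real.rpow_natCast, ← Real.rpow_mul hC₀.le, ← Real.rpow_mul hC₀.le,
    mul_comm r]

end POD

/-! ### Sample numbers and active dimension -/

/-- Product and order-dependent weights whose order-dependent part is dominated by the decay of
the product part. -/
structure FastPOD (γ : Finset ℕ → ℝ) (Γ g : ℕ → ℝ) (q Cq r₁ : ℝ) : Prop where
  pod : IsPOD γ Γ g
  Cq_pos : 0 < Cq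
  order_le : ∀ k : ℕ, 1 ≤ k → Γ k ≤ Cq * (k.factorial : ℝ) ^ q
  r₁_pos : 0 < r₁
  q_mul_r₁ : q * r₁ < 1
  summable_r₁ : Summable fun j => g j ^ r₁
  g_zero_pos : 0 < g 0

/-- Weights and parameters for which the changing dimension algorithms are well-behaved. -/
structure Regime (γ : Finset ℕ → ℝ) (Γ g : ℕ → ℝ) (q Cq r₁ l₀ a C τ : ℝ) : Prop
    extends FastPOD γ Γ g q Cq r₁ where
  l₀_pos : 0 < l₀
  l₀_lt : l₀ < 1
  τ_pos : 0 < τ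
  one_le_a : 1 ≤ a
  C_pos : 0 < C
  summable_one_sub : Summable fun j => g j ^ (1 - l₀)
  summable_cost : Summable fun j => g j ^ (l₀ / (2 * τ))

theorem FastPOD.summable_weight {γ : Finset ℕ → ℝ} {Γ g : ℕ → ℝ} {q Cq r₁ r B : ℝ}
    (F : FastPOD γ Γ g q Cq r₁) (hr : 0 < r) (hB : 0 < B) (hg : Summable fun j => g j ^ r) :
    Summable fun u : Finset ℕ => γ u ^ r * B ^ u.card :=
  F.pod.summable_weight F.Cq_pos F.order_le F.r₁_pos F.q_mul_r₁ F.summable_r₁ hr hB hg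

namespace Regime

variable {γ : Finset ℕ → ℝ} {Γ g : ℕ → ℝ} {q Cq r₁ l₀ a C τ : ℝ}
  (R : Regime γ Γ g q Cq r₁ l₀ a C τ)
include R

theorem summable_sumPow : Summable fun u : {u : Finset ℕ // u.Nonempty} => γ u.1 ^ (1 - l₀) := by
  have := R.summable_weight (sub_pos.2 R.l₀_lt) one_pos R.summable_one_sub
  simp only [one_pow, mul_one] at this
  exact this.subtype {u : Finset ℕ | u.Nonempty}

theorem sumPow_pos : 0 < sumPow γ (1 - l₀) := by
  refine R.summable_sumPow.tsum_pos (fun u => Real.rpow_nonneg (R.pod.weight_nonneg _) _)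
    ⟨{0}, Finset.singleton_nonempty 0⟩ ?_
  simp only [R.pod.weight_singleton]
  exact Real.rpow_pos_of_pos R.g_zero_pos _

theorem threshold_nonneg (u : Finset ℕ) : 0 ≤ threshold γ l₀ a C u := by
  have h1 := R.sumPow_pos
  have h2 := R.one_le_a
  have h3 := R.C_pos
  have h4 := Real.rpow_nonneg (R.pod.weight_nonneg u) l₀
  rw [threshold]
  positivity

/-- The factor 2^|u| pays for the evaluations of the inclusion-exclusion formula for one value of
f_u. -/
theorem summable_threshold : Summable fun u : Finset ℕ =>
    threshold γ l₀ a C u ^ (1 / (2 * τ)) * 2 ^ u.card := by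
  have hτ := R.τ_pos
  have h1 := R.sumPow_pos
  have h2 := R.one_le_a
  have h3 := R.C_pos
  have := (R.summable_weight (div_pos R.l₀_pos (by linarith : 0 < 2 * τ))
    (by positivity : (0 : ℝ) < C ^ (1 / (2 * τ)) * 2) R.summable_cost).mul_left
    ((sumPow γ (1 - l₀) * a) ^ (1 / (2 * τ)))
  refine this.congr fun u => ?_
  have h4 := Real.rpow_nonneg (R.pod.weight_nonneg u) l₀
  have hP : 0 ≤ sumPow γ (1 - l₀) * a := by positivity
  rw [threshold, mul_assoc (γ u ^ l₀)]
  generalize sumPow γ (1 - l₀) * a = P at hP ⊢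
  rw [Real.mul_rpow (by positivity) (by positivity), Real.mul_rpow h4 hP, ← Real.rpow_mul (R.pod.weight_nonneg u), mul_pow,
    ← Real.rpow_natCast (C ^ _), ← Real.rpow_mul h3.le, ← Real.rpow_natCast C,
    ← Real.rpow_mul h3.le, mul_one_div, mul_comm (u.card : ℝ)]
  ring

theorem finite_threshold {ε : ℝ} (hε : 0 < ε) :
    {u : Finset ℕ | ε ^ 2 < threshold γ l₀ a C u}.Finite := by
  have hpos : 0 < (ε ^ 2) ^ (1 / (2 * τ)) := by positivity
  have h1 := R.summable_threshold.tendsto_cofinite_zero.eventually (gt_mem_nhds hpos)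
  rw [eventually_cofinite] at h1
  refine h1.subset fun u hu => not_lt.2 ?_
  have hτ := R.τ_pos
  calc (ε ^ 2) ^ (1 / (2 * τ)) ≤ threshold γ l₀ a C u ^ (1 / (2 * τ)) :=
        Real.rpow_le_rpow (by positivity) (le_of_lt hu) (by positivity)
    _ ≤ _ := le_mul_of_one_le_right (Real.rpow_nonneg (R.threshold_nonneg u) _)
        (one_le_pow₀ one_le_two)

omit R in
theorem lt_threshold_of_mem {ε : ℝ} {u : Finset ℕ} (hu : u ∈ usedSets γ l₀ a C τ ε) :
    ε ^ 2 < threshold γ l₀ a C u := by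
  by_contra h
  have := hu.2
  rw [numSamples, if_pos (not_lt.1 h)] at this
  omega

theorem threshold_le_of_notMem {ε : ℝ} (hε : 0 < ε) {u : Finset ℕ} (hu0 : u.Nonempty)
    (hu : u ∉ usedSets γ l₀ a C τ ε) : threshold γ l₀ a C u ≤ ε ^ 2 := by
  by_contra h
  refine hu ⟨hu0, ?_⟩
  rw [numSamples, if_neg h, Nat.one_le_floor_iff]
  have hτ := R.τ_pos
  refine Real.one_le_rpow ?_ (by positivity)
  rw [one_le_div (by positivity)]
  exact (not_le.1 h).le

theorem finite_usedSets {ε : ℝ} (hε : 0 < ε) : (usedSets γ l₀ a C τ ε).Finite :=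
  (R.finite_threshold hε).subset fun _ hu => lt_threshold_of_mem hu

theorem finite_dimSet {ε : ℝ} (hε : 0 < ε) : (dimSet γ l₀ a C ε).Finite := by
  refine Set.Finite.of_finite_image (f := Finset.range)
    ((R.finite_threshold hε).subset ?_) fun i _ j _ hij => by
      simpa using congrArg Finset.card hij
  rintro _ ⟨l, hl, rfl⟩
  exact hl.2

/-- Among sets of a given size the initial segment has the largest threshold, so a used u puts |u|
into `dimSet`. -/
theorem card_le_epsDim {ε : ℝ} (hε : 0 < ε) {u : Finset ℕ} (hu : u ∈ usedSets γ l₀ a C τ ε) :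
    u.card ≤ epsDim γ l₀ a C ε := by
  refine le_csSup (R.finite_dimSet hε).bddAbove ⟨hu.1.card_pos, ?_⟩
  refine (lt_threshold_of_mem hu).trans_le ?_
  have h1 := R.sumPow_pos
  have h2 := R.one_le_a
  have h3 := R.C_pos
  rw [threshold, threshold, Finset.card_range]
  gcongr
  · exact R.pod.weight_nonneg u
  · exact R.l₀_pos.le
  · exact R.pod.weight_le_range u

theorem numSamples_le {ε : ℝ} (hε : 0 < ε) (u : Finset ℕ) :
    (numSamples γ l₀ a C τ ε u : ℝ) ≤
      threshold γ l₀ a C u ^ (1 / (2 * τ)) * ε ^ (-(1 / τ)) := by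
  have hθ := R.threshold_nonneg u
  have hτ := R.τ_pos
  have h1 : (threshold γ l₀ a C u / ε ^ 2) ^ (1 / (2 * τ)) =
      threshold γ l₀ a C u ^ (1 / (2 * τ)) * ε ^ (-(1 / τ)) := by
    rw [Real.div_rpow hθ (by positivity), ← Real.rpow_natCast, ← Real.rpow_mul hε.le,
      div_eq_mul_inv, ← Real.rpow_neg hε.le]
    congr 2
    push_cast
    field_simp
  rw [numSamples]
  split_ifs
  · push_cast
    positivity
  · rw [← h1]
    exact Nat.floor_le (by positivity)

theorem lt_numSamples_add_one {ε : ℝ} (hε : 0 < ε) {u : Finset ℕ}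
    (hu : u ∈ usedSets γ l₀ a C τ ε) :
    threshold γ l₀ a C u / ε ^ 2 ≤ ((numSamples γ l₀ a C τ ε u : ℝ) + 1) ^ (2 * τ) := by
  have hθ := R.threshold_nonneg u
  have hτ := R.τ_pos
  rw [numSamples, if_neg (not_le.2 (lt_threshold_of_mem hu))]
  have h1 := (Nat.lt_floor_add_one ((threshold γ l₀ a C u / ε ^ 2) ^ (1 / (2 * τ)))).le
  have h2 := Real.rpow_le_rpow (by positivity) h1 (by positivity : 0 ≤ 2 * τ)
  rwa [← Real.rpow_mul (by positivity), one_div_mul_cancel (by positivity), Real.rpow_one] at h2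

/-- Superexponential decay of the weights of initial segments bounds the active dimension. -/
theorem exists_mul_log_le : ∃ κ c₁ c₂ : ℝ, 0 < κ ∧ ∀ ε : ℝ, 0 < ε → ∀ l ∈ dimSet γ l₀ a C ε,
    κ * (l * Real.log l) ≤ 2 * Real.log (1 / ε) + c₁ + c₂ * l := by
  have hr := R.r₁_pos
  have hl := R.l₀_pos
  have hL := R.sumPow_pos
  have ha : 0 < a := one_pos.trans_le R.one_le_a
  have hC := R.C_pos
  have hCq := R.Cq_pos
  set A := ∑' j, g j ^ r₁ + 1 with hA
  have h0 : 0 ≤ ∑' j, g j ^ r₁ := tsum_nonneg fun j => Real.rpow_nonneg (R.pod.nonneg j) r₁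
  have hApos : 0 < A := by positivity
  set M := max 1 (Cq ^ r₁)
  have hM : 0 < M := lt_max_of_lt_left one_pos
  set s := 1 - q * r₁
  have hs : 0 < s := sub_pos.2 R.q_mul_r₁
  set t := l₀ / r₁ with ht
  have htpos : 0 < t := div_pos hl hr
  refine ⟨t * s, t * Real.log M + Real.log (sumPow γ (1 - l₀) * a),
    t * Real.log (Real.exp 1 * A) + Real.log C + t * s, by positivity, fun ε hε l hlm => ?_⟩
  have hγ0 := R.pod.weight_nonneg (Finset.range l)
  have hθ : 0 < threshold γ l₀ a C (Finset.range l) := lt_trans (by positivity) hlm.2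
  have hγ : 0 < γ (Finset.range l) := by
    refine hγ0.lt_of_ne fun h => hθ.ne' ?_
    rw [threshold, ← h, Real.zero_rpow hl.ne']
    ring
  have hl1 : (1 : ℝ) ≤ l := by exact_mod_cast hlm.1
  have hfac : (0 : ℝ) < l.factorial := by positivity
  have h1 := R.pod.sum_powersetCard_le R.Cq_pos R.order_le hr hApos zero_le_one (Finset.range l)
    ((R.summable_r₁.sum_le_tsum _ fun j _ => Real.rpow_nonneg (R.pod.nonneg j) r₁).trans
      (le_add_of_nonneg_right one_pos.le)) l
  -- An l-element set has one subset of size l, so the symmetric function estimate bounds a single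
  -- weight.
  have hself : (Finset.range l).powersetCard l = {Finset.range l} := by
    simpa using Finset.powersetCard_self (Finset.range l)
  rw [hself, Finset.sum_singleton, one_pow, mul_one, one_mul] at h1
  have h2 := Real.log_le_log (Real.rpow_pos_of_pos hγ _) h1
  rw [Real.log_rpow hγ, Real.log_mul hM.ne' (by positivity), Real.log_mul (by positivity)
    (by positivity), Real.log_pow, Real.log_rpow hfac] at h2
  have h3 := Real.log_lt_log (by positivity) hlm.2
  rw [threshold, mul_assoc (γ _ ^ l₀), Finset.card_range, Real.log_mul (by positivity)
    (by positivity), Real.log_mul (by positivity) (by positivity), Real.log_rpow hγ, Real.log_pow,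
    Real.log_pow] at h3
  have h4 : (l : ℝ) * Real.log l - l ≤ Real.log l.factorial := by
    -- The weak Stirling bound l^l/l! ≤ e^l.
    have h5 := Real.pow_div_factorial_le_exp (l : ℝ) (by positivity) l
    have h6 := Real.log_le_log (by positivity) h5
    rw [Real.log_exp, Real.log_div (by positivity) hfac.ne', Real.log_pow] at h6
    linarith
  rw [one_div, Real.log_inv]
  have h7 : l₀ * Real.log (γ (Finset.range l)) ≤
      t * (Real.log M + (l * Real.log (Real.exp 1 * A) + -s * Real.log l.factorial)) := by
    have : l₀ * Real.log (γ (Finset.range l)) = t * (r₁ * Real.log (γ (Finset.range l))) := by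
      rw [ht]
      field_simp
    rw [this]
    exact mul_le_mul_of_nonneg_left h2 htpos.le
  have h8 : t * s * (l * Real.log l - l) ≤ t * s * Real.log l.factorial :=
    mul_le_mul_of_nonneg_left h4 (by positivity)
  push_cast at h3
  nlinarith

end Regime

/-- If l ≤ √T, then already √T ≤ T/log T. Otherwise log l ≥ (log T)/2, which is large enough to
absorb the linear term. -/
theorem exists_le_mul_div_log {κ c₁ c₂ : ℝ} (hκ : 0 < κ) : ∃ c : ℝ, 0 < c ∧
    ∀ᶠ T : ℝ in atTop, ∀ l : ℝ, κ * (l * Real.log l) ≤ 2 * T + c₁ + c₂ * l →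
      l ≤ c * (T / Real.log T) := by
  refine ⟨max 1 (12 / κ), lt_max_of_lt_left one_pos, ?_⟩
  have h1 : ∀ᶠ T : ℝ in atTop, ‖Real.log T‖ ≤ 1 * ‖T ^ (1 / 2 : ℝ)‖ :=
    (isLittleO_log_rpow_atTop (by norm_num : (0 : ℝ) < 1 / 2)).bound one_pos
  filter_upwards [h1, eventually_ge_atTop 2, eventually_ge_atTop c₁,
    Real.tendsto_log_atTop.eventually_ge_atTop (4 * |c₂| / κ)] with T h1 hT hc₁ hlog l hl
  have hT0 : 0 < T := by linarith
  have hlogT : 0 < Real.log T := Real.log_pos (by linarith)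
  rw [← Real.sqrt_eq_rpow, Real.norm_of_nonneg hlogT.le, Real.norm_of_nonneg (Real.sqrt_nonneg _),
    one_mul] at h1
  rcases le_total l √T with hle | hle
  · have : √T ≤ T / Real.log T := by
      rw [le_div_iff₀ hlogT]
      nlinarith [Real.mul_self_sqrt hT0.le, Real.sqrt_nonneg T]
    calc l ≤ 1 * (T / Real.log T) := by linarith
      _ ≤ _ := by gcongr; exact le_max_left _ _
  · have hl0 : 0 < l := (Real.sqrt_pos.2 hT0).trans_le hle
    have h2 : Real.log T / 2 ≤ Real.log l := by
      rw [← Real.log_sqrt hT0.le]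
      exact Real.log_le_log (Real.sqrt_pos.2 hT0) hle
    rw [div_le_iff₀ hκ] at hlog
    have h3 : c₂ * l ≤ κ / 2 * (l * Real.log l) := by
      have : c₂ ≤ κ / 2 * Real.log l := by nlinarith [le_abs_self c₂]
      nlinarith
    -- Absorbing c₂ l leaves (κ/2) l log l ≤ 3T; then log l ≥ (log T)/2 gives the 12.
    have h4 : l * Real.log T ≤ 12 / κ * T := by
      rw [div_mul_eq_mul_div, le_div_iff₀ hκ]
      nlinarith [mul_le_mul_of_nonneg_left h2 (mul_pos hκ hl0).le]
    calc l ≤ 12 / κ * (T / Real.log T) := by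
          rw [← mul_div_assoc, le_div_iff₀ hlogT]
          exact h4
      _ ≤ _ := by gcongr; exact le_max_right _ _

theorem tendsto_log_one_div : Tendsto (fun ε : ℝ => Real.log (1 / ε)) (𝓝[>] 0) atTop := by
  simp only [one_div]
  exact Real.tendsto_log_atTop.comp tendsto_inv_nhdsGT_zero

namespace Regime

variable {γ : Finset ℕ → ℝ} {Γ g : ℕ → ℝ} {q Cq r₁ l₀ a C τ : ℝ}
  (R : Regime γ Γ g q Cq r₁ l₀ a C τ)
include R

theorem isBigO_epsDim : (fun ε : ℝ => (epsDim γ l₀ a C ε : ℝ)) =O[𝓝[>] 0]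
    fun ε : ℝ => Real.log (1 / ε) / Real.log (Real.log (1 / ε)) := by
  obtain ⟨κ, c₁, c₂, hκ, hb⟩ := R.exists_mul_log_le
  obtain ⟨c, hc, hT⟩ := exists_le_mul_div_log (c₁ := c₁) (c₂ := c₂) hκ
  refine IsBigO.of_bound c ?_
  filter_upwards [tendsto_log_one_div.eventually hT, self_mem_nhdsWithin,
    tendsto_log_one_div.eventually_ge_atTop 1] with ε hε hε0 hε1
  have hpos : 0 ≤ Real.log (1 / ε) / Real.log (Real.log (1 / ε)) :=
    div_nonneg (by linarith) (Real.log_nonneg hε1)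
  rw [Real.norm_of_nonneg (Nat.cast_nonneg _), Real.norm_of_nonneg hpos]
  rcases Set.eq_empty_or_nonempty (dimSet γ l₀ a C ε) with h | h
  · rw [epsDim, h]
    simp only [csSup_empty, Nat.bot_eq_zero, Nat.cast_zero]
    positivity
  · exact hε _ (hb ε hε0 _ (Nat.sSup_mem h (R.finite_dimSet hε0).bddAbove))

theorem isLittleO_epsDim : (fun ε : ℝ => (epsDim γ l₀ a C ε : ℝ)) =o[𝓝[>] 0]
    fun ε : ℝ => Real.log (1 / ε) := by
  refine R.isBigO_epsDim.trans_isLittleO ?_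
  have h1 : (fun T : ℝ => T / Real.log T) =o[atTop] fun T => T := by
    have := (isBigO_refl (fun T : ℝ => T) atTop).mul_isLittleO ((isLittleO_one_iff ℝ).2
      (tendsto_inv_atTop_zero.comp Real.tendsto_log_atTop))
    simpa [div_eq_mul_inv] using this
  exact h1.comp_tendsto tendsto_log_one_div

end Regime

/-! ### Cost and error of changing dimension algorithms -/

theorem logFactor_pos (l₁ l₂ : ℝ) {k : ℕ} (h : 1 ≤ k) (n : ℕ) : 0 < logFactor l₁ l₂ k n := by
  rw [logFactor]
  split_ifs with hk
  · exact one_pos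
  · have h1 : (1 : ℝ) ≤ k := by exact_mod_cast h
    have h2 : 0 ≤ Real.log ((n : ℝ) + 1) := Real.log_nonneg (by linarith [n.cast_nonneg (α := ℝ)])
    have h3 : 0 ≤ ((k : ℝ) - 1) ^ l₂ := Real.rpow_nonneg (by linarith) _
    positivity

/-- A small slope t in z is bought with the constant -log t; this is log y ≤ y - 1 at y = t(1+z). -/
theorem log_one_add_le {z t : ℝ} (hz : 0 ≤ z) (ht : 0 < t) (ht1 : t ≤ 1) :
    Real.log (1 + z) ≤ t * z - Real.log t := by
  have h1 := Real.log_le_sub_one_of_pos (by positivity : 0 < t * (1 + z))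
  rw [Real.log_mul ht.ne' (by positivity)] at h1
  nlinarith

/-- Multiplying the bound for log(1+z) by s = (k-1)^l₂ cancels the denominator in z, and s ≤ d. Thus
the factor is a small power of n+1 times an exponential in the dimension. -/
theorem logFactor_le {l₁ l₂ t d : ℝ} (hl₁ : 0 ≤ l₁) (hl₂ : l₂ ≤ 1) (ht : 0 < t)
    (ht1 : t ≤ 1) {k n : ℕ} (hk : 1 ≤ k) (hd : (k : ℝ) ≤ d) :
    logFactor l₁ l₂ k n ≤ Real.exp (l₁ * (t * Real.log (n + 1) - d * Real.log t)) := by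
  have hlog : 0 ≤ Real.log ((n : ℝ) + 1) :=
    Real.log_nonneg (by linarith [n.cast_nonneg (α := ℝ)])
  have hlt : Real.log t ≤ 0 := Real.log_nonpos ht.le ht1
  have hd0 : 0 ≤ d := le_trans (Nat.cast_nonneg k) hd
  rw [logFactor]
  split_ifs with hk1
  · refine Real.one_le_exp (mul_nonneg hl₁ ?_)
    nlinarith [mul_nonneg ht.le hlog]
  · have h2 : (2 : ℝ) ≤ k := by exact_mod_cast (by omega : 2 ≤ k)
    set s := ((k : ℝ) - 1) ^ l₂
    have hs : 0 < s := Real.rpow_pos_of_pos (by linarith) _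
    have hsd : s ≤ d := by
      calc s ≤ ((k : ℝ) - 1) ^ (1 : ℝ) := Real.rpow_le_rpow_of_exponent_le (by linarith) hl₂
        _ ≤ d := by rw [Real.rpow_one]; linarith
    have hz : 0 ≤ Real.log ((n : ℝ) + 1) / s := by positivity
    rw [Real.rpow_def_of_pos (by positivity)]
    refine Real.exp_le_exp.2 ?_
    have h3 := log_one_add_le hz ht ht1
    calc Real.log (1 + Real.log ((n : ℝ) + 1) / s) * (l₁ * s)
        ≤ (t * (Real.log ((n : ℝ) + 1) / s) - Real.log t) * (l₁ * s) := by gcongr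
      _ = l₁ * (t * Real.log ((n : ℝ) + 1) - s * Real.log t) := by field_simp
      _ ≤ _ := by
          refine mul_le_mul_of_nonneg_left ?_ hl₁
          nlinarith

theorem costUnr_blockAlg_le {D : Set ℝ} {c : D} {price : ℕ → ℝ} (hp : Monotone price)
    (u : Finset ℕ) {n : ℕ} (q : Fin n → ℝ × (u → D)) :
    costUnr price (blockAlg c u q) ≤ n * 2 ^ u.card * price u.card := by
  rw [costUnr, blockAlg, list_sum_flatMap, ← Fin.sum_univ_def]
  have h1 : ∀ i : Fin n, ((u.powerset.toList.map fun v => ((-1) ^ (u \ v).card * (q i).1,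
      Node.restrict c v fun j => if h : j ∈ u then (q i).2 ⟨j, h⟩ else c)).map
        fun p : ℝ × Node c => price p.2.supp.card).sum ≤ 2 ^ u.card * price u.card := by
    intro i
    rw [List.map_map, Finset.sum_map_toList]
    calc _ ≤ ∑ v ∈ u.powerset, price u.card := by
          refine Finset.sum_le_sum fun v hv => hp ?_
          refine (Finset.card_le_card ?_).trans (Finset.card_le_card (Finset.mem_powerset.1 hv))
          exact Finset.filter_subset _ _
      _ = _ := by simp
  refine (Finset.sum_le_sum fun i _ => (le_of_eq ?_).trans (h1 i)).trans ?_
  · congr!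
  · simp [mul_assoc]

namespace Regime

variable {γ : Finset ℕ → ℝ} {Γ g : ℕ → ℝ} {q Cq r₁ l₀ a C τ : ℝ}
  (R : Regime γ Γ g q Cq r₁ l₀ a C τ)
include R

theorem costUnr_changingDim_le {D : Set ℝ} {c : D} {price : ℕ → ℝ} (hp : Monotone price)
    (hp1 : ∀ k, 1 ≤ price k) (Q : Blocks D) {ε : ℝ} (hε : 0 < ε) :
    costUnr price (changingDim c γ l₀ a C τ Q ε) ≤ price (epsDim γ l₀ a C ε) *
      (1 + ε ^ (-(1 / τ)) * ∑' u, threshold γ l₀ a C u ^ (1 / (2 * τ)) * 2 ^ u.card) := by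
  have hfin := R.finite_usedSets hε
  set d := epsDim γ l₀ a C ε
  have hd : 0 ≤ price d := zero_le_one.trans (hp1 d)
  rw [changingDim, dif_pos hfin, costUnr, List.map_cons, List.sum_cons, list_sum_flatMap,
    Finset.sum_map_toList, mul_add, mul_one]
  refine add_le_add (hp (by simp [Node.restrict])) ?_
  calc _ ≤ ∑ u ∈ hfin.toFinset, price d * ε ^ (-(1 / τ)) *
        (threshold γ l₀ a C u ^ (1 / (2 * τ)) * 2 ^ u.card) := by
        refine Finset.sum_le_sum fun u hu => ?_
        have hu' : u ∈ usedSets γ l₀ a C τ ε := hfin.mem_toFinset.1 hu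
        refine (costUnr_blockAlg_le hp u _).trans ?_
        have h1 := R.numSamples_le hε u
        have h2 := hp (R.card_le_epsDim hε hu')
        have h3 := Real.rpow_nonneg (R.threshold_nonneg u) (1 / (2 * τ))
        calc _ ≤ threshold γ l₀ a C u ^ (1 / (2 * τ)) * ε ^ (-(1 / τ)) * 2 ^ u.card * price d := by
              gcongr
              exact zero_le_one.trans (hp1 _)
          _ = _ := by ring
    _ = price d * ε ^ (-(1 / τ)) * ∑ u ∈ hfin.toFinset,
          threshold γ l₀ a C u ^ (1 / (2 * τ)) * 2 ^ u.card := by rw [Finset.mul_sum]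
    _ ≤ price d * ε ^ (-(1 / τ)) *
          ∑' u, threshold γ l₀ a C u ^ (1 / (2 * τ)) * 2 ^ u.card := by
        refine mul_le_mul_of_nonneg_left ?_ (by positivity)
        exact R.summable_threshold.sum_le_tsum _ fun u _ =>
          mul_nonneg (Real.rpow_nonneg (R.threshold_nonneg u) _) (by positivity)
    _ = _ := by ring

theorem isBigO_costUnr {D : Set ℝ} {c : D} {price : ℕ → ℝ} (hp : Monotone price)
    (hp1 : ∀ k, 1 ≤ price k) (Q : Blocks D) :
    (fun ε : ℝ => costUnr price (changingDim c γ l₀ a C τ Q ε)) =O[𝓝[>] 0]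
      fun ε : ℝ => price (epsDim γ l₀ a C ε) * ε ^ (-(1 / τ)) := by
  have hτ := R.τ_pos
  set A := ∑' u, threshold γ l₀ a C u ^ (1 / (2 * τ)) * 2 ^ u.card
  refine IsBigO.of_bound (1 + A) ?_
  filter_upwards [Ioo_mem_nhdsGT one_pos] with ε hε
  have h0 : 0 ≤ costUnr price (changingDim c γ l₀ a C τ Q ε) := by
    refine List.sum_nonneg ?_
    simp only [List.mem_map]
    rintro _ ⟨p, -, rfl⟩
    exact zero_le_one.trans (hp1 _)
  have hd : 0 ≤ price (epsDim γ l₀ a C ε) := zero_le_one.trans (hp1 _)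
  have h1 : 1 ≤ ε ^ (-(1 / τ)) := Real.one_le_rpow_of_pos_of_le_one_of_nonpos hε.1 hε.2.le
    (by rw [neg_nonpos]; positivity)
  rw [Real.norm_of_nonneg h0, Real.norm_of_nonneg (by positivity)]
  refine (R.costUnr_changingDim_le hp hp1 Q hε.1).trans ?_
  have h2 : price (epsDim γ l₀ a C ε) * 1 ≤ price (epsDim γ l₀ a C ε) * ε ^ (-(1 / τ)) :=
    mul_le_mul_of_nonneg_left h1 hd
  change price (epsDim γ l₀ a C ε) * (1 + ε ^ (-(1 / τ)) * A) ≤ _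
  linarith

/-- Termwise comparison with ε² Λ γ_u^(1-l₀)/L, whose sum over nonempty u is ε² Λ by definition of
L. Used and unused sets meet the same bound. -/
theorem errSq_changingDim_le {D : Set ℝ} {K : D → D → ℝ} {c : D} {ρ : Measure D}
    [IsProbabilityMeasure ρ] (h : Setting K c ρ γ) (hC₀ : 0 < constC₀ K ρ) (hC : constC₀ K ρ ≤ C)
    {l₁ l₂ : ℝ} {Q : Blocks D} (hQ : BlockBound K ρ a C τ l₁ l₂ Q) {ε Λ : ℝ} (hε : 0 < ε)
    (hΛ : 1 ≤ Λ) (hlog : ∀ u ∈ usedSets γ l₀ a C τ ε,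
      logFactor l₁ l₂ u.card (numSamples γ l₀ a C τ ε u) ≤ Λ) :
    errSq (kernelInf K γ) (measureInf K γ ρ) (h.nodes (changingDim c γ l₀ a C τ Q ε)) ≤
      ε ^ 2 * Λ := by
  have hfin := R.finite_usedSets hε
  have hτ := R.τ_pos
  have ha : 0 < a := one_pos.trans_le R.one_le_a
  have hL := R.sumPow_pos
  have hCpos := R.C_pos
  set L := sumPow γ (1 - l₀) with hLdef
  have hs : Summable fun u : Finset ℕ => ({u : Finset ℕ | u.Nonempty}).indicator
      (fun u => ε ^ 2 * Λ * (γ u ^ (1 - l₀) / L)) u := by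
    rw [← summable_subtype_iff_indicator]
    exact (R.summable_sumPow.div_const L).mul_left _
  have htsum : ∑' u : Finset ℕ, ({u : Finset ℕ | u.Nonempty}).indicator
      (fun u => ε ^ 2 * Λ * (γ u ^ (1 - l₀) / L)) u = ε ^ 2 * Λ := by
    rw [← tsum_subtype {u : Finset ℕ | u.Nonempty}, tsum_mul_left, tsum_div_const]
    change ε ^ 2 * Λ * (L / L) = _
    rw [div_self hL.ne', mul_one]
  rw [← (h.hasSum_errSq _).tsum_eq, ← htsum]
  refine (h.hasSum_errSq _).summable.tsum_le_tsum (fun u => ?_) hs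
  have hsplit : 0 < γ u → γ u = γ u ^ l₀ * γ u ^ (1 - l₀) := fun hγ => by
    rw [← Real.rpow_add hγ, add_sub_cancel, Real.rpow_one]
  rcases u.eq_empty_or_nonempty with rfl | hu0
  · rw [h.errSq_changingDim_empty Q hfin, mul_zero]
    refine Set.indicator_nonneg (fun v _ => ?_) _
    have := Real.rpow_nonneg (h.nonneg v) (1 - l₀)
    positivity
  rw [Set.indicator_of_mem (show u ∈ {u : Finset ℕ | u.Nonempty} from hu0)]
  rcases (h.nonneg u).eq_or_lt with hγ | hγ
  · rw [← hγ, zero_mul]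
    have := Real.rpow_nonneg (le_refl (0 : ℝ)) (1 - l₀)
    positivity
  have hr1 := Real.rpow_pos_of_pos hγ (1 - l₀)
  have hr2 := Real.rpow_pos_of_pos hγ l₀
  by_cases hu : u ∈ usedSets γ l₀ a C τ ε
  · rw [h.errSq_changingDim_of_mem Q hfin hu]
    set n := numSamples γ l₀ a C τ ε u with hn
    have hLF := logFactor_pos l₁ l₂ hu0.card_pos n
    have h1 := hQ u n hu0 hu.2
    have hnn : 0 ≤ errSq (kernelOn K u) (Measure.pi fun _ : u => ρ) (List.ofFn (Q u n)) :=
      errSq_nonneg (posSemidef_kernelOn h.psd u)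
        (fun _ => (measurable_kernelOn h.meas u).comp measurable_prodMk_right)
        (integrable_kernelOn_diag h.diag u) _
    rw [worstCaseError_kernelOn h.meas h.psd h.diag, ← ENNReal.ofReal_pow (Real.sqrt_nonneg _),
      Real.sq_sqrt hnn, ENNReal.ofReal_le_ofReal_iff (by positivity)] at h1
    have h2 := R.lt_numSamples_add_one hε hu
    rw [← hn, div_le_iff₀ (by positivity)] at h2
    have hn0 : 0 < ((n : ℝ) + 1) ^ (2 * τ) := by positivity
    calc γ u * errSq (kernelOn K u) (Measure.pi fun _ : u => ρ) (List.ofFn (Q u n))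
        ≤ γ u * (a * C ^ u.card / ((n : ℝ) + 1) ^ (2 * τ) * Λ) := by
          refine mul_le_mul_of_nonneg_left (h1.trans ?_) hγ.le
          exact mul_le_mul_of_nonneg_left (hlog u hu) (by positivity)
      _ = threshold γ l₀ a C u / ((n : ℝ) + 1) ^ (2 * τ) * Λ * (γ u ^ (1 - l₀) / L) := by
          rw [threshold, ← hLdef]
          nth_rewrite 1 [hsplit hγ]
          field_simp
      _ ≤ ε ^ 2 * Λ * (γ u ^ (1 - l₀) / L) := by
          gcongr
          rw [div_le_iff₀ hn0]
          linarith
  -- No samples: the initial error satisfies C₀^|u| ≤ a C^|u|, by a ≥ 1 and C ≥ C₀, and the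
  -- threshold is at most ε².
  · rw [h.errSq_changingDim_of_notMem Q hfin hu0 hu]
    have h1 := R.threshold_le_of_notMem hε hu0 hu
    calc γ u * constC₀ K ρ ^ u.card ≤ γ u * (a * C ^ u.card) := by
          gcongr
          calc constC₀ K ρ ^ u.card ≤ 1 * C ^ u.card := by rw [one_mul]; gcongr
            _ ≤ _ := by gcongr; exact R.one_le_a
      _ = threshold γ l₀ a C u * 1 * (γ u ^ (1 - l₀) / L) := by
          rw [threshold, ← hLdef]
          nth_rewrite 1 [hsplit hγ]
          field_simp
      _ ≤ ε ^ 2 * Λ * (γ u ^ (1 - l₀) / L) := by gcongr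

/-- Here log(n_u+1) = O(log(1/ε)) and d(ε) = o(log(1/ε)), so `logFactor_le` with a small fixed t
gives an arbitrarily small power. -/
theorem eventually_logFactor_le {l₁ l₂ : ℝ} (hl₁ : 0 ≤ l₁) (hl₂ : l₂ ≤ 1) {δ : ℝ} (hδ : 0 < δ) :
    ∀ᶠ ε : ℝ in 𝓝[>] 0, ∀ u ∈ usedSets γ l₀ a C τ ε,
      logFactor l₁ l₂ u.card (numSamples γ l₀ a C τ ε u) ≤ ε ^ (-δ) := by
  have hτ := R.τ_pos
  set A := ∑' u, threshold γ l₀ a C u ^ (1 / (2 * τ)) * 2 ^ u.card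
  have hterm : ∀ u, 0 ≤ threshold γ l₀ a C u ^ (1 / (2 * τ)) * 2 ^ u.card := fun u =>
    mul_nonneg (Real.rpow_nonneg (R.threshold_nonneg u) _) (by positivity)
  have hA : 0 ≤ A := tsum_nonneg hterm
  set b := 1 + 1 / τ with hb
  have hbpos : 0 < b := by positivity
  -- With log(n+1) ≤ b log(1/ε), this gives the sample term half of the exponent δ; the dimension
  -- term gets the other half. Using l₁ + 1 avoids division by zero.
  set t := min 1 (δ / (2 * (l₁ + 1) * b)) with ht
  have htpos : 0 < t := lt_min one_pos (by positivity)
  have ht1 : t ≤ 1 := min_le_left _ _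
  have hlt : Real.log t ≤ 0 := Real.log_nonpos htpos.le ht1
  have hη : 0 < δ / (2 * (l₁ + 1) * (1 - Real.log t)) := by
    have : 0 < 1 - Real.log t := by linarith
    positivity
  filter_upwards [R.isLittleO_epsDim.bound hη, Ioo_mem_nhdsGT one_pos,
    tendsto_log_one_div.eventually_ge_atTop (max 0 (Real.log (1 + A)))] with ε hd hε hT u hu
  set T := Real.log (1 / ε)
  have hT0 : 0 ≤ T := (le_max_left _ _).trans hT
  have hTA : Real.log (1 + A) ≤ T := (le_max_right _ _).trans hT
  rw [Real.norm_of_nonneg (Nat.cast_nonneg _), Real.norm_of_nonneg hT0] at hd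
  set n := numSamples γ l₀ a C τ ε u
  obtain ⟨d, hdd⟩ : ∃ d : ℝ, d = (epsDim γ l₀ a C ε : ℝ) := ⟨_, rfl⟩
  have hd0 : 0 ≤ d := hdd ▸ Nat.cast_nonneg _
  rw [← hdd] at hd
  have hT' : Real.log ε = -T := by simp only [T, one_div, Real.log_inv, neg_neg]
  have hn : Real.log ((n : ℝ) + 1) ≤ b * T := by
    have h1 : (n : ℝ) + 1 ≤ (1 + A) * ε ^ (-(1 / τ)) := by
      have h2 := R.numSamples_le hε.1 u
      have h3 : threshold γ l₀ a C u ^ (1 / (2 * τ)) ≤ A :=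
        (le_mul_of_one_le_right (Real.rpow_nonneg (R.threshold_nonneg u) _)
          (one_le_pow₀ one_le_two)).trans (R.summable_threshold.le_tsum u fun v _ => hterm v)
      have h4 : 1 ≤ ε ^ (-(1 / τ)) := Real.one_le_rpow_of_pos_of_le_one_of_nonpos hε.1 hε.2.le
        (by rw [neg_nonpos]; positivity)
      have h5 := mul_le_mul_of_nonneg_right h3 (zero_le_one.trans h4)
      linarith
    have h2 := Real.log_le_log (by positivity) h1
    rw [Real.log_mul (by positivity) (Real.rpow_pos_of_pos hε.1 _).ne', Real.log_rpow hε.1,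
      hT'] at h2
    rw [hb]
    linarith
  refine (logFactor_le hl₁ hl₂ htpos ht1 hu.1.card_pos
    (hdd ▸ Nat.cast_le.2 (R.card_le_epsDim hε.1 hu))).trans ?_
  rw [Real.rpow_def_of_pos hε.1, hT']
  refine Real.exp_le_exp.2 ?_
  have h1 : t * Real.log ((n : ℝ) + 1) ≤ δ / (2 * (l₁ + 1)) * T := by
    calc t * Real.log ((n : ℝ) + 1) ≤ δ / (2 * (l₁ + 1) * b) * (b * T) := by
          gcongr
          · exact Real.log_nonneg (by linarith [n.cast_nonneg (α := ℝ)])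
          · exact min_le_right _ _
      _ = _ := by field_simp
  have h2 : -(d * Real.log t) ≤ δ / (2 * (l₁ + 1)) * T := by
    have hpos : 0 < 1 - Real.log t := by linarith
    calc -(d * Real.log t) ≤ d * (1 - Real.log t) := by linarith
      _ ≤ δ / (2 * (l₁ + 1) * (1 - Real.log t)) * T * (1 - Real.log t) := by gcongr
      _ = _ := by field_simp
  have h3 : l₁ * (t * Real.log ((n : ℝ) + 1) - d * Real.log t) ≤
      (l₁ + 1) * (δ / (2 * (l₁ + 1)) * T + δ / (2 * (l₁ + 1)) * T) := by
    have h4 : 0 ≤ δ / (2 * (l₁ + 1)) * T := by positivity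
    calc _ ≤ l₁ * (δ / (2 * (l₁ + 1)) * T + δ / (2 * (l₁ + 1)) * T) := by
          refine mul_le_mul_of_nonneg_left ?_ hl₁
          linarith
      _ ≤ _ := by
          refine mul_le_mul_of_nonneg_right (by linarith) (by linarith)
  refine h3.trans (le_of_eq ?_)
  have : l₁ + 1 ≠ 0 := by positivity
  field_simp
  ring

/-- The errors of the changing dimension algorithms are of the order of `ε`, up to an arbitrarily
small loss in the exponent. -/
theorem eventually_algError_le {D : Set ℝ} {K : D → D → ℝ} {c : D} {ρ : Measure D}
    [IsProbabilityMeasure ρ] (h : Setting K c ρ γ) (hC₀ : 0 < constC₀ K ρ) (hC : constC₀ K ρ ≤ C)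
    {l₁ l₂ : ℝ} (hl₁ : 0 ≤ l₁) (hl₂ : l₂ ≤ 1) {Q : Blocks D}
    (hQ : BlockBound K ρ a C τ l₁ l₂ Q) {δ : ℝ} (hδ : 0 < δ) :
    ∀ᶠ ε : ℝ in 𝓝[>] 0,
      √(errSq (kernelInf K γ) (measureInf K γ ρ) (h.nodes (changingDim c γ l₀ a C τ Q ε))) ≤
        ε ^ (1 - δ) := by
  filter_upwards [R.eventually_logFactor_le hl₁ hl₂ (by positivity : 0 < 2 * δ),
    Ioo_mem_nhdsGT one_pos] with ε hlog hε
  have hΛ : 1 ≤ ε ^ (-(2 * δ)) :=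
    Real.one_le_rpow_of_pos_of_le_one_of_nonpos hε.1 hε.2.le (by linarith)
  refine Real.sqrt_le_iff.2 ⟨Real.rpow_nonneg hε.1.le _, ?_⟩
  refine (R.errSq_changingDim_le h hC₀ hC hQ hε.1 hΛ hlog).trans (le_of_eq ?_)
  rw [← Real.rpow_natCast, ← Real.rpow_natCast, ← Real.rpow_add hε.1, ← Real.rpow_mul hε.1.le]
  congr 1
  push_cast
  ring

end Regime

/-- The exact exponent is log A/log ε. Truncating 1 minus it at zero leaves a quantity eventually
below every δ. -/
theorem exists_tendsto_zero_exponent {A : ℝ → ℝ} (hA : ∀ ε, 0 ≤ A ε)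
    (h : ∀ δ : ℝ, 0 < δ → ∀ᶠ ε : ℝ in 𝓝[>] 0, A ε ≤ ε ^ (1 - δ)) :
    ∃ η : ℝ → ℝ, Tendsto η (𝓝[>] 0) (𝓝 0) ∧ ∀ᶠ ε : ℝ in 𝓝[>] 0, A ε ≤ ε ^ (1 - η ε) := by
  classical
  refine ⟨fun ε => if A ε = 0 then 0 else max 0 (1 - Real.log (A ε) / Real.log ε), ?_, ?_⟩
  · rw [Metric.tendsto_nhds]
    intro δ hδ
    filter_upwards [h (δ / 2) (by positivity), Ioo_mem_nhdsGT one_pos] with ε hA' hε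
    split_ifs with h0
    · simpa using hδ
    · have hApos : 0 < A ε := (hA ε).lt_of_ne' h0
      have hl := Real.log_le_log hApos hA'
      rw [Real.log_rpow hε.1] at hl
      have hneg : Real.log ε < 0 := Real.log_neg hε.1 hε.2
      have : 1 - δ / 2 ≤ Real.log (A ε) / Real.log ε := by
        rw [le_div_iff_of_neg hneg]
        exact hl
      rw [Real.dist_eq, sub_zero, abs_of_nonneg (le_max_left _ _)]
      exact max_lt hδ (by linarith)
  · filter_upwards [Ioo_mem_nhdsGT one_pos] with ε hε
    split_ifs with h0
    · rw [h0]
      exact Real.rpow_nonneg hε.1.le _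
    · have hApos : 0 < A ε := (hA ε).lt_of_ne' h0
      have hneg : Real.log ε < 0 := Real.log_neg hε.1 hε.2
      calc A ε = ε ^ (Real.log (A ε) / Real.log ε) := by
            rw [Real.rpow_def_of_pos hε.1, mul_div_cancel₀ _ hneg.ne, Real.exp_log hApos]
        _ ≤ _ := Real.rpow_le_rpow_of_exponent_ge hε.1 hε.2.le
            (by linarith [le_max_right 0 (1 - Real.log (A ε) / Real.log ε)])

/-! ### Decay rates as extended real numbers -/

theorem EReal.one_div_coe (x : ℝ) : 1 / (x : EReal) = ((1 / x : ℝ) : EReal) := by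
  rw [EReal.coe_div, EReal.coe_one]

/-- This is the decay needed for the sum L to converge. -/
theorem one_div_one_sub_lt {d : EReal} (hd : 1 < d) {l₀ : ℝ} (h : (l₀ : EReal) < 1 - 1 / d) :
    l₀ < 1 ∧ ((1 / (1 - l₀) : ℝ) : EReal) < d := by
  induction d with
  | bot => exact absurd hd (by simp)
  | top =>
    rw [EReal.div_top, sub_zero] at h
    exact ⟨by exact_mod_cast h, EReal.coe_lt_top _⟩
  | coe x =>
    have hx : 1 < x := by exact_mod_cast hd
    rw [EReal.one_div_coe, ← EReal.coe_one, ← EReal.coe_sub, EReal.coe_lt_coe_iff] at h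
    have hx0 : 0 < x := by linarith
    have h0 : 0 < 1 / x := by positivity
    refine ⟨by linarith, ?_⟩
    rw [EReal.coe_lt_coe_iff, div_lt_comm₀ (by linarith) hx0]
    linarith

/-- This is the decay needed for the cost series, whose weights carry the power l₀/(2τ). -/
theorem two_mul_div_lt {d : EReal} (hd : 1 < d) {l₀ τ : ℝ} (hl : 0 < l₀)
    (h : (τ : EReal) < l₀ * d / 2) : ((1 / (l₀ / (2 * τ)) : ℝ) : EReal) < d := by
  induction d with
  | bot => exact absurd hd (by simp)
  | top => exact EReal.coe_lt_top _
  | coe x =>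
    have h2 : ((l₀ : EReal) * x / 2) = ((l₀ * x / 2 : ℝ) : EReal) := by
      rw [EReal.coe_div, EReal.coe_mul]
      rfl
    rw [h2, EReal.coe_lt_coe_iff] at h
    rw [EReal.coe_lt_coe_iff, one_div_div, div_lt_iff₀ hl]
    linarith

theorem one_add_two_div_lt {d : EReal} (hd : 1 < d) {z : ℝ} (hz : 0 < z)
    (h : 2 / (d - 1) < (z : EReal)) : ((1 + 2 / z : ℝ) : EReal) < d := by
  induction d with
  | bot => exact absurd hd (by simp)
  | top => exact EReal.coe_lt_top _
  | coe x =>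
    have hx : 1 < x := by exact_mod_cast hd
    have h2 : (2 : EReal) / ((x : EReal) - 1) = ((2 / (x - 1) : ℝ) : EReal) := by
      rw [EReal.coe_div, EReal.coe_sub]
      rfl
    rw [h2, EReal.coe_lt_coe_iff, div_lt_comm₀ (by linarith) hz] at h
    rw [EReal.coe_lt_coe_iff]
    linarith

theorem two_div_le {d : EReal} {p : ℝ} (hp : 0 < p)
    (h : ((1 + 2 / p : ℝ) : EReal) ≤ d) : 2 / (d - 1) ≤ (p : EReal) := by
  induction d with
  | bot => exact absurd (le_bot_iff.1 h) (EReal.coe_ne_bot _)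
  | top =>
    have : (⊤ : EReal) - 1 = ⊤ := rfl
    rw [this, EReal.div_top]
    exact_mod_cast hp.le
  | coe x =>
    have h2 : (2 : EReal) / ((x : EReal) - 1) = ((2 / (x - 1) : ℝ) : EReal) := by
      rw [EReal.coe_div, EReal.coe_sub]
      rfl
    have hp2 : 0 < 2 / p := by positivity
    rw [EReal.coe_le_coe_iff] at h
    rw [h2, EReal.coe_le_coe_iff, div_le_comm₀ (by linarith) hp]
    linarith

theorem two_div_lt_top {d : EReal} (hd : 1 < d) : 2 / (d - 1) < ⊤ := by
  induction d with
  | bot => exact absurd hd (by simp)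
  | top =>
    have : (⊤ : EReal) - 1 = ⊤ := rfl
    rw [this, EReal.div_top]
    exact EReal.zero_lt_top
  | coe x =>
    have h2 : (2 : EReal) / ((x : EReal) - 1) = ((2 / (x - 1) : ℝ) : EReal) := by
      rw [EReal.coe_div, EReal.coe_sub]
      rfl
    rw [h2]
    exact EReal.coe_lt_top _

section Weights

variable {γ : Finset ℕ → ℝ} {Γ g : ℕ → ℝ} {q Cq r₁ C₀ : ℝ}

/-- Take r₁ = 1/p with p strictly between max(1, q) and the decay of the singletons. An active set
forces some g_j > 0, hence g_0 > 0. -/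
theorem IsPOD.exists_fastPOD (hPOD : IsPOD γ Γ g) (hC₀ : 0 < C₀)
    (hactive : ∃ u : Finset ℕ, u.Nonempty ∧ 0 < γ u) (hdecay : 1 < decay γ C₀ 1)
    (hq : (q : EReal) < decay γ C₀ 1) (hCq : 0 < Cq)
    (hΓ : ∀ k : ℕ, 1 ≤ k → Γ k ≤ Cq * (k.factorial : ℝ) ^ q) :
    ∃ r₁ < 1, FastPOD γ Γ g q Cq r₁ := by
  obtain ⟨p, hp, hpd⟩ := EReal.lt_iff_exists_real_btwn.1 (max_lt hdecay hq)
  have hp1 : 1 < p := by exact_mod_cast (le_max_left _ _).trans_lt hp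
  have hqp : q < p := by exact_mod_cast (le_max_right _ _).trans_lt hp
  have hp0 : 0 < p := by linarith
  refine ⟨1 / p, by rw [div_lt_one hp0]; exact hp1, hPOD, hCq, hΓ, by positivity, ?_, ?_, ?_⟩
  · rw [mul_one_div, div_lt_one hp0]
    exact hqp
  · exact hPOD.summable_of_lt_decay le_rfl hC₀ (by positivity) (by rwa [one_div_one_div])
  · obtain ⟨u, ⟨j, hj⟩, hu⟩ := hactive
    refine lt_of_lt_of_le ((hPOD.nonneg j).lt_of_ne fun h => hu.ne' ?_) (hPOD.antitone (Nat.zero_le j))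
    rw [hPOD.eq, Finset.prod_eq_zero hj h.symm, mul_zero]

theorem FastPOD.le_decay (F : FastPOD γ Γ g q Cq r₁) (hC₀ : 0 < C₀) {r : ℝ} (hr : 0 < r)
    (hg : Summable fun j => g j ^ r) : ((1 / r : ℝ) : EReal) ≤ decay γ C₀ ⊤ :=
  F.pod.le_decay F.Cq_pos F.order_le F.r₁_pos F.q_mul_r₁ F.summable_r₁ hr hC₀ hg

theorem FastPOD.one_lt_decay (F : FastPOD γ Γ g q Cq r₁) (hC₀ : 0 < C₀) (hr : r₁ < 1) :
    1 < decay γ C₀ ⊤ := by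
  refine lt_of_lt_of_le ?_ (F.le_decay hC₀ F.r₁_pos F.summable_r₁)
  rw [← EReal.coe_one, EReal.coe_lt_coe_iff, one_lt_div F.r₁_pos]
  exact hr

end Weights

/-! ### Tractability -/

theorem BlockBound.mono {D : Set ℝ} {K : D → D → ℝ} {ρ : Measure D} [IsProbabilityMeasure ρ]
    {a C τ l₁ l₂ : ℝ} {Q : Blocks D} (h : BlockBound K ρ a C τ l₁ l₂ Q) (ha : 0 < a) (hC : 0 < C)
    {a' C' τ' : ℝ} (haa : a ≤ a') (hCC : C ≤ C') (hττ : τ' ≤ τ) :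
    BlockBound K ρ a' C' τ' l₁ l₂ Q := by
  intro u n hu hn
  refine (h u n hu hn).trans (ENNReal.ofReal_le_ofReal ?_)
  have h1 : (1 : ℝ) ≤ (n : ℝ) + 1 := by linarith [n.cast_nonneg (α := ℝ)]
  have h2 := (logFactor_pos l₁ l₂ hu.card_pos n).le
  have h3 : 0 < a' := ha.trans_le haa
  have h4 : 0 < C' := hC.trans_le hCC
  gcongr

section Upper

variable {D : Set ℝ} {K : D → D → ℝ} {c : D} {ρ : Measure D} {γ : Finset ℕ → ℝ}
  [IsProbabilityMeasure ρ] {price : ℕ → ℝ}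

theorem compUnr_le {ε : ℝ} (Q : Algorithm c) (hQ : algError K γ ρ Q ≤ ENNReal.ofReal ε) :
    compUnr K c γ ρ price ε ≤ ENNReal.ofReal (costUnr price Q) :=
  iInf₂_le (f := fun (Q : Algorithm c) (_ : algError K γ ρ Q ≤ ENNReal.ofReal ε) =>
    ENNReal.ofReal (costUnr price Q)) Q hQ

theorem compUnr_antitone : Antitone (compUnr K c γ ρ price) := fun _ _ h =>
  le_iInf₂ fun Q hQ => compUnr_le Q (hQ.trans (ENNReal.ofReal_le_ofReal h))

theorem Setting.compUnr_eq_zero (h : Setting K c ρ γ) {ε : ℝ}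
    (hε : √(errSq (kernelInf K γ) (measureInf K γ ρ) []) ≤ ε) :
    compUnr K c γ ρ price ε = 0 := by
  refine le_antisymm ?_ zero_le
  have h1 : algError K γ ρ ([] : Algorithm c) ≤ ENNReal.ofReal ε := by
    rw [h.algError_eq]
    exact ENNReal.ofReal_le_ofReal hε
  refine (compUnr_le _ h1).trans ?_
  simp [costUnr]

/-- Above the initial error E the empty algorithm is free. Between ε₀ and E, monotonicity bounds the
complexity by its value at ε₀/2, and a larger constant absorbs this. -/
theorem Setting.tractableWith_of_eventually (h : Setting K c ρ γ) {z : ℝ} (hz : 0 ≤ z) {b : ℝ}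
    (hb : 0 ≤ b) (hev : ∀ᶠ ε : ℝ in 𝓝[>] 0, compUnr K c γ ρ price ε ≤ ENNReal.ofReal (b * ε ^ (-z))) :
    TractableWith K c γ ρ price z := by
  obtain ⟨ε₀, hε₀, hsub⟩ := mem_nhdsGT_iff_exists_Ioo_subset.1 hev
  have hε₀ : 0 < ε₀ := hε₀
  set E := √(errSq (kernelInf K γ) (measureInf K γ ρ) [])
  have hE : 0 ≤ E := Real.sqrt_nonneg _
  set B := max b (b * (ε₀ / 2) ^ (-z) * (E + 1) ^ z)
  have hB : 0 ≤ B := hb.trans (le_max_left _ _)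
  refine ⟨hz, B, hB, fun ε hε => ?_⟩
  rcases lt_or_ge ε ε₀ with h1 | h1
  · refine (hsub ⟨hε, h1⟩ : compUnr K c γ ρ price ε ≤ _).trans (ENNReal.ofReal_le_ofReal ?_)
    gcongr
    exact le_max_left _ _
  rcases le_total E ε with h2 | h2
  · rw [h.compUnr_eq_zero h2]
    exact zero_le
  · have h3 : ε₀ / 2 ≤ ε := by linarith
    refine (compUnr_antitone h3).trans ((hsub ⟨half_pos hε₀, half_lt_self hε₀⟩ :
      compUnr K c γ ρ price (ε₀ / 2) ≤ _).trans (ENNReal.ofReal_le_ofReal ?_))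
    have h4 : (E + 1) ^ (-z) ≤ ε ^ (-z) :=
      Real.rpow_le_rpow_of_nonpos hε (by linarith) (by linarith)
    calc b * (ε₀ / 2) ^ (-z) = b * (ε₀ / 2) ^ (-z) * (E + 1) ^ z * (E + 1) ^ (-z) := by
          rw [mul_assoc, ← Real.rpow_add (by positivity), add_neg_cancel, Real.rpow_zero, mul_one]
      _ ≤ B * ε ^ (-z) := by
          gcongr
          exact le_max_right _ _

theorem exists_le_mul_exp {l : ℝ} (hl : 0 ≤ l) (hmono : Monotone price)
    (hp1 : ∀ k, 1 ≤ price k) (hp : price =O[atTop] fun d : ℕ => Real.exp (l * d)) :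
    ∃ b : ℝ, 0 < b ∧ ∀ d, price d ≤ b * Real.exp (l * d) := by
  obtain ⟨b, hb⟩ := hp.bound
  obtain ⟨N, hN⟩ := eventually_atTop.1 hb
  refine ⟨max b (price N), lt_max_of_lt_right (one_pos.trans_le (hp1 N)), fun d => ?_⟩
  rcases le_total N d with h | h
  · have := hN d h
    rw [Real.norm_of_nonneg (zero_le_one.trans (hp1 d)), Real.norm_of_nonneg (Real.exp_pos _).le]
      at this
    exact this.trans (by gcongr; exact le_max_left _ _)
  · calc price d ≤ price N * 1 := by rw [mul_one]; exact hmono h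
      _ ≤ max b (price N) * Real.exp (l * d) := by
          gcongr
          · exact (zero_le_one.trans (hp1 N)).trans (le_max_right _ _)
          · exact le_max_right _ _
          · exact Real.one_le_exp (by positivity)

/-- As d(ε) = o(log(1/ε)), the price e^(l d) costs only ε^(-δ). The error is at most ε^(1-δ), so a
small δ and a change of parameter give any exponent above 1/τ. -/
theorem Regime.tractableWith {Γ g : ℕ → ℝ} {q Cq r₁ l₀ a C τ : ℝ}
    (R : Regime γ Γ g q Cq r₁ l₀ a C τ) (h : Setting K c ρ γ) (hC₀ : 0 < constC₀ K ρ)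
    (hC : constC₀ K ρ ≤ C) {l₁ l₂ : ℝ} (hl₁ : 0 ≤ l₁) (hl₂ : l₂ ≤ 1) {Q : Blocks D}
    (hQ : BlockBound K ρ a C τ l₁ l₂ Q) (hmono : Monotone price) (hp1 : ∀ k, 1 ≤ price k)
    {l : ℝ} (hl : 0 ≤ l) (hp : price =O[atTop] fun d : ℕ => Real.exp (l * d)) {z : ℝ}
    (hz : 1 / τ < z) : TractableWith K c γ ρ price z := by
  have hτ := R.τ_pos
  have hz0 : 0 < z := lt_trans (by positivity) hz
  obtain ⟨b, hb, hpb⟩ := exists_le_mul_exp hl hmono hp1 hp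
  obtain ⟨b', hb', hcost⟩ := (R.isBigO_costUnr (c := c) hmono hp1 Q).exists_pos
  have hzτ : 0 < z - 1 / τ := by linarith
  -- The second bound is the solution of 1/τ + δ = (1-δ) z; the first keeps 1 - δ positive.
  set δ := min (1 / 2) ((z - 1 / τ) / (1 + z)) with hδdef
  have hδ : 0 < δ := lt_min (by norm_num) (by positivity)
  have hδ2 : δ ≤ 1 / 2 := min_le_left _ _
  have hδz : 1 / τ + δ ≤ (1 - δ) * z := by
    have : δ ≤ (z - 1 / τ) / (1 + z) := min_le_right _ _
    rw [le_div_iff₀ (by positivity)] at this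
    linarith
  have hs : 0 < 1 / (1 - δ) := by
    have : 0 < 1 - δ := by linarith
    positivity
  refine h.tractableWith_of_eventually hz0.le (b := b' * b) (by positivity) ?_
  have hlim : Tendsto (fun ε : ℝ => ε ^ (1 / (1 - δ))) (𝓝[>] 0) (𝓝[>] 0) := by
    refine tendsto_nhdsWithin_iff.2 ⟨?_, ?_⟩
    · have := (Real.continuousAt_rpow_const 0 (1 / (1 - δ)) (Or.inr hs.le)).tendsto
      rw [Real.zero_rpow hs.ne'] at this
      exact this.mono_left nhdsWithin_le_nhds
    · filter_upwards [self_mem_nhdsWithin] with ε hε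
      exact Real.rpow_pos_of_pos hε _
  have hmain : ∀ᶠ ε : ℝ in 𝓝[>] 0, compUnr K c γ ρ price (ε ^ (1 - δ)) ≤
      ENNReal.ofReal (b' * b * (ε ^ (1 - δ)) ^ (-z)) := by
    have hη : 0 < δ / (l + 1) := by positivity
    filter_upwards [R.eventually_algError_le h hC₀ hC hl₁ hl₂ hQ hδ, hcost.bound,
      R.isLittleO_epsDim.bound hη, Ioo_mem_nhdsGT one_pos] with ε h1 h2 h3 hε
    have h4 : algError K γ ρ (changingDim c γ l₀ a C τ Q ε) ≤ ENNReal.ofReal (ε ^ (1 - δ)) := by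
      rw [h.algError_eq]
      exact ENNReal.ofReal_le_ofReal h1
    refine (compUnr_le _ h4).trans (ENNReal.ofReal_le_ofReal ?_)
    refine (le_abs_self _).trans (h2.trans ?_)
    have hT : 0 ≤ Real.log (1 / ε) := Real.log_nonneg (by rw [one_le_div hε.1]; exact hε.2.le)
    rw [Real.norm_of_nonneg (Nat.cast_nonneg _), Real.norm_of_nonneg hT] at h3
    have hpr : 0 ≤ price (epsDim γ l₀ a C ε) := zero_le_one.trans (hp1 _)
    have hpow : ∀ y : ℝ, 0 < ε ^ y := fun y => Real.rpow_pos_of_pos hε.1 y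
    rw [Real.norm_of_nonneg (mul_nonneg hpr (hpow _).le), mul_assoc]
    refine mul_le_mul_of_nonneg_left ?_ hb'.le
    have h5 : Real.exp (l * epsDim γ l₀ a C ε) ≤ ε ^ (-δ) := by
      rw [Real.rpow_def_of_pos hε.1]
      refine Real.exp_le_exp.2 ?_
      have h6 : Real.log ε = -Real.log (1 / ε) := by rw [one_div, Real.log_inv, neg_neg]
      rw [h6]
      calc l * (epsDim γ l₀ a C ε : ℝ) ≤ (l + 1) * (δ / (l + 1) * Real.log (1 / ε)) := by
            gcongr
            linarith
        _ = _ := by field_simp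
    calc price (epsDim γ l₀ a C ε) * ε ^ (-(1 / τ))
        ≤ b * ε ^ (-δ) * ε ^ (-(1 / τ)) := by
          refine mul_le_mul_of_nonneg_right ?_ (hpow _).le
          exact (hpb _).trans (by gcongr)
      _ = b * ε ^ (-(1 / τ + δ)) := by
          rw [mul_assoc, ← Real.rpow_add hε.1]
          congr 2
          ring
      _ ≤ b * ε ^ (-((1 - δ) * z)) := by
          refine mul_le_mul_of_nonneg_left ?_ hb.le
          exact Real.rpow_le_rpow_of_exponent_ge hε.1 hε.2.le (by linarith)
      _ = b * (ε ^ (1 - δ)) ^ (-z) := by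
          rw [← Real.rpow_mul hε.1.le]
          congr 2
          ring
  filter_upwards [hlim.eventually hmain, self_mem_nhdsWithin] with ε h1 hε
  rwa [← Real.rpow_mul (le_of_lt hε), one_div_mul_cancel (by linarith), Real.rpow_one] at h1

theorem FastPOD.tractableWith {Γ g : ℕ → ℝ} {q Cq r₁ τ : ℝ} (F : FastPOD γ Γ g q Cq r₁)
    (h : Setting K c ρ γ) (hC₀ : 0 < constC₀ K ρ) (hd : 1 < decay γ (constC₀ K ρ) ⊤)
    (hτ : 0 < τ) (hblocks : HasBlocks K ρ τ) (hmono : Monotone price) (hp1 : ∀ k, 1 ≤ price k)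
    {l : ℝ} (hl : 0 ≤ l) (hp : price =O[atTop] fun d : ℕ => Real.exp (l * d)) {z : ℝ}
    (hz : max (1 / (τ : EReal)) (2 / (decay γ (constC₀ K ρ) ⊤ - 1)) < z) :
    TractableWith K c γ ρ price z := by
  have hzτ : 1 / τ < z := by
    have := (le_max_left _ _).trans_lt hz
    rwa [EReal.one_div_coe, EReal.coe_lt_coe_iff] at this
  have hz0 : 0 < z := lt_trans (by positivity) hzτ
  obtain ⟨p, hp1', hpd⟩ := EReal.lt_iff_exists_real_btwn.1
    (one_add_two_div_lt hd hz0 ((le_max_right _ _).trans_lt hz))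
  rw [EReal.coe_lt_coe_iff] at hp1'
  have hz2 : 2 / z = 2 * (1 / z) := by ring
  have hz1 : 0 < 1 / z := by positivity
  rw [hz2] at hp1'
  have hp0 : 0 < p := by linarith
  -- The midpoint of 1/z and (p-1)/2. Lowering τ to at most x gives 2τ' < p - 1, so with l₀ = 1 -
  -- 1/p both series in `Regime` converge, while 1/τ' < z still holds.
  set x := (1 / z + (p - 1) / 2) / 2 with hx
  set τ' := min τ x with hτ'
  have hzx : 1 / z < τ' := lt_min (by rwa [one_div_lt hz0 hτ]) (by rw [hx]; linarith)
  have hτ'0 : 0 < τ' := hz1.trans hzx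
  have hτ'p : 2 * τ' < p - 1 := by
    have : τ' ≤ x := min_le_right _ _
    rw [hx] at this
    linarith
  obtain ⟨a, C, l₁, l₂, ha, hC, hl₁, hl₂, hl₂', Q, hQ⟩ := hblocks
  have hQ' := hQ.mono ha hC (le_max_left a 1) (le_max_left C (constC₀ K ρ)) (min_le_left τ x)
  have hpinv : 1 / p < 1 := by rw [div_lt_one hp0]; linarith
  have hpinv0 : 0 < 1 / p := by positivity
  have hR : Regime γ Γ g q Cq r₁ (1 - 1 / p) (max a 1) (max C (constC₀ K ρ)) τ' :=
    { F with
      l₀_pos := by linarith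
      l₀_lt := by linarith
      τ_pos := hτ'0
      one_le_a := le_max_right _ _
      C_pos := lt_max_of_lt_left hC
      summable_one_sub := by
        refine F.pod.summable_of_lt_decay le_top hC₀ (by linarith) (lt_of_le_of_lt ?_ hpd)
        rw [EReal.coe_le_coe_iff]
        simp
      summable_cost := by
        have h1 : 0 < 1 - 1 / p := by linarith
        refine F.pod.summable_of_lt_decay le_top hC₀ (by positivity) (lt_of_le_of_lt ?_ hpd)
        rw [EReal.coe_le_coe_iff, one_div_div, div_le_iff₀ h1, mul_sub, mul_one_div_cancel hp0.ne']
        linarith }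
  exact hR.tractableWith h hC₀ (le_max_right _ _) hl₁ hl₂' hQ' hmono hp1 hl hp
    (by rwa [one_div_lt hτ'0 hz0])

end Upper

/-! ### Lower bounds for the complexity -/

section Lower

variable {D : Set ℝ} {K : D → D → ℝ} {c : D} {ρ : Measure D} {γ : Finset ℕ → ℝ}
  [IsProbabilityMeasure ρ] {price : ℕ → ℝ}

/-- The complexity is an infimum that need not be attained; the added 1 makes room for an actual
algorithm. -/
theorem TractableWith.exists_algorithm {p : ℝ} (h : TractableWith K c γ ρ price p) :
    ∃ B : ℝ, 0 ≤ B ∧ ∀ ε : ℝ, 0 < ε → ∃ Q : Algorithm c,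
      algError K γ ρ Q ≤ ENNReal.ofReal ε ∧ costUnr price Q ≤ B * ε ^ (-p) + 1 := by
  obtain ⟨-, B, hB, hb⟩ := h
  refine ⟨B, hB, fun ε hε => ?_⟩
  have hpos : 0 ≤ B * ε ^ (-p) := mul_nonneg hB (Real.rpow_nonneg hε.le _)
  have h1 : compUnr K c γ ρ price ε < ENNReal.ofReal (B * ε ^ (-p) + 1) :=
    (hb ε hε).trans_lt ((ENNReal.ofReal_lt_ofReal_iff (by linarith)).2 (by linarith))
  obtain ⟨Q, hQ⟩ := iInf_lt_iff.1 h1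
  obtain ⟨hQe, hQc⟩ := iInf_lt_iff.1 hQ
  exact ⟨Q, hQe, ((ENNReal.ofReal_lt_ofReal_iff (by linarith)).1 hQc).le⟩

theorem length_le_costUnr (hp1 : ∀ k, 1 ≤ price k) (Q : Algorithm c) :
    (Q.length : ℝ) ≤ costUnr price Q := by
  induction Q with
  | nil => simp [costUnr]
  | cons p Q ih =>
    have := hp1 p.2.supp.card
    simp only [costUnr, List.map_cons, List.sum_cons, List.length_cons] at ih ⊢
    push_cast
    linarith

/-- The coordinates that are active in some node of an algorithm. -/
def activeCoords (Q : Algorithm c) : Finset ℕ := (Q.map fun p => p.2.supp).foldr (· ∪ ·) ∅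

theorem supp_subset_activeCoords {Q : Algorithm c} {p : ℝ × Node c} (hp : p ∈ Q) :
    p.2.supp ⊆ activeCoords Q := by
  induction Q with
  | nil => simp at hp
  | cons p' Q ih =>
    simp only [activeCoords, List.map_cons, List.foldr_cons]
    rcases List.mem_cons.1 hp with rfl | hp
    · exact Finset.subset_union_left
    · exact (ih hp).trans Finset.subset_union_right

theorem card_activeCoords_le {b : ℝ} (hb : ∀ k : ℕ, (k : ℝ) ≤ b * price k) (Q : Algorithm c) :
    ((activeCoords Q).card : ℝ) ≤ b * costUnr price Q := by
  induction Q with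
  | nil => simp [activeCoords, costUnr]
  | cons p Q ih =>
    have h1 : ((p.2.supp ∪ activeCoords Q).card : ℝ) ≤ p.2.supp.card + (activeCoords Q).card := by
      exact_mod_cast Finset.card_union_le _ _
    have h2 := hb p.2.supp.card
    have h3 : costUnr price (p :: Q) = price p.2.supp.card + costUnr price Q := by simp [costUnr]
    have h4 : activeCoords (p :: Q) = p.2.supp ∪ activeCoords Q := rfl
    rw [h3, h4]
    linarith

namespace Setting

variable (h : Setting K c ρ γ)
include h

theorem errSq_kernelInf_le {Q : Algorithm c} {ε : ℝ} (hε : 0 ≤ ε)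
    (hQ : algError K γ ρ Q ≤ ENNReal.ofReal ε) :
    errSq (kernelInf K γ) (measureInf K γ ρ) (h.nodes Q) ≤ ε ^ 2 := by
  rw [h.algError_eq, ENNReal.ofReal_le_ofReal_iff hε] at hQ
  exact Real.sqrt_le_left hε |>.1 hQ

theorem sum_errSq_le {Q : Algorithm c} {ε : ℝ} (hε : 0 ≤ ε)
    (hQ : algError K γ ρ Q ≤ ENNReal.ofReal ε) (F : Finset (Finset ℕ)) :
    ∑ u ∈ F, γ u * errSq (fun x y : domain K γ => prodKer K u x.1 y.1) (measureInf K γ ρ)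
      (h.nodes Q) ≤ ε ^ 2 := by
  refine le_trans ?_ (h.errSq_kernelInf_le hε hQ)
  rw [← (h.hasSum_errSq _).tsum_eq]
  exact (h.hasSum_errSq _).summable.sum_le_tsum _ fun u _ =>
    mul_nonneg (h.nonneg u) (h.errSq_prodKer_nonneg u _)

theorem minError_le {L : List (ℝ × D)} {n : ℕ} (hn : L.length ≤ n) :
    minError K ρ n ≤ ENNReal.ofReal √(errSq K ρ L) := by
  -- Padding with zero coefficients reaches exactly n nodes without changing the functional.
  set L' := L ++ List.replicate (n - L.length) (0, c) with hL'
  have hlen : L'.length = n := by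
    rw [hL', List.length_append, List.length_replicate]
    omega
  have hE : ∀ f, errFun ρ L' f = errFun ρ L f := fun f => by simp [errFun, hL']
  have hS : errSq K ρ L = errSq K ρ L' := by simp only [errSq, hE]
  clear_value L'
  subst hlen
  refine (iInf_le _ L'.get).trans (le_of_eq ?_)
  rw [hS]
  refine worstCaseError_eq h.psd (fun y => h.meas.comp measurable_prodMk_right) h.diag L'
    fun f => ?_
  rw [quad_eq_sum, List.ofFn_get]

/-- Only the term of the first coordinate is kept: there Q acts as a univariate quadrature with as
many nodes. -/
theorem minError_le_of_algError {Q : Algorithm c} {ε : ℝ} (hε : 0 ≤ ε)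
    (hQ : algError K γ ρ Q ≤ ENNReal.ofReal ε) (hγ : 0 < γ {0}) {n : ℕ} (hn : Q.length ≤ n) :
    minError K ρ n ≤ ENNReal.ofReal (ε / √(γ {0})) := by
  have h1 := h.sum_errSq_le hε hQ {{0}}
  have h2 : errSq (fun x y : domain K γ => prodKer K {0} x.1 y.1) (measureInf K γ ρ)
      (h.nodes Q) = errSq K ρ ((h.nodes Q).map fun p => (p.1, p.2.1 0)) := by
    simp only [prodKer, Finset.prod_singleton]
    refine errSq_comp h.meas (h.measurePreserving_eval 0) (P := fun _ => True)
      (fun φ _ => ?_) (fun _ => trivial) trivial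
    rw [List.map_map]
    rfl
  rw [Finset.sum_singleton, h2, ← le_div_iff₀' hγ] at h1
  refine (h.minError_le (L := (h.nodes Q).map fun p => (p.1, p.2.1 0))
    (by simpa [nodes] using hn)).trans (ENNReal.ofReal_le_ofReal ?_)
  refine Real.sqrt_le_iff.2 ⟨by positivity, ?_⟩
  rwa [div_pow, Real.sq_sqrt hγ.le]

/-- Each sample costs at least 1, so n is of order ε^(-p) and ε is at least a constant times ε^(pα).
Hence ε^(pα-1) stays bounded as ε → 0. -/
theorem one_div_le_of_tractableWith (hγ : 0 < γ {0}) (hp1 : ∀ k, 1 ≤ price k) {α b p : ℝ}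
    (hα : 0 < α) (hb : 0 < b)
    (hmin : ∀ᶠ n : ℕ in atTop, ENNReal.ofReal (b * (n : ℝ) ^ (-α)) ≤ minError K ρ n)
    (hp : TractableWith K c γ ρ price p) : 1 / α ≤ p := by
  have hp0 : 0 ≤ p := hp.1
  obtain ⟨B, hB, hQ⟩ := hp.exists_algorithm
  obtain ⟨N, hN⟩ := eventually_atTop.1 hmin
  have hsq : 0 < √(γ {0}) := Real.sqrt_pos.2 hγ
  have key : ∀ ε : ℝ, ε ∈ Set.Ioo (0 : ℝ) 1 →
      ε ^ (p * α - 1) ≤ (b * (B + 3 + N) ^ (-α) * √(γ {0}))⁻¹ := by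
    intro ε hε
    obtain ⟨Q, hQe, hQc⟩ := hQ ε hε.1
    have h1 : 1 ≤ ε ^ (-p) := Real.one_le_rpow_of_pos_of_le_one_of_nonpos hε.1 hε.2.le (by linarith)
    -- Adding N puts n where the lower bound for the minimal error is valid.
    set n := ⌈B * ε ^ (-p) + 1⌉₊ + N with hn
    have hlen : Q.length ≤ n := by
      have : (Q.length : ℝ) ≤ ⌈B * ε ^ (-p) + 1⌉₊ :=
        (length_le_costUnr hp1 Q).trans (hQc.trans (Nat.le_ceil _))
      have : Q.length ≤ ⌈B * ε ^ (-p) + 1⌉₊ := by exact_mod_cast this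
      omega
    have hpos : 0 ≤ B * ε ^ (-p) := by positivity
    have hn1 : (0 : ℝ) < n := by
      have : 0 < ⌈B * ε ^ (-p) + 1⌉₊ := Nat.ceil_pos.2 (by linarith)
      exact_mod_cast (by omega : 0 < n)
    have hnle : (n : ℝ) ≤ (B + 3 + N) * ε ^ (-p) := by
      have h2 := (Nat.ceil_lt_add_one (by linarith : 0 ≤ B * ε ^ (-p) + 1)).le
      have h3 : (N : ℝ) * 1 ≤ N * ε ^ (-p) := by gcongr
      rw [hn]
      push_cast
      linarith
    have h2 := (hN n (by omega)).trans (h.minError_le_of_algError hε.1.le hQe hγ hlen)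
    have hε0 := hε.1
    rw [ENNReal.ofReal_le_ofReal_iff (by positivity), le_div_iff₀ hsq] at h2
    have h3 : ((B + 3 + N) * ε ^ (-p)) ^ (-α) ≤ (n : ℝ) ^ (-α) :=
      Real.rpow_le_rpow_of_nonpos hn1 hnle (by linarith)
    rw [Real.mul_rpow (by positivity) (by positivity), ← Real.rpow_mul hε.1.le] at h3
    have h4 : ε ^ (p * α - 1) * ε = ε ^ (-p * -α) := by
      rw [← Real.rpow_add_one hε.1.ne']
      congr 1
      ring
    have hB3 : 0 < (B + 3 + N) ^ (-α) := by positivity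
    rw [← one_div, le_div_iff₀ (by positivity), ← mul_le_mul_iff_left₀ hε.1, one_mul]
    calc ε ^ (p * α - 1) * (b * (B + 3 + N) ^ (-α) * √(γ {0})) * ε
        = b * ((B + 3 + N) ^ (-α) * (ε ^ (p * α - 1) * ε)) * √(γ {0}) := by ring
      _ ≤ b * (n : ℝ) ^ (-α) * √(γ {0}) := by rw [h4]; gcongr
      _ ≤ ε := h2
  rw [div_le_iff₀ hα]
  by_contra hlt
  have hlim := tendsto_rpow_neg_nhdsGT_zero (y := p * α - 1) (by linarith)
  obtain ⟨ε, h1, h2⟩ := ((hlim.eventually_gt_atTop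
    (b * (B + 3 + N) ^ (-α) * √(γ {0}))⁻¹).and (Ioo_mem_nhdsGT one_pos)).exists
  exact absurd (key ε h2) (not_le.2 h1)

theorem errSq_singleton_of_notMem {Q : Algorithm c} {j : ℕ} (hj : j ∉ activeCoords Q) :
    errSq (fun x y : domain K γ => prodKer K {j} x.1 y.1) (measureInf K γ ρ) (h.nodes Q) =
      constC₀ K ρ := by
  rw [h.errSq_prodKer_eq (L := []) fun φ hφ => ?_, errSq_kernelOn_nil]
  · simp
  · rw [List.map_nil, List.sum_nil]
    refine List.sum_eq_zero fun y hy => ?_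
    obtain ⟨p, hp, rfl⟩ := List.mem_map.1 hy
    have : p.2.pt j = c := by
      by_contra hne
      exact hj (supp_subset_activeCoords hp ((p.2.pt_ne_iff j).1 hne))
    rw [hφ _ ⟨⟨j, Finset.mem_singleton_self j⟩, this⟩, mul_zero]

/-- At least m of the first 2m coordinates are untouched, and each contributes its full initial
error, of weight at least g(2m). -/
theorem mul_weight_le {Γ g : ℕ → ℝ} (hPOD : IsPOD γ Γ g) (hC₀ : 0 < constC₀ K ρ)
    {Q : Algorithm c} {ε : ℝ} (hε : 0 ≤ ε) (hQ : algError K γ ρ Q ≤ ENNReal.ofReal ε) {m : ℕ}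
    (hm : (activeCoords Q).card ≤ m) : m * g (2 * m) * constC₀ K ρ ≤ ε ^ 2 := by
  set F := Finset.range (2 * m) \ activeCoords Q
  have hF : m ≤ F.card := by
    have : _ ≤ F.card := Finset.le_card_sdiff (activeCoords Q) (Finset.range (2 * m))
    rw [Finset.card_range] at this
    omega
  refine le_trans ?_ (h.sum_errSq_le hε hQ (F.map ⟨fun j => {j}, Finset.singleton_injective⟩))
  rw [Finset.sum_map]
  have h1 : ∀ j ∈ F, g (2 * m) * constC₀ K ρ ≤ γ {j} *
      errSq (fun x y : domain K γ => prodKer K {j} x.1 y.1) (measureInf K γ ρ) (h.nodes Q) := by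
    intro j hj
    have hj' := Finset.mem_sdiff.1 hj
    rw [h.errSq_singleton_of_notMem hj'.2, hPOD.weight_singleton]
    gcongr
    exact hPOD.antitone (Finset.mem_range.1 hj'.1).le
  calc m * g (2 * m) * constC₀ K ρ ≤ F.card * (g (2 * m) * constC₀ K ρ) := by
        rw [mul_assoc]
        have := hPOD.nonneg (2 * m)
        gcongr
    _ = ∑ j ∈ F, g (2 * m) * constC₀ K ρ := by rw [Finset.sum_const, nsmul_eq_mul]
    _ ≤ _ := Finset.sum_le_sum h1

/-- Cost bounds the number of touched coordinates. Choosing ε so that at most m are touched turns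
`mul_weight_le` into g(2m) = O(m^(-(1+2/p))). -/
theorem summable_of_tractableWith {Γ g : ℕ → ℝ} (hPOD : IsPOD γ Γ g) (hC₀ : 0 < constC₀ K ρ)
    {b : ℝ} (hb1 : 1 ≤ b) (hb : ∀ k : ℕ, (k : ℝ) ≤ b * price k) {p : ℝ} (hp0 : 0 < p)
    (hp : TractableWith K c γ ρ price p) {r : ℝ} (hr : 0 < r) (hrp : 1 < (1 + 2 / p) * r) :
    Summable fun j => g j ^ r := by
  obtain ⟨B, hB, hQ⟩ := hp.exists_algorithm
  have hb0 : 0 < b := by linarith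
  -- With ε^(-p) = m/s below, b B ε^(-p) ≤ m/2; together with 2b ≤ m this bounds the touched
  -- coordinates by m.
  set s := 2 * b * (B + 1) with hs
  have hs0 : 0 < s := by positivity
  set κ := 1 + 2 / p with hκ
  have hκ0 : 0 < κ := by positivity
  set A := s ^ (2 / p) / constC₀ K ρ with hA
  have hA0 : 0 < A := by positivity
  have h1 : ∀ m : ℕ, 0 < m → 2 * b ≤ m → g (2 * m) ≤ A * (m : ℝ) ^ (-κ) := by
    intro m hm0 hm
    have hm0 : (0 : ℝ) < m := by exact_mod_cast hm0
    set ε := ((m : ℝ) / s) ^ (-(1 / p)) with hε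
    have hε0 : 0 < ε := by positivity
    obtain ⟨Q, hQe, hQc⟩ := hQ ε hε0
    have h2 : ε ^ (-p) = m / s := by
      rw [hε, ← Real.rpow_mul (by positivity), neg_mul_neg, one_div_mul_cancel hp0.ne',
        Real.rpow_one]
    have h3 : ((activeCoords Q).card : ℝ) ≤ m := by
      refine (card_activeCoords_le hb Q).trans ?_
      rw [h2] at hQc
      have h4 : b * (B * (m / s)) ≤ m / 2 := by
        rw [hs]
        calc b * (B * (m / (2 * b * (B + 1)))) = m / 2 * (B / (B + 1)) := by field_simp
          _ ≤ m / 2 * 1 := by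
              gcongr
              rw [div_le_one (by positivity)]
              linarith
          _ = _ := mul_one _
      have := mul_le_mul_of_nonneg_left hQc hb0.le
      linarith
    have h4 := h.mul_weight_le hPOD hC₀ hε0.le hQe (m := m) (by exact_mod_cast h3)
    have h5 : ε ^ 2 = (m : ℝ) ^ (-(2 / p)) * s ^ (2 / p) := by
      rw [hε, ← Real.rpow_natCast, ← Real.rpow_mul (by positivity), Real.div_rpow hm0.le hs0.le,
        div_eq_mul_inv, ← Real.rpow_neg hs0.le]
      congr 2 <;> push_cast <;> ring
    rw [h5] at h4
    have h6 : (m : ℝ) ^ (-κ) = (m : ℝ) ^ (-(2 / p)) / m := by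
      rw [hκ, neg_add', ← Real.rpow_sub_one hm0.ne']
      congr 1
      ring
    rw [h6, hA, ← mul_div_assoc, le_div_iff₀ hm0, div_mul_eq_mul_div, le_div_iff₀ hC₀]
    linarith
  have hsum : Summable fun n : ℕ => (A * (3 : ℝ) ^ κ) ^ r * (n : ℝ) ^ (-(κ * r)) :=
    (Real.summable_nat_rpow.2 (by linarith)).mul_left _
  refine Summable.of_norm_bounded_eventually_nat hsum ?_
  filter_upwards [eventually_ge_atTop (2 * ⌈2 * b⌉₊ + 2)] with n hn
  have hm2 : ⌈2 * b⌉₊ + 1 ≤ n / 2 := by omega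
  have hm3 : 2 * b ≤ ((n / 2 : ℕ) : ℝ) := (Nat.le_ceil _).trans (by exact_mod_cast (by omega))
  have hn3 : (n : ℝ) / 3 ≤ ((n / 2 : ℕ) : ℝ) := by
    rw [div_le_iff₀ (by norm_num)]
    exact_mod_cast (by omega)
  have hn0 : (0 : ℝ) < n := by exact_mod_cast (by omega : 0 < n)
  rw [Real.norm_of_nonneg (Real.rpow_nonneg (hPOD.nonneg n) r), ← neg_mul,
    Real.rpow_mul hn0.le, ← Real.mul_rpow (by positivity) (by positivity)]
  refine Real.rpow_le_rpow (hPOD.nonneg n) ?_ hr.le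
  calc g n ≤ g (2 * (n / 2)) := hPOD.antitone (by omega)
    _ ≤ A * ((n / 2 : ℕ) : ℝ) ^ (-κ) := h1 _ (by omega) hm3
    _ ≤ A * ((n : ℝ) / 3) ^ (-κ) := by
        refine mul_le_mul_of_nonneg_left ?_ hA0.le
        exact Real.rpow_le_rpow_of_nonpos (by positivity) hn3 (by linarith)
    _ = A * (3 : ℝ) ^ κ * (n : ℝ) ^ (-κ) := by
        rw [Real.div_rpow hn0.le (by norm_num), Real.rpow_neg (by norm_num : (0 : ℝ) ≤ 3),
          div_inv_eq_mul]
        ring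

theorem two_div_decay_le {Γ g : ℕ → ℝ} {q Cq r₁ : ℝ} (F : FastPOD γ Γ g q Cq r₁)
    (hC₀ : 0 < constC₀ K ρ) {b : ℝ} (hb1 : 1 ≤ b) (hb : ∀ k : ℕ, (k : ℝ) ≤ b * price k) {p : ℝ}
    (hp0 : 0 < p) (hp : TractableWith K c γ ρ price p) :
    2 / (decay γ (constC₀ K ρ) ⊤ - 1) ≤ (p : EReal) := by
  refine two_div_le hp0 (EReal.ge_of_forall_gt_iff_ge.1 fun y hy => ?_)
  rw [EReal.coe_lt_coe_iff] at hy
  have hp2 : 0 < 2 / p := by positivity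
  -- The maximum keeps the summability exponent 1/x meaningful when y is not positive.
  set x := max y 1 with hx
  have hx1 : 1 ≤ x := le_max_right _ _
  have hxp : x < 1 + 2 / p := max_lt hy (by linarith)
  have hx0 : 0 < x := by linarith
  have hs := h.summable_of_tractableWith F.pod hC₀ hb1 hb hp0 hp (r := 1 / x) (by positivity)
    (by rwa [mul_one_div, one_lt_div hx0])
  have := F.le_decay hC₀ (by positivity) hs
  rw [one_div_one_div] at this
  exact le_trans (EReal.coe_le_coe_iff.2 (le_max_left y 1)) this

end Setting

theorem exists_le_mul_price (hp1 : ∀ k, 1 ≤ price k) (hp : (fun d : ℕ => (d : ℝ)) =O[atTop] price) :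
    ∃ b : ℝ, 1 ≤ b ∧ ∀ k : ℕ, (k : ℝ) ≤ b * price k := by
  obtain ⟨b, hb⟩ := hp.bound
  obtain ⟨N, hN⟩ := eventually_atTop.1 hb
  refine ⟨max 1 (max b N), le_max_left _ _, fun k => ?_⟩
  have hk : 0 ≤ price k := zero_le_one.trans (hp1 k)
  rcases le_total N k with h | h
  · have := hN k h
    rw [Real.norm_of_nonneg (Nat.cast_nonneg k), Real.norm_of_nonneg hk] at this
    refine this.trans (mul_le_mul_of_nonneg_right ?_ hk)
    exact (le_max_left _ _).trans (le_max_right _ _)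
  · calc (k : ℝ) ≤ N * 1 := by rw [mul_one]; exact_mod_cast h
      _ ≤ max 1 (max b N) * price k := by
          refine mul_le_mul ((le_max_right _ _).trans (le_max_right _ _)) (hp1 k) zero_le_one ?_
          exact zero_le_one.trans (le_max_left _ _)

end Lower

end InfInt

end

/-! ### Assembly of the error, cost and exponent statements. -/

theorem mainTheorem5 {D : Set ℝ} (hD : MeasurableSet D)
    (K : D → D → ℝ) (hKmeas : Measurable (Function.uncurry K))
    (hKpos : (Matrix.of K).PosSemidef)
    (c : D) (hKc : K c c = 0)
    (ρ : Measure D) [IsProbabilityMeasure ρ]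
    (hM : Integrable (fun x => K x x) ρ) (hC₀ : 0 < constC₀ K ρ)
    (γ : Finset ℕ → ℝ) (Γ g : ℕ → ℝ) (hPOD : IsPOD γ Γ g)
    (hsum : Summable fun u : Finset ℕ => γ u * constM K ρ ^ u.card)
    (hactive : ∃ u : Finset ℕ, u.Nonempty ∧ 0 < γ u)
    (hdecay : 1 < decay γ (constC₀ K ρ) 1)
    (q Cq : ℝ) (hq : (q : EReal) < decay γ (constC₀ K ρ) 1) (hCq : 0 < Cq)
    (hΓ : ∀ k : ℕ, 1 ≤ k → Γ k ≤ Cq * (k.factorial : ℝ) ^ q)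
    (price : ℕ → ℝ) (hprice_mono : Monotone price) (hprice_one : ∀ k, 1 ≤ price k) :
    -- error and cost of the changing dimension algorithms
    (∀ l₀ τ a C l₁ l₂ : ℝ, 0 < l₀ → (l₀ : EReal) < 1 - 1 / decay γ (constC₀ K ρ) ⊤ →
      0 < τ → (τ : EReal) < l₀ * decay γ (constC₀ K ρ) ⊤ / 2 →
      1 ≤ a → constC₀ K ρ ≤ C → 0 ≤ l₁ → 0 ≤ l₂ → l₂ ≤ 1 →
      ∀ Q : Blocks D, BlockBound K ρ a C τ l₁ l₂ Q →
        (∀ ε : ℝ, 0 < ε → (usedSets γ l₀ a C τ ε).Finite ∧ (dimSet γ l₀ a C ε).Finite ∧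
          ∀ u ∈ usedSets γ l₀ a C τ ε, u.card ≤ epsDim γ l₀ a C ε) ∧
        (∃ η : ℝ → ℝ, Tendsto η (𝓝[>] 0) (𝓝 0) ∧ ∀ᶠ ε in 𝓝[>] (0 : ℝ),
          algError K γ ρ (changingDim c γ l₀ a C τ Q ε) ≤ ENNReal.ofReal (ε ^ (1 - η ε))) ∧
        ((fun ε : ℝ => costUnr price (changingDim c γ l₀ a C τ Q ε)) =O[𝓝[>] 0]
          fun ε : ℝ => price (epsDim γ l₀ a C ε) * ε ^ (-(1 / τ))) ∧
        ((fun ε : ℝ => (epsDim γ l₀ a C ε : ℝ)) =O[𝓝[>] 0]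
          fun ε : ℝ => Real.log (1 / ε) / Real.log (Real.log (1 / ε))) ∧
        ((fun ε : ℝ => (epsDim γ l₀ a C ε : ℝ)) =o[𝓝[>] 0] fun ε : ℝ => Real.log (1 / ε))) ∧
    -- the upper bound for the exponent of strong tractability
    ((∃ l : ℝ, 0 ≤ l ∧ price =O[atTop] fun d : ℕ => Real.exp (l * d)) →
      (∀ τ : ℝ, 0 < τ → HasBlocks K ρ τ →
        StronglyTractable K c γ ρ price ∧
        expUnr K c γ ρ price ≤
          max (1 / (τ : EReal)) (2 / (decay γ (constC₀ K ρ) ⊤ - 1))) ∧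
      -- the exact exponent of strong tractability
      (∀ α : ℝ, 0 < α →
        ((fun d : ℕ => (d : ℝ)) =O[atTop] price) →
        (∃ b : ℝ, 0 < b ∧ ∀ᶠ n : ℕ in atTop,
          ENNReal.ofReal (b * (n : ℝ) ^ (-α)) ≤ minError K ρ n) →
        (∀ δ : ℝ, 0 < δ → ∃ τ : ℝ, 0 < τ ∧ |τ - α| < δ ∧ HasBlocks K ρ τ) →
        expUnr K c γ ρ price =
          max (1 / (α : EReal)) (2 / (decay γ (constC₀ K ρ) ⊤ - 1)))) := by
  have hS : Setting K c ρ γ := ⟨hKmeas, hKpos, hKc, hM, hPOD.weight_nonneg, hsum⟩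
  obtain ⟨r₁, hr₁, F⟩ := hPOD.exists_fastPOD hC₀ hactive hdecay hq hCq hΓ
  have hd := F.one_lt_decay hC₀ hr₁
  refine ⟨?_, ?_⟩
  · intro l₀ τ a C l₁ l₂ hl₀ hl₀d hτ hτd ha hC hl₁ _ hl₂ Q hQ
    obtain ⟨hl₀1, hdec⟩ := one_div_one_sub_lt hd hl₀d
    have R : Regime γ Γ g q Cq r₁ l₀ a C τ :=
      { F with
        l₀_pos := hl₀
        l₀_lt := hl₀1
        τ_pos := hτ
        one_le_a := ha
        C_pos := hC₀.trans_le hC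
        summable_one_sub := hPOD.summable_of_lt_decay le_top hC₀ (sub_pos.2 hl₀1) hdec
        summable_cost := hPOD.summable_of_lt_decay le_top hC₀ (by positivity)
          (two_mul_div_lt hd hl₀ hτd) }
    refine ⟨fun ε hε => ⟨R.finite_usedSets hε, R.finite_dimSet hε, fun u hu =>
      R.card_le_epsDim hε hu⟩, ?_, R.isBigO_costUnr hprice_mono hprice_one Q, R.isBigO_epsDim,
      R.isLittleO_epsDim⟩
    obtain ⟨η, hη, hle⟩ := exists_tendsto_zero_exponent (fun ε => Real.sqrt_nonneg _)
      fun δ hδ => R.eventually_algError_le hS hC₀ hC hl₁ hl₂ hQ hδ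
    refine ⟨η, hη, hle.mono fun ε hε => ?_⟩
    rw [hS.algError_eq]
    exact ENNReal.ofReal_le_ofReal hε
  · rintro ⟨l, hl, hprice⟩
    have hupper : ∀ τ : ℝ, 0 < τ → HasBlocks K ρ τ → ∀ z : ℝ,
        max (1 / (τ : EReal)) (2 / (decay γ (constC₀ K ρ) ⊤ - 1)) < z →
        TractableWith K c γ ρ price z := fun τ hτ hb z hz =>
      F.tractableWith hS hC₀ hd hτ hb hprice_mono hprice_one hl hprice hz
    have hexp : ∀ z : ℝ, TractableWith K c γ ρ price z → expUnr K c γ ρ price ≤ (z : EReal) :=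
      fun z hz => iInf₂_le z hz
    refine ⟨fun τ hτ hb => ⟨?_, ?_⟩, ?_⟩
    · have hlt : max (1 / (τ : EReal)) (2 / (decay γ (constC₀ K ρ) ⊤ - 1)) < ⊤ :=
        max_lt (by rw [EReal.one_div_coe]; exact EReal.coe_lt_top _) (two_div_lt_top hd)
      obtain ⟨z, hz, -⟩ := EReal.lt_iff_exists_real_btwn.1 hlt
      exact ⟨z, hupper τ hτ hb z hz⟩
    · exact EReal.le_of_forall_lt_iff_le.1 fun z hz => hexp z (hupper τ hτ hb z hz)
    · intro α hα hprice' hmin hblocks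
      refine le_antisymm ?_ ?_
      · refine EReal.le_of_forall_lt_iff_le.1 fun z hz => ?_
        have hzα : 1 / α < z := by
          have := (le_max_left _ _).trans_lt hz
          rwa [EReal.one_div_coe, EReal.coe_lt_coe_iff] at this
        have hz0 : 0 < z := lt_trans (by positivity) hzα
        -- This distance from α ensures τ > 1/z, so the upper bound for τ already covers z.
        obtain ⟨τ, hτ, hτα, hb⟩ := hblocks (α - 1 / z) (by rw [sub_pos]; rwa [one_div_lt hz0 hα])
        have hτz : 1 / τ < z := by
          rw [one_div_lt hτ hz0]
          linarith [(abs_lt.1 hτα).1]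
        refine hexp z (hupper τ hτ hb z (max_lt ?_ ((le_max_right _ _).trans_lt hz)))
        rwa [EReal.one_div_coe, EReal.coe_lt_coe_iff]
      · obtain ⟨b, hb, hmin⟩ := hmin
        obtain ⟨b', hb', hprice''⟩ := exists_le_mul_price hprice_one hprice'
        refine le_iInf₂ fun p hp => ?_
        have h1 : 1 / α ≤ p := hS.one_div_le_of_tractableWith
          (by rw [hPOD.weight_singleton]; exact F.g_zero_pos) hprice_one hα hb hmin hp
        -- The bound 1/α ≤ p also supplies the positivity of p needed for the decay estimate.
        refine max_le ?_ (hS.two_div_decay_le F hC₀ hb' hprice'' (lt_of_lt_of_le (by positivity) h1)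
          hp)
        rwa [EReal.one_div_coe, EReal.coe_le_coe_iff]
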